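/- Let $\nu\neq 0$ be a measure on $(0,\infty)$ with $\int\min(1,z)\,\nu(\mathrm dz)<\infty$. There are constants $C>0$ and $\epsilon_0\in(0,1)$, depending only on $\nu$, such that the following holds for every pure-jump (driftless) subordinator $X$ with Lévy measure $\nu$, i.e. every Lévy process with $X_0=0$, nondecreasing right-continuous paths and $\mathsf E e^{-uX_t}=\exp\big(-t\int(1-e^{-uz})\,\nu(\mathrm dz)\big)$ for $u\ge 0$. Put $I_{[X]}=\int_0^\infty e^{-X_t}\,\mathrm dt$. For $\epsilon\in(0,1)$ let $X^{(\epsilon)}_t=\sum_{0<s\le t}\epsilon\lfloor (X_s-X_{s-})/\epsilon\rfloor$ be the lattice process obtained by rounding every jump of $X$ down to a multiple of $\epsilon$, let $I_{[X^{(\epsilon)}]}=\int_0^\infty e^{-X^{(\epsilon)}_t}\,\mathrm dt$, and set $$\upsilon_{\epsilon,k}=\nu\big([\epsilon k,\epsilon(k+1))\big)\ (k\ge 1),\qquad \varrho(\epsilon)=\Big(\int_0^\epsilon\nu([z,\infty))\,\mathrm dz\Big)^{1/2},$$ $$c_{\epsilon,0}=1,\qquad c_{\epsilon,j}=\frac{1}{(1-e^{\epsilon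 j})\sum_{k=1}^\infty\upsilon_{\epsilon,k}}\sum_{k=1}^{j}e^{\epsilon k}c_{\epsilon,j-k}\,\upsilon_{\epsilon,k}\quad(j\ge 1).$$ (1) For every $\epsilon\in(0,1)$ with $\nu([\epsilon,\infty))>0$, one has $0<\sum_{k\ge1}\upsilon_{\epsilon,k}<\infty$, the series $\sum_{j\ge 0}c_{\epsilon,j}e^{-\epsilon j}$ converges absolutely to a positive number, and for every $x>0$ the series on the right below converges absolutely and $$\mathsf P\{I_{[X^{(\epsilon)}]}\le x\}=F_\epsilon(x):=1-\frac{1}{\sum_{j=0}^\infty c_{\epsilon,j}e^{-\epsilon j}}\sum_{j=0}^\infty c_{\epsilon,j}e^{-\epsilon j}\exp\Big(-e^{\epsilon j}x\sum_{k=1}^\infty\upsilon_{\epsilon,k}\Big).$$ (2) As $\epsilon\searrow0$, $\mathsf P\{I_{[X]}\le x\}=F_\epsilon(x)+O(\varrho(\epsilon))$ uniformly in $x>0$; precisely, for every $\epsilon\in(0,\epsilon_0)$ one has $\nu([\epsilon,\infty))>0$ and $$\big|\mathsf P\{I_{[X]}\le x\}-F_\epsilon(x)\big|\le C\,\varrho(\epsilon)\qquad\text{for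 all }x>0.$$ -/

import Mathlib

open MeasureTheory ProbabilityTheory Set
open scoped NNReal ENNReal

universe u

namespace ExpFunctional

/-- `ν` is the Lévy measure of a subordinator: it lives on `(0, ∞)` and `∫ min (1, z) ν(dz) < ∞`. -/
structure IsSubordinatorLevyMeasure (ν : Measure ℝ) : Prop where
  measure_Iic_zero : ν (Iic 0) = 0
  lintegral_min_lt_top : ∫⁻ z, ENNReal.ofReal (min 1 z) ∂ν < ∞

/-- The driftless Laplace exponent `Ψ(u) = ∫ (1 - e^{-uz}) ν(dz)`. -/
noncomputable def laplaceExponent (ν : Measure ℝ) (u : ℝ) : ℝ :=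
  ∫ z, (1 - Real.exp (-(u * z))) ∂ν

/-- `X` is a pure-jump (that is, driftless) subordinator with Lévy measure `ν` under `P`: a process
with stationary independent increments, almost surely started at `0` with nondecreasing
right-continuous paths, such that `E e^{-u X_t} = e^{-t Ψ(u)}`. -/
structure IsPureJumpSubordinator {Ω : Type u} [MeasurableSpace Ω]
    (P : Measure Ω) (ν : Measure ℝ) (X : ℝ≥0 → Ω → ℝ) : Prop where
  measurable : ∀ t, Measurable (X t)
  indep : HasIndepIncrements X P
  stationary : ∀ s t, IdentDistrib (fun ω => X (s + t) ω - X s ω) (X t) P P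
  start_zero : ∀ᵐ ω ∂P, X 0 ω = 0
  monotone : ∀ᵐ ω ∂P, Monotone fun t => X t ω
  rightCts : ∀ᵐ ω ∂P, ∀ t, ContinuousWithinAt (fun s => X s ω) (Ici t) t
  laplace : ∀ (t : ℝ≥0) (u : ℝ), 0 ≤ u →
    ∫ ω, Real.exp (-(u * X t ω)) ∂P = Real.exp (-(t * laplaceExponent ν u))

/-- The jump `X_t - X_{t-}` of the path of `ω` at time `t` (equal to `0` at `t = 0`). -/
noncomputable def jump {Ω : Type u} (X : ℝ≥0 → Ω → ℝ) (t : ℝ≥0) (ω : Ω) : ℝ :=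
  X t ω - Function.leftLim (fun s => X s ω) t

/-- The lattice process `X^(ε)`: every jump `z` of `X` is replaced by `ε ⌊z / ε⌋`. For a
nondecreasing path only finitely many terms of the sum are nonzero. -/
noncomputable def discretised {Ω : Type u} (X : ℝ≥0 → Ω → ℝ) (ε : ℝ) (t : ℝ≥0) (ω : Ω) : ℝ :=
  ∑' s : Iic t, ε * (⌊jump X s ω / ε⌋ : ℝ)

/-- The exponential functional `∫_0^∞ e^{-X_t} dt`, with values in `[0, ∞]`. -/
noncomputable def expFunctional {Ω : Type u} (X : ℝ≥0 → Ω → ℝ) (ω : Ω) : ℝ≥0∞ :=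
  ∫⁻ t in Ioi (0 : ℝ), ENNReal.ofReal (Real.exp (-X t.toNNReal ω))

/-- The distribution function `P {∫_0^∞ e^{-X_t} dt ≤ x}` of the exponential functional. -/
noncomputable def expFunctionalCDF {Ω : Type u} [MeasurableSpace Ω]
    (P : Measure Ω) (X : ℝ≥0 → Ω → ℝ) (x : ℝ) : ℝ :=
  P.real {ω | expFunctional X ω ≤ ENNReal.ofReal x}

/-- The lattice masses `υ_{ε,k} = ν([εk, ε(k+1)))`. -/
noncomputable def latticeMass (ν : Measure ℝ) (ε : ℝ) (k : ℕ) : ℝ :=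
  ν.real (Ico (ε * k) (ε * (k + 1)))

/-- The total lattice mass `∑_{k ≥ 1} υ_{ε,k}`. -/
noncomputable def totalMass (ν : Measure ℝ) (ε : ℝ) : ℝ :=
  ∑' k : ℕ, latticeMass ν ε (k + 1)

/-- The coefficients `c_{ε,j}`; see `coeff_of_pos` for the recurrence in its usual form. -/
noncomputable def coeff (ν : Measure ℝ) (ε : ℝ) : ℕ → ℝ
  | 0 => 1
  | j + 1 => 1 / ((1 - Real.exp (ε * ((j + 1 : ℕ) : ℝ))) * totalMass ν ε) *
      ∑ i : Fin (j + 1), Real.exp (ε * ((i + 1 : ℕ) : ℝ)) * coeff ν ε (j - i) *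
        latticeMass ν ε (i + 1)

theorem coeff_zero (ν : Measure ℝ) (ε : ℝ) : coeff ν ε 0 = 1 := by
  rw [coeff]

theorem coeff_of_pos (ν : Measure ℝ) (ε : ℝ) {j : ℕ} (hj : 1 ≤ j) :
    coeff ν ε j = 1 / ((1 - Real.exp (ε * j)) * totalMass ν ε) *
      ∑ k ∈ Finset.Icc 1 j, Real.exp (ε * k) * coeff ν ε (j - k) * latticeMass ν ε k := by
  obtain ⟨m, rfl⟩ : ∃ m, j = m + 1 := ⟨j - 1, by omega⟩
  rw [coeff]
  congr 1
  rw [Fin.sum_univ_eq_sum_range (fun i => Real.exp (ε * ((i + 1 : ℕ) : ℝ)) * coeff ν ε (m - i) *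
    latticeMass ν ε (i + 1)) (m + 1), ← Finset.Ico_add_one_right_eq_Icc, Finset.sum_Ico_eq_sum_range]
  refine Finset.sum_congr (by simp) fun i _ => ?_
  rw [show m + 1 - (1 + i) = m - i by omega, add_comm 1 i]

/-- The rate `ϱ(ε) = (∫_0^ε ν([z, ∞)) dz)^{1/2}`. -/
noncomputable def rate (ν : Measure ℝ) (ε : ℝ) : ℝ :=
  Real.sqrt (∫ z in (0 : ℝ)..ε, ν.real (Ici z))

/-- The explicit distribution function
`1 - (∑_j c_{ε,j} e^{-εj})⁻¹ ∑_j c_{ε,j} e^{-εj} exp (-e^{εj} x ∑_{k≥1} υ_{ε,k})`. -/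
noncomputable def seriesCDF (ν : Measure ℝ) (ε x : ℝ) : ℝ :=
  1 - 1 / (∑' j : ℕ, coeff ν ε j * Real.exp (-(ε * j))) *
    ∑' j : ℕ, coeff ν ε j * Real.exp (-(ε * j)) *
      Real.exp (-(Real.exp (ε * j) * x * totalMass ν ε))

end ExpFunctional

open ExpFunctional

namespace ExpFunctional

open Filter Topology

/-! Two facts are combined: an exact law for the lattice process, and a bound for the error made by
rounding.

The exact law comes from moments. For a nonnegative process with Laplace exponent `ψ` whose
increments are independent of the past, `E I^n = ∏_{k ≤ n} k / ψ(k)`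
(`HasLaplaceIncrements.lintegral_expFunctional_pow`). This applies to `X^(ε)` once its exponent is
known to be `ψ_ε(u) = ∑ υ_k (1 - e^{-uεk})`. To see that, the sum over rounded jumps is written as a
limit of sums over increments along partitions, and the small-time law `h⁻¹ E F(X_h) → ∫ F dν`
identifies the Laplace transform. With `Λ = ∑ υ_k` and `C(u) = ∑ c_j e^{-uεj}`, the recurrence for
`c_j` says that `Λ C(u) = ψ_ε(u) C(u + 1)`, so that `C(n + 1) / C(1) = ∏_{k ≤ n} Λ / ψ_ε(k)`. Hence
the moments are those of a signed mixture of exponential laws with rates `e^{εj} Λ` and weights `c_j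
e^{-εj} / C(1)`. Such a mixture has an exponential moment, so its moments determine the law
(`measureReal_Iic_of_moments`).

For the error, rounding lowers the path, hence `I_{[X]} ≤ I_{[X^(ε)]}`. The means differ by `1 /
ψ_ε(1) - 1 / Ψ(1) = O(ϱ²)`, because `Ψ(1) - ψ_ε(1) ≤ ∫ min(z, ε) ν(dz) = ϱ²`. By Markov's inequality
the two functionals differ by more than `ϱ` with probability `O(ϱ)` only. It remains to see that
`I_{[X]}` lies in an interval of length `2ϱ` with probability `O(ϱ)`, with a constant depending on
`ν` alone (`exists_measure_expFunctional_mem_Ioo_le`). Up to an error `h`, `I_{[X]}` is `h` times a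
discounted sum of i.i.d. increments over steps of length `h`. By exchangeability the first large
increment can be moved through all positions before the second large one. Each move raises the sum
by a definite amount, up to small corrections, so few positions put the sum into a given interval.
Summing over the position of the second large increment gives a geometric series, and `h → 0`
finishes the bound. -/

theorem discretised_congr {Ω : Type u} {X Y : ℝ≥0 → Ω → ℝ} {ω : Ω} (h : ∀ t, X t ω = Y t ω) (ε : ℝ) (t : ℝ≥0) :
    discretised X ε t ω = discretised Y ε t ω := by
  simp only [discretised, jump, h]

/-! ### Passing to a version all of whose paths are regular -/

section Regularisation

variable {Ω : Type u} [mΩ : MeasurableSpace Ω] {P : Measure Ω} {ν : Measure ℝ} {X Y : ℝ≥0 → Ω → ℝ}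

/-- A pure-jump subordinator all of whose paths start at `0`, are nondecreasing and
right-continuous. -/
structure IsRegularSubordinator (P : Measure Ω) (ν : Measure ℝ) (X : ℝ≥0 → Ω → ℝ) : Prop
    extends IsPureJumpSubordinator P ν X where
  zero : ∀ ω, X 0 ω = 0
  mono : ∀ ω, Monotone fun t => X t ω
  rc : ∀ ω t, ContinuousWithinAt (fun s => X s ω) (Ici t) t

theorem expFunctionalCDF_congr (h : ∀ᵐ ω ∂P, ∀ t, X t ω = Y t ω) (x : ℝ) :
    expFunctionalCDF P X x = expFunctionalCDF P Y x := by
  unfold expFunctionalCDF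
  refine measureReal_congr ?_
  filter_upwards [h] with ω hω
  have : expFunctional X ω = expFunctional Y ω := by simp only [expFunctional, hω]
  exact congrArg (· ≤ ENNReal.ofReal x) this

theorem HasIndepIncrements.congr_ae (hX : HasIndepIncrements X P)
    (h : ∀ᵐ ω ∂P, ∀ t, X t ω = Y t ω) : HasIndepIncrements Y P := fun n t ht =>
  (hX n t ht).congr fun i => by
    filter_upwards [h] with ω hω
    simp only [hω]

theorem IsPureJumpSubordinator.exists_regular (hX : IsPureJumpSubordinator P ν X) :
    ∃ Y, IsRegularSubordinator P ν Y ∧ ∀ᵐ ω ∂P, ∀ t, X t ω = Y t ω := by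
  classical
  have hg : ∀ᵐ ω ∂P, X 0 ω = 0 ∧ (Monotone fun t => X t ω) ∧
      ∀ t, ContinuousWithinAt (fun s => X s ω) (Ici t) t := by
    filter_upwards [hX.start_zero, hX.monotone, hX.rightCts] with ω h1 h2 h3 using ⟨h1, h2, h3⟩
  -- The exceptional set need not be measurable. It is enlarged to a measurable null set, on which
  -- the new process is set to `0`.
  obtain ⟨N, hN, hNm, hN0⟩ := exists_measurable_superset_of_null (ae_iff.1 hg)
  have hae : ∀ᵐ ω ∂P, ∀ t, X t ω = (fun t => Nᶜ.indicator (X t)) t ω := by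
    have : ∀ᵐ ω ∂P, ω ∉ N := measure_eq_zero_iff_ae_notMem.1 hN0
    filter_upwards [this] with ω hω t
    simp [hω]
  have hgood : ∀ ω, ω ∉ N → X 0 ω = 0 ∧ (Monotone fun t => X t ω) ∧
      ∀ t, ContinuousWithinAt (fun s => X s ω) (Ici t) t := fun ω hω => by
    by_contra hc
    exact hω (hN hc)
  refine ⟨fun t => Nᶜ.indicator (X t), ?_, hae⟩
  have key : ∀ ω, Nᶜ.indicator (X 0) ω = 0 ∧ (Monotone fun t => Nᶜ.indicator (X t) ω) ∧
      ∀ t, ContinuousWithinAt (fun s => Nᶜ.indicator (X s) ω) (Ici t) t := by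
    intro ω
    by_cases hω : ω ∈ N
    · simp only [mem_compl_iff, hω, not_true_eq_false, not_false_eq_true, indicator_of_notMem,
        true_and]
      exact ⟨monotone_const, fun t => continuousWithinAt_const⟩
    · simp only [mem_compl_iff, hω, not_false_eq_true, indicator_of_mem]
      exact hgood ω hω
  exact
    { measurable := fun t => (hX.measurable t).indicator hNm.compl
      indep := HasIndepIncrements.congr_ae hX.indep hae
      stationary := fun s t => by
        have h1 := hX.stationary s t
        refine ⟨?_, ?_, ?_⟩
        · exact (((hX.measurable _).indicator hNm.compl).sub
            ((hX.measurable _).indicator hNm.compl)).aemeasurable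
        · exact ((hX.measurable _).indicator hNm.compl).aemeasurable
        · rw [← Measure.map_congr (μ := P) (f := fun ω => X (s + t) ω - X s ω), h1.map_eq]
          · refine Measure.map_congr ?_
            filter_upwards [hae] with ω hω using hω t
          · filter_upwards [hae] with ω hω
            rw [hω, hω]
      start_zero := ae_of_all _ fun ω => (key ω).1
      monotone := ae_of_all _ fun ω => (key ω).2.1
      rightCts := ae_of_all _ fun ω => (key ω).2.2
      laplace := fun t u hu => by
        rw [← hX.laplace t u hu]
        refine integral_congr_ae ?_
        filter_upwards [hae] with ω hω
        rw [hω t]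
      zero := fun ω => (key ω).1
      mono := fun ω => (key ω).2.1
      rc := fun ω => (key ω).2.2 }

end Regularisation

/-! ### Independence of increments from the past -/

section Past

variable {Ω : Type u} {X : ℝ≥0 → Ω → ℝ}

/-- The `σ`-algebra generated by the process up to time `s`. -/
abbrev past (X : ℝ≥0 → Ω → ℝ) (s : ℝ≥0) : MeasurableSpace Ω :=
  MeasurableSpace.comap (fun ω (r : Iic s) => X r ω) MeasurableSpace.pi

theorem measurable_past {r s : ℝ≥0} (h : r ≤ s) : Measurable[past X s] (X r) :=
  (measurable_pi_apply (⟨r, h⟩ : Iic s)).comp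
    (comap_measurable (fun ω (r : Iic s) => X r ω))

theorem past_mono : Monotone (past X) := fun s t hst => by
  refine Measurable.comap_le (m₁ := past X t) ?_
  exact @measurable_pi_lambda _ _ _ (past X t) _ _ fun r => measurable_past (r.2.trans hst)

variable {Ω : Type u} [mΩ : MeasurableSpace Ω] {P : Measure Ω} {ν : Measure ℝ} {X : ℝ≥0 → Ω → ℝ}

theorem past_le (h : ∀ t, Measurable (X t)) (s : ℝ≥0) : past X s ≤ mΩ :=
  (measurable_pi_lambda (fun ω (r : Iic s) => X r ω) fun r => h r).comap_le

/-- The increments after time `s` are independent of the past up to time `s`. -/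
theorem indep_past_sub [IsProbabilityMeasure P] (hm : ∀ t, Measurable (X t))
    (hX : HasIndepIncrements X P) (h0 : ∀ ω, X 0 ω = 0) {s t : ℝ≥0} (hst : s ≤ t) :
    IndepFun (fun ω (r : Iic s) => X r ω) (fun ω => X t ω - X s ω) P := by
  classical
  refine IndepFun.process_indepFun (fun r => hm r) ((hm t).sub (hm s)) fun I => ?_
  -- With `0` among the times, every past value is a partial sum of increments. With `s` as the
  -- largest one, the increment that follows the last point of `J` is exactly `X t - X s`.
  set J : Finset ℝ≥0 := insert 0 (insert s (I.image Subtype.val)) with hJ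
  have hJ0 : 0 ∈ J := by simp [hJ]
  have hJs : s ∈ J := by simp [hJ]
  have hJle : ∀ r ∈ J, r ≤ s := by
    intro r hr
    simp only [hJ, Finset.mem_insert, Finset.mem_image] at hr
    rcases hr with rfl | rfl | ⟨a, -, rfl⟩
    · exact zero_le
    · exact le_rfl
    · exact a.2
  set n := J.card with hn
  have hnpos : 0 < n := Finset.card_pos.2 ⟨0, hJ0⟩
  set e := J.orderEmbOfFin rfl with he
  -- The times of `J` in increasing order, then `t` forever: independence of increments is available
  -- along monotone sequences indexed by `ℕ`.
  set τ : ℕ → ℝ≥0 := fun k => if h : k < n then e ⟨k, h⟩ else t with hτ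
  have hτlt : ∀ k (h : k < n), τ k = e ⟨k, h⟩ := fun k h => by simp [hτ, h]
  have hτge : ∀ k, n ≤ k → τ k = t := fun k h => by simp [hτ, h]
  have heJ : ∀ i, e i ∈ J := fun i => J.orderEmbOfFin_mem rfl i
  have hsurj : ∀ r ∈ J, ∃ k, k < n ∧ τ k = r := by
    intro r hr
    have : r ∈ Set.range e := by
      rw [he, Finset.range_orderEmbOfFin]
      exact hr
    obtain ⟨i, rfl⟩ := this
    exact ⟨i, i.2, hτlt _ _⟩
  have hmono : Monotone τ := by
    refine monotone_nat_of_le_succ fun k => ?_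
    by_cases h : k + 1 < n
    · rw [hτlt _ h, hτlt k (by omega)]
      exact e.monotone (by simp)
    · rw [hτge (k + 1) (by omega)]
      by_cases h' : k < n
      · rw [hτlt k h']
        exact (hJle _ (heJ _)).trans hst
      · rw [hτge k (by omega)]
  have hτ0 : τ 0 = 0 := by
    obtain ⟨k, -, hk⟩ := hsurj 0 hJ0
    exact le_antisymm (hk ▸ hmono (Nat.zero_le k)) zero_le
  have hτs : τ (n - 1) = s := by
    obtain ⟨k, hk, hks⟩ := hsurj s hJs
    refine le_antisymm ?_ (hks ▸ hmono (by omega))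
    rw [hτlt (n - 1) (by omega)]
    exact hJle _ (heJ _)
  have hτt : τ (n - 1 + 1) = t := hτge _ (by omega)
  have hind := hX.nat hmono
  have hsum : ∀ k ω, X (τ k) ω = ∑ i ∈ Finset.range k, (X (τ (i + 1)) ω - X (τ i) ω) := by
    intro k ω
    rw [Finset.sum_range_sub (fun i => X (τ i) ω), hτ0, h0, sub_zero]
  have h2 := hind.indepFun_finset (Finset.range (n - 1)) {n - 1}
    (by simp) (fun i => (hm _).sub (hm _))
  choose k hk hkr using hsurj
  have hkI : ∀ i : I, (i : Iic s).1 ∈ J := fun i => by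
    simp only [hJ, Finset.mem_insert, Finset.mem_image]
    exact Or.inr (Or.inr ⟨i, i.2, rfl⟩)
  have hψ : Measurable fun v : ({n - 1} : Finset ℕ) → ℝ => v ⟨n - 1, by simp⟩ :=
    measurable_pi_apply _
  have h3 := h2.comp
    (φ := fun (v : (Finset.range (n - 1) : Finset ℕ) → ℝ) (i : I) =>
      ∑ j : (Finset.range (n - 1) : Finset ℕ), if (j : ℕ) < k _ (hkI i) then v j else 0)
    (ψ := fun v : ({n - 1} : Finset ℕ) → ℝ => v ⟨n - 1, by simp⟩)
    (measurable_pi_lambda _ fun i => Finset.measurable_sum _ fun j _ => by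
      split_ifs
      · exact measurable_pi_apply _
      · exact measurable_const)
    hψ
  convert h3 using 1
  · funext ω i
    have h4 := hsum (k _ (hkI i)) ω
    rw [hkr] at h4
    rw [h4]
    simp only [Function.comp]
    rw [Finset.sum_coe_sort (Finset.range (n - 1))
      (fun j => if j < k _ (hkI i) then X (τ (j + 1)) ω - X (τ j) ω else 0), ← Finset.sum_filter]
    refine Finset.sum_congr ?_ fun _ _ => rfl
    ext j
    have := hk _ (hkI i)
    simp only [Finset.mem_range, Finset.mem_filter]
    omega
  · funext ω
    simp only [Function.comp, hτs, hτt]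

theorem lintegral_past_mul [IsProbabilityMeasure P] (hX : IsRegularSubordinator P ν X)
    {s t : ℝ≥0} {V : Ω → ℝ≥0∞} (hV : Measurable[past X s] V) {g : ℝ → ℝ≥0∞} (hg : Measurable g) :
    ∫⁻ ω, V ω * g (X (s + t) ω - X s ω) ∂P = (∫⁻ ω, V ω ∂P) * ∫⁻ ω, g (X t ω) ∂P := by
  have h1 := indep_past_sub hX.measurable hX.indep hX.zero (le_self_add : s ≤ s + t)
  have hm2 : Measurable fun ω => X (s + t) ω - X s ω := (hX.measurable _).sub (hX.measurable _)
  refine (lintegral_mul_eq_lintegral_mul_lintegral_of_independent_measurableSpace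
    (past_le hX.measurable s) hm2.comap_le h1 hV
    (hg.comp (comap_measurable (fun ω => X (s + t) ω - X s ω)))).trans ?_
  congr 1
  exact ((hX.stationary s t).comp hg).lintegral_eq

end Past

/-! ### Moments of the exponential functional -/

section Moments

/-- The tail integral `J t = ∫_t^∞ w` satisfies `J ^ (n + 1) = (n + 1) ∫_t^∞ w J ^ n`. -/
theorem tail_lintegral_pow {w : ℝ → ℝ≥0∞} (hw : Measurable w) (n : ℕ) (t : ℝ) :
    (∫⁻ s in Ioi t, w s) ^ (n + 1) =
      (n + 1) * ∫⁻ s in Ioi t, w s * (∫⁻ r in Ioi s, w r) ^ n := by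
  have hJ : Measurable fun s : ℝ => ∫⁻ r in Ioi s, w r := by
    have : Antitone fun s : ℝ => ∫⁻ r in Ioi s, w r := fun a b hab =>
      lintegral_mono_set (Ioi_subset_Ioi hab)
    exact this.measurable
  induction n generalizing t with
  | zero => simp
  | succ n ih =>
    -- The induction hypothesis is multiplied by `J t`, which is split at `s`. The part beyond `s`
    -- raises the power of `J s`. The part before `s` becomes, by Tonelli and the induction
    -- hypothesis at `r`, the same integral up to the factor `n + 1`, so the two parts add up to the
    -- factor `n + 2`.
    set f : ℝ → ℝ≥0∞ := fun s => w s * (∫⁻ r in Ioi s, w r) ^ n with hf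
    have hfm : Measurable f := hw.mul (hJ.pow_const n)
    have hsplit : ∀ s ∈ Ioi t, f s * (∫⁻ r in Ioi t, w r) =
        w s * (∫⁻ r in Ioi s, w r) ^ (n + 1) +
          ∫⁻ r in Ioi t, (Iic s).indicator (fun r => f s * w r) r := by
      intro s hs
      have h1 : ∫⁻ r in Ioi t, w r = (∫⁻ r in Ioc t s, w r) + ∫⁻ r in Ioi s, w r := by
        rw [← Ioc_union_Ioi_eq_Ioi (le_of_lt hs),
          lintegral_union measurableSet_Ioi (Ioc_disjoint_Ioi le_rfl)]
      rw [h1, mul_add, add_comm]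
      congr 1
      · simp only [hf]; ring
      · rw [lintegral_indicator measurableSet_Iic, Measure.restrict_restrict measurableSet_Iic,
          inter_comm, Ioi_inter_Iic, lintegral_const_mul _ hw]
    have hswap : ∫⁻ s in Ioi t, ∫⁻ r in Ioi t, (Iic s).indicator (fun r => f s * w r) r =
        ∫⁻ r in Ioi t, w r * ∫⁻ s in Ioi r, f s := by
      rw [lintegral_lintegral_swap]
      · refine setLIntegral_congr_fun measurableSet_Ioi fun r hr => ?_
        have : ∀ s, (Iic s).indicator (fun r => f s * w r) r =
            (Ici r).indicator (fun s => w r * f s) s := by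
          intro s
          by_cases h : r ≤ s
          · simp [h, mul_comm]
          · simp [h]
        simp only [this]
        rw [lintegral_indicator measurableSet_Ici, Measure.restrict_restrict measurableSet_Ici,
          inter_eq_left.2 (Ici_subset_Ioi.2 hr), lintegral_const_mul _ hfm,
          restrict_Ioi_eq_restrict_Ici]
      · have hset : MeasurableSet {p : ℝ × ℝ | p.2 ≤ p.1} :=
          measurableSet_le measurable_snd measurable_fst
        have : (Function.uncurry fun s r => (Iic s).indicator (fun r => f s * w r) r) =
            {p : ℝ × ℝ | p.2 ≤ p.1}.indicator fun p => f p.1 * w p.2 := by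
          funext p
          rcases p with ⟨a, b⟩
          simp only [Function.uncurry, indicator, mem_Iic, mem_ofPred_eq]
        rw [this]
        exact (((hfm.comp measurable_fst).mul (hw.comp measurable_snd)).indicator
          hset).aemeasurable
    have hlast : (n + 1 : ℝ≥0∞) * ∫⁻ r in Ioi t, w r * ∫⁻ s in Ioi r, f s =
        ∫⁻ r in Ioi t, w r * (∫⁻ s in Ioi r, w s) ^ (n + 1) := by
      rw [← lintegral_const_mul' _ _ (by finiteness)]
      refine lintegral_congr fun r => ?_
      rw [ih r]
      ring
    have hm : Measurable fun s => w s * (∫⁻ r in Ioi s, w r) ^ (n + 1) :=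
      hw.mul (hJ.pow_const _)
    rw [pow_succ, ih t, mul_assoc, ← lintegral_mul_const _ hfm,
      setLIntegral_congr_fun measurableSet_Ioi hsplit, lintegral_add_left hm, hswap, mul_add,
      hlast]
    push_cast
    ring

variable {Ω : Type u} [mΩ : MeasurableSpace Ω]

/-- A nonnegative process, adapted to `𝓕`, whose increments are independent of the past and have
Laplace exponent `ψ`. -/
structure HasLaplaceIncrements (P : Measure Ω) (𝓕 : ℝ≥0 → MeasurableSpace Ω)
    (X : ℝ≥0 → Ω → ℝ) (ψ : ℝ → ℝ) : Prop where
  le : ∀ t, 𝓕 t ≤ mΩ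
  mono : Monotone 𝓕
  adapted : ∀ t, Measurable[𝓕 t] (X t)
  jointly : Measurable (Function.uncurry X)
  zero : ∀ ω, X 0 ω = 0
  nonneg : ∀ t ω, 0 ≤ X t ω
  -- The weight `V` carries the past. Its bound `1` is what dominates the limits by which this
  -- identity is proved for sums over jumps.
  laplace : ∀ (s t : ℝ≥0) (V : Ω → ℝ≥0∞), Measurable[𝓕 s] V → (∀ ω, V ω ≤ 1) →
    ∀ u : ℝ, 0 < u → ∫⁻ ω, V ω * ENNReal.ofReal (Real.exp (-(u * (X (s + t) ω - X s ω)))) ∂P =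
      ENNReal.ofReal (Real.exp (-(t * ψ u))) * ∫⁻ ω, V ω ∂P

theorem lintegral_exp_neg_mul_Ioi {a : ℝ} (ha : 0 < a) (t : ℝ) :
    ∫⁻ s in Ioi t, ENNReal.ofReal (Real.exp (-((s - t) * a))) = ENNReal.ofReal (1 / a) := by
  have h1 : ∀ s : ℝ, Real.exp (-((s - t) * a)) = Real.exp (t * a) * Real.exp (-a * s) :=
    fun s => by rw [← Real.exp_add]; ring_nf
  simp only [h1]
  rw [← ofReal_integral_eq_lintegral_ofReal]
  · rw [integral_const_mul, integral_exp_mul_Ioi (by linarith), neg_div_neg_eq, ← mul_div_assoc,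
      ← Real.exp_add]
    ring_nf
    simp
  · exact (integrableOn_exp_mul_Ioi (by linarith) t).const_mul _
  · exact ae_of_all _ fun s => by positivity

variable {P : Measure Ω} {𝓕 : ℝ≥0 → MeasurableSpace Ω}
  {X : ℝ≥0 → Ω → ℝ} {ψ : ℝ → ℝ}

theorem HasLaplaceIncrements.measurable_expFunctional (hX : HasLaplaceIncrements P 𝓕 X ψ) :
    Measurable (expFunctional X) := by
  have : Measurable fun p : Ω × ℝ => X p.2.toNNReal p.1 :=
    hX.jointly.comp ((measurable_snd.real_toNNReal).prodMk measurable_fst)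
  exact ((Real.measurable_exp.comp this.neg).ennreal_ofReal).lintegral_prod_right'

variable [IsProbabilityMeasure P]

/-- Moments of the tail of the exponential functional, jointly with the past. -/
theorem HasLaplaceIncrements.lintegral_mul_tail_pow (hX : HasLaplaceIncrements P 𝓕 X ψ)
    (hψ : ∀ n : ℕ, 0 < ψ (n + 1)) (n : ℕ) (t : ℝ≥0) (V : Ω → ℝ≥0∞) (hV : Measurable[𝓕 t] V)
    (hV1 : ∀ ω, V ω ≤ 1) :
    ∫⁻ ω, V ω * (∫⁻ s in Ioi (t : ℝ), ENNReal.ofReal (Real.exp (-X s.toNNReal ω))) ^ n ∂P =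
      (∏ k ∈ Finset.range n, ENNReal.ofReal ((k + 1) / ψ (k + 1))) *
        ∫⁻ ω, V ω * ENNReal.ofReal (Real.exp (-(n * X t ω))) ∂P := by
  set w : ℝ → Ω → ℝ≥0∞ := fun s ω => ENNReal.ofReal (Real.exp (-X s.toNNReal ω)) with hw
  have hwm : Measurable (Function.uncurry w) := by
    have : Measurable fun p : ℝ × Ω => X p.1.toNNReal p.2 :=
      hX.jointly.comp ((measurable_fst.real_toNNReal).prodMk measurable_snd)
    exact (Real.measurable_exp.comp this.neg).ennreal_ofReal
  have hwω : ∀ ω, Measurable fun s => w s ω := fun ω => hwm.comp measurable_prodMk_right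
  have hJm : Measurable fun p : ℝ × Ω => ∫⁻ r in Ioi p.1, w r p.2 := by
    have h1 : Measurable fun q : (ℝ × Ω) × ℝ =>
        {q : (ℝ × Ω) × ℝ | q.1.1 < q.2}.indicator (fun q => w q.2 q.1.2) q := by
      refine Measurable.indicator ?_ (measurableSet_lt (measurable_fst.comp measurable_fst)
        measurable_snd)
      exact hwm.comp (measurable_snd.prodMk (measurable_snd.comp measurable_fst))
    have h2 := h1.lintegral_prod_right' (ν := volume)
    convert h2 using 2 with p
    rw [← lintegral_indicator measurableSet_Ioi]
    rfl
  -- `V` must stay general: the hypothesis is applied at the later time `s` to the weight `V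
  -- e^{-X_s}`. The resulting `e^{-(n+1) X_s}` is reduced to time `t` at the cost of `e^{-(s-t)
  -- ψ(n+1)}`, whose integral over `s` is `1 / ψ(n+1)`.
  induction n generalizing t V with
  | zero => simp
  | succ n ih =>
    have hVm : Measurable V := hV.mono (hX.le t) le_rfl
    have h1 : ∀ ω, V ω * (∫⁻ s in Ioi (t : ℝ), w s ω) ^ (n + 1) =
        (n + 1) * ∫⁻ s in Ioi (t : ℝ), V ω * w s ω * (∫⁻ r in Ioi s, w r ω) ^ n := by
      intro ω
      rw [tail_lintegral_pow (hwω ω), ← mul_assoc, mul_comm (V ω), mul_assoc,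
        ← lintegral_const_mul' _ _ (ne_top_of_le_ne_top ENNReal.one_ne_top (hV1 ω))]
      simp only [mul_assoc]
    rw [lintegral_congr h1, lintegral_const_mul' _ _ (by finiteness), lintegral_lintegral_swap]
    · have h2 : ∀ s ∈ Ioi (t : ℝ),
          ∫⁻ ω, V ω * w s ω * (∫⁻ r in Ioi s, w r ω) ^ n ∂P =
            (∏ k ∈ Finset.range n, ENNReal.ofReal ((k + 1) / ψ (k + 1))) *
              (ENNReal.ofReal (Real.exp (-((s - t) * ψ (n + 1)))) *
                ∫⁻ ω, V ω * ENNReal.ofReal (Real.exp (-((n + 1 : ℕ) * X t ω))) ∂P) := by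
        intro s hs
        have hts : (t : ℝ) < s := hs
        have hs0 : (0 : ℝ) ≤ s := t.2.trans hts.le
        have hle : t ≤ s.toNNReal := by
          rw [← NNReal.coe_le_coe, Real.coe_toNNReal _ hs0]; exact hts.le
        have h3 := ih s.toNNReal (fun ω => V ω * w s ω)
          ((hV.mono (hX.mono hle) le_rfl).mul
            ((Real.measurable_exp.comp (hX.adapted s.toNNReal).neg).ennreal_ofReal))
          (fun ω => by
            refine mul_le_one' (hV1 ω) ?_
            simp only [hw]
            rw [ENNReal.ofReal_le_one, Real.exp_le_one_iff]
            linarith [hX.nonneg s.toNNReal ω])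
        rw [Real.coe_toNNReal _ hs0] at h3
        rw [h3]
        congr 1
        have h4 := hX.laplace t (s.toNNReal - t)
          (fun ω => V ω * ENNReal.ofReal (Real.exp (-((n + 1 : ℕ) * X t ω))))
          (hV.mul ((Real.measurable_exp.comp
            ((hX.adapted t).const_mul _).neg).ennreal_ofReal))
          (fun ω => by
            refine mul_le_one' (hV1 ω) ?_
            rw [ENNReal.ofReal_le_one, Real.exp_le_one_iff]
            have := hX.nonneg t ω
            have : 0 ≤ ((n + 1 : ℕ) : ℝ) * X t ω := by positivity
            linarith) (n + 1) (by positivity)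
        rw [NNReal.coe_sub hle, Real.coe_toNNReal _ hs0] at h4
        rw [← h4]
        refine lintegral_congr fun ω => ?_
        rw [add_tsub_cancel_of_le hle]
        simp only [hw]
        rw [mul_assoc, mul_assoc, ← ENNReal.ofReal_mul (by positivity),
          ← ENNReal.ofReal_mul (by positivity), ← Real.exp_add, ← Real.exp_add]
        congr 3
        push_cast
        ring
      rw [setLIntegral_congr_fun measurableSet_Ioi h2, lintegral_const_mul' _ _
        (ENNReal.prod_ne_top fun _ _ => ENNReal.ofReal_ne_top),
        lintegral_mul_const' _ _ ?_, lintegral_exp_neg_mul_Ioi (hψ n), Finset.prod_range_succ]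
      · have : ENNReal.ofReal ((n + 1) / ψ (n + 1)) = (n + 1) * ENNReal.ofReal (1 / ψ (n + 1)) := by
          rw [div_eq_mul_one_div, ENNReal.ofReal_mul (by positivity)]
          congr 1
          rw [ENNReal.ofReal_add (by positivity) zero_le_one, ENNReal.ofReal_natCast,
            ENNReal.ofReal_one]
        rw [this]
        ring
      · refine ne_top_of_le_ne_top (b := 1) ENNReal.one_ne_top ?_
        calc _ ≤ ∫⁻ _, (1 : ℝ≥0∞) ∂P := lintegral_mono fun ω => by
              refine mul_le_one' (hV1 ω) ?_
              rw [ENNReal.ofReal_le_one, Real.exp_le_one_iff]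
              have := hX.nonneg t ω
              have : 0 ≤ ((n + 1 : ℕ) : ℝ) * X t ω := by positivity
              linarith
          _ = 1 := by simp
    · refine Measurable.aemeasurable ?_
      have ha : Measurable fun p : Ω × ℝ => w p.2 p.1 := hwm.comp measurable_swap
      have hb : Measurable fun p : Ω × ℝ => ∫⁻ r in Ioi p.2, w r p.1 := hJm.comp measurable_swap
      exact ((hVm.comp measurable_fst).mul ha).mul (hb.pow_const n)

/-- The moments `E I^n = n! / ∏_{k ≤ n} ψ k` of the exponential functional. -/
theorem HasLaplaceIncrements.lintegral_expFunctional_pow (hX : HasLaplaceIncrements P 𝓕 X ψ)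
    (hψ : ∀ n : ℕ, 0 < ψ (n + 1)) (n : ℕ) :
    ∫⁻ ω, expFunctional X ω ^ n ∂P =
      ∏ k ∈ Finset.range n, ENNReal.ofReal ((k + 1) / ψ (k + 1)) := by
  have h := hX.lintegral_mul_tail_pow hψ n 0 (fun _ => 1) measurable_const (fun _ => le_rfl)
  simpa [hX.zero, expFunctional] using h

end Moments

/-! ### The Lévy measure and its Laplace exponent -/

section LevyMeasure

variable {ν : Measure ℝ}

theorem IsSubordinatorLevyMeasure.ae_pos (hν : IsSubordinatorLevyMeasure ν) : ∀ᵐ z ∂ν, 0 < z := by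
  have : ∀ᵐ z ∂ν, z ∉ Iic (0 : ℝ) := measure_eq_zero_iff_ae_notMem.1 hν.measure_Iic_zero
  filter_upwards [this] with z hz
  simpa using hz

theorem IsSubordinatorLevyMeasure.integrable_min (hν : IsSubordinatorLevyMeasure ν) :
    Integrable (fun z => min 1 z) ν := by
  refine ⟨(measurable_const.min measurable_id).aestronglyMeasurable, ?_⟩
  rw [hasFiniteIntegral_iff_ofReal]
  · exact hν.lintegral_min_lt_top
  · filter_upwards [hν.ae_pos] with z hz
    exact le_min zero_le_one hz.le

theorem one_sub_exp_neg_le_mul_min {u z : ℝ} (hz : 0 ≤ z) :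
    1 - Real.exp (-(u * z)) ≤ max 1 u * min 1 z := by
  have h1 := Real.one_sub_le_exp_neg (u * z)
  have h2 := Real.exp_pos (-(u * z))
  rcases le_total 1 z with h | h
  · rw [min_eq_left h]
    have := le_max_left 1 u
    linarith
  · rw [min_eq_right h]
    have := mul_le_mul_of_nonneg_right (le_max_right 1 u) hz
    linarith

theorem IsSubordinatorLevyMeasure.integrable_one_sub_exp (hν : IsSubordinatorLevyMeasure ν)
    {u : ℝ} (hu : 0 ≤ u) : Integrable (fun z => 1 - Real.exp (-(u * z))) ν := by
  refine (hν.integrable_min.const_mul (max 1 u)).mono'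
    (by fun_prop) ?_
  filter_upwards [hν.ae_pos] with z hz
  rw [Real.norm_of_nonneg]
  · exact one_sub_exp_neg_le_mul_min hz.le
  · have : 0 ≤ u * z := by positivity
    simpa using this

theorem IsSubordinatorLevyMeasure.measure_Ici_lt_top (hν : IsSubordinatorLevyMeasure ν)
    {b : ℝ} (hb : 0 < b) : ν (Ici b) < ∞ := by
  have hb1 : 0 < min 1 b := lt_min one_pos hb
  have := hν.integrable_min.measure_ge_lt_top hb1
  refine lt_of_le_of_lt (measure_mono fun z hz => ?_) this
  exact min_le_min_left 1 (mem_Ici.1 hz)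

theorem IsSubordinatorLevyMeasure.exists_measure_Ici_ne_zero (hν : IsSubordinatorLevyMeasure ν)
    (h0 : ν ≠ 0) : ∃ b > 0, ν (Ici b) ≠ 0 := by
  by_contra! hc
  apply h0
  rw [← Measure.measure_univ_eq_zero]
  have : (univ : Set ℝ) ⊆ Iic 0 ∪ ⋃ n : ℕ, Ici (1 / ((n : ℝ) + 1)) := by
    intro z _
    rcases le_or_gt z 0 with h | h
    · exact Or.inl h
    · obtain ⟨n, hn⟩ := exists_nat_one_div_lt h
      exact Or.inr (mem_iUnion.2 ⟨n, hn.le⟩)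
  refine measure_mono_null this (measure_union_null hν.measure_Iic_zero
    (measure_iUnion_null fun n => hc _ (by positivity)))

theorem IsSubordinatorLevyMeasure.laplaceExponent_pos (hν : IsSubordinatorLevyMeasure ν)
    (h0 : ν ≠ 0) {u : ℝ} (hu : 0 < u) : 0 < laplaceExponent ν u := by
  unfold laplaceExponent
  have hpos : ∀ᵐ z ∂ν, 0 < 1 - Real.exp (-(u * z)) := by
    filter_upwards [hν.ae_pos] with z hz
    have : 0 < u * z := by positivity
    simpa using this
  rw [integral_pos_iff_support_of_nonneg_ae (by filter_upwards [hpos] with z hz using hz.le)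
    (hν.integrable_one_sub_exp hu.le)]
  rw [pos_iff_ne_zero]
  intro hc
  apply h0
  rw [← Measure.measure_univ_eq_zero, ← nonpos_iff_eq_zero, ← hc]
  refine measure_mono_ae ?_
  filter_upwards [hpos] with z hz _
  exact hz.ne'

/-- The differences of the exponent are the moments, in the variable `e^{-z}`, of the finite measure
`(1 - e^{-z}) ν(dz)`. -/
theorem laplaceExponent_add_one_sub (hν : IsSubordinatorLevyMeasure ν) {u : ℝ} (hu : 0 ≤ u) :
    laplaceExponent ν (u + 1) - laplaceExponent ν u =
      ∫ z, (1 - Real.exp (-z)) * Real.exp (-(u * z)) ∂ν := by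
  unfold laplaceExponent
  rw [← integral_sub (hν.integrable_one_sub_exp (by linarith)) (hν.integrable_one_sub_exp hu)]
  refine integral_congr_ae (ae_of_all _ fun z => ?_)
  have : Real.exp (-((u + 1) * z)) = Real.exp (-(u * z)) * Real.exp (-z) := by
    rw [← Real.exp_add]; ring_nf
  simp only [this]
  ring

/-- Used to choose the level separating small from large increments in the density bound: the mass
of `(1 - e^{-z}) ν(dz)` near `0` is controlled by its high moments. -/
theorem tendsto_laplaceExponent_add_one_sub (hν : IsSubordinatorLevyMeasure ν) :
    Tendsto (fun m : ℕ => laplaceExponent ν (m + 1) - laplaceExponent ν m) atTop (𝓝 0) := by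
  have h1 : ∀ m : ℕ, laplaceExponent ν (m + 1) - laplaceExponent ν m =
      ∫ z, (1 - Real.exp (-z)) * Real.exp (-(m * z)) ∂ν :=
    fun m => laplaceExponent_add_one_sub hν (Nat.cast_nonneg m)
  simp only [h1]
  rw [← integral_zero ℝ ℝ (μ := ν)]
  have hint := hν.integrable_one_sub_exp zero_le_one
  simp only [one_mul] at hint
  refine tendsto_integral_of_dominated_convergence _ (fun m => by fun_prop) hint ?_ ?_
  · intro m
    filter_upwards [hν.ae_pos] with z hz
    have h2 : Real.exp (-z) ≤ 1 := by simpa using hz.le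
    have h3 : Real.exp (-(m * z)) ≤ 1 := by
      have : 0 ≤ m * z := by positivity
      simpa using this
    rw [Real.norm_of_nonneg (mul_nonneg (by linarith) (Real.exp_pos _).le)]
    exact mul_le_of_le_one_right (by linarith) h3
  · filter_upwards [hν.ae_pos] with z hz
    have h4 : Tendsto (fun m : ℕ => Real.exp (-(m * z))) atTop (𝓝 0) :=
      Real.tendsto_exp_neg_atTop_nhds_zero.comp
        (tendsto_natCast_atTop_atTop.atTop_mul_const hz)
    simpa using h4.const_mul (1 - Real.exp (-z))

end LevyMeasure

/-! ### Small-time asymptotics of the subordinator -/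

section SmallTime

variable {Ω : Type u} [mΩ : MeasurableSpace Ω] {P : Measure Ω}
  {ν : Measure ℝ} {X : ℝ≥0 → Ω → ℝ}

theorem IsRegularSubordinator.nonneg (hX : IsRegularSubordinator P ν X) (t : ℝ≥0) (ω : Ω) :
    0 ≤ X t ω := by
  rw [← hX.zero ω]; exact hX.mono ω zero_le

variable [IsProbabilityMeasure P]

theorem IsRegularSubordinator.integrable_exp (hX : IsRegularSubordinator P ν X) (t : ℝ≥0) {u : ℝ}
    (hu : 0 ≤ u) : Integrable (fun ω => Real.exp (-(u * X t ω))) P := by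
  have := hX.measurable t
  refine Integrable.of_bound (C := 1) (by fun_prop) (ae_of_all _ fun ω => ?_)
  rw [Real.norm_of_nonneg (Real.exp_pos _).le]
  have : 0 ≤ u * X t ω := mul_nonneg hu (hX.nonneg t ω)
  simpa using this

/-- The expectation is a difference of two Laplace transforms, and the limit is its derivative at `h
= 0`. The weight `1 - e^{-z}` compensates for the possibly infinite mass of `ν` near `0`. -/
theorem IsRegularSubordinator.tendsto_div_monomial (hν : IsSubordinatorLevyMeasure ν)
    (hX : IsRegularSubordinator P ν X) {u : ℝ} (hu : 0 ≤ u) :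
    Tendsto (fun h : ℝ≥0 => (∫ ω, (1 - Real.exp (-X h ω)) * Real.exp (-(u * X h ω)) ∂P) / h)
      (𝓝[>] 0) (𝓝 (∫ z, (1 - Real.exp (-z)) * Real.exp (-(u * z)) ∂ν)) := by
  rw [← laplaceExponent_add_one_sub hν hu]
  have h1 : ∀ h : ℝ≥0, ∫ ω, (1 - Real.exp (-X h ω)) * Real.exp (-(u * X h ω)) ∂P =
      Real.exp (-(h * laplaceExponent ν u)) - Real.exp (-(h * laplaceExponent ν (u + 1))) := by
    intro h
    rw [← hX.laplace h u hu, ← hX.laplace h (u + 1) (by linarith),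
      ← integral_sub (hX.integrable_exp h hu) (hX.integrable_exp h (by linarith))]
    refine integral_congr_ae (ae_of_all _ fun ω => ?_)
    have : Real.exp (-((u + 1) * X h ω)) = Real.exp (-(u * X h ω)) * Real.exp (-X h ω) := by
      rw [← Real.exp_add]; ring_nf
    simp only [this]
    ring
  simp only [h1]
  have hd : HasDerivAt (fun h : ℝ => Real.exp (-(h * laplaceExponent ν u)) -
      Real.exp (-(h * laplaceExponent ν (u + 1))))
      (laplaceExponent ν (u + 1) - laplaceExponent ν u) 0 := by
    have h2 : ∀ a : ℝ, HasDerivAt (fun h : ℝ => Real.exp (-(h * a))) (-a) 0 := fun a => by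
      have := ((hasDerivAt_id (0 : ℝ)).mul_const a).neg.exp
      simpa using this
    refine ((h2 (laplaceExponent ν u)).fun_sub (h2 (laplaceExponent ν (u + 1)))).congr_deriv ?_
    ring
  have hs := (hasDerivAt_iff_tendsto_slope.1 hd)
  have hc : Tendsto (fun h : ℝ≥0 => (h : ℝ)) (𝓝[>] 0) (𝓝[≠] 0) := by
    refine tendsto_nhdsWithin_iff.2 ⟨?_, ?_⟩
    · exact (NNReal.continuous_coe.tendsto 0).mono_left nhdsWithin_le_nhds
    · filter_upwards [self_mem_nhdsWithin] with h hh
      simpa using (ne_of_gt hh : h ≠ 0)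
  refine (hs.comp hc).congr fun h => ?_
  simp [slope_def_field]

/-- Convergence on monomials in `e^{-z}` extends by linearity to polynomials. It extends to uniform
limits because the total masses of the weighted measures converge too. -/
theorem IsRegularSubordinator.tendsto_div_of_approx (hν : IsSubordinatorLevyMeasure ν)
    (hX : IsRegularSubordinator P ν X) {Q : ℝ → ℝ} (hQ : Measurable Q)
    (happ : ∀ δ > 0, ∃ p : Polynomial ℝ, ∀ z, 0 ≤ z → |p.eval (Real.exp (-z)) - Q z| ≤ δ) :
    Tendsto (fun h : ℝ≥0 => (∫ ω, (1 - Real.exp (-X h ω)) * Q (X h ω) ∂P) / h)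
      (𝓝[>] 0) (𝓝 (∫ z, (1 - Real.exp (-z)) * Q z ∂ν)) := by
  have hpoly : ∀ (p : Polynomial ℝ) (z : ℝ), (1 - Real.exp (-z)) * p.eval (Real.exp (-z)) =
      ∑ k ∈ Finset.range (p.natDegree + 1),
        p.coeff k * ((1 - Real.exp (-z)) * Real.exp (-((k : ℝ) * z))) := by
    intro p z
    rw [Polynomial.eval_eq_sum_range, Finset.mul_sum]
    refine Finset.sum_congr rfl fun k _ => ?_
    rw [← Real.exp_nat_mul]
    ring_nf
  have hintP : ∀ (h : ℝ≥0) (u : ℝ), 0 ≤ u →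
      Integrable (fun ω => (1 - Real.exp (-X h ω)) * Real.exp (-(u * X h ω))) P := by
    intro h u hu
    refine ((hX.integrable_exp h hu).sub (hX.integrable_exp h (u := u + 1) (by linarith))).congr
      (ae_of_all _ fun ω => ?_)
    have : Real.exp (-((u + 1) * X h ω)) = Real.exp (-(u * X h ω)) * Real.exp (-X h ω) := by
      rw [← Real.exp_add]; ring_nf
    simp only [Pi.sub_apply, this]
    ring
  have hintν : ∀ u : ℝ, 0 ≤ u →
      Integrable (fun z => (1 - Real.exp (-z)) * Real.exp (-(u * z))) ν := by
    intro u hu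
    refine ((hν.integrable_one_sub_exp (u := u + 1) (by linarith)).sub
      (hν.integrable_one_sub_exp hu)).congr (ae_of_all _ fun z => ?_)
    have : Real.exp (-((u + 1) * z)) = Real.exp (-(u * z)) * Real.exp (-z) := by
      rw [← Real.exp_add]; ring_nf
    simp only [Pi.sub_apply, this]
    ring
  have hpolyP : ∀ (p : Polynomial ℝ) (h : ℝ≥0),
      Integrable (fun ω => (1 - Real.exp (-X h ω)) * p.eval (Real.exp (-X h ω))) P := by
    intro p h
    simp only [hpoly]
    exact integrable_finsetSum _ fun k _ => (hintP h k (Nat.cast_nonneg k)).const_mul _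
  have hpolyν : ∀ p : Polynomial ℝ,
      Integrable (fun z => (1 - Real.exp (-z)) * p.eval (Real.exp (-z))) ν := by
    intro p
    simp only [hpoly]
    exact integrable_finsetSum _ fun k _ => (hintν k (Nat.cast_nonneg k)).const_mul _
  have hptend : ∀ p : Polynomial ℝ, Tendsto (fun h : ℝ≥0 =>
      (∫ ω, (1 - Real.exp (-X h ω)) * p.eval (Real.exp (-X h ω)) ∂P) / h)
      (𝓝[>] 0) (𝓝 (∫ z, (1 - Real.exp (-z)) * p.eval (Real.exp (-z)) ∂ν)) := by
    intro p
    simp only [hpoly]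
    rw [integral_finsetSum _ fun k _ => (hintν (k : ℕ) (Nat.cast_nonneg _)).const_mul _]
    have : ∀ h : ℝ≥0, (∫ ω, ∑ k ∈ Finset.range (p.natDegree + 1), p.coeff k *
        ((1 - Real.exp (-X h ω)) * Real.exp (-((k : ℝ) * X h ω))) ∂P) / h =
        ∑ k ∈ Finset.range (p.natDegree + 1), p.coeff k *
          ((∫ ω, (1 - Real.exp (-X h ω)) * Real.exp (-((k : ℝ) * X h ω)) ∂P) / h) := by
      intro h
      rw [integral_finsetSum _ fun k _ => (hintP h (k : ℕ) (Nat.cast_nonneg _)).const_mul _,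
        Finset.sum_div]
      exact Finset.sum_congr rfl fun k _ => by rw [integral_const_mul, mul_div_assoc]
    simp only [this, integral_const_mul]
    exact tendsto_finsetSum _ fun k _ =>
      (hX.tendsto_div_monomial hν (Nat.cast_nonneg k)).const_mul _
  have hone : Tendsto (fun h : ℝ≥0 => (∫ ω, (1 - Real.exp (-X h ω)) ∂P) / h)
      (𝓝[>] 0) (𝓝 (∫ z, (1 - Real.exp (-z)) ∂ν)) := by
    simpa using hX.tendsto_div_monomial hν le_rfl
  have hintP1 : ∀ h : ℝ≥0, Integrable (fun ω => 1 - Real.exp (-X h ω)) P := fun h => by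
    simpa using hintP h 0 le_rfl
  have hintν1 : Integrable (fun z => 1 - Real.exp (-z)) ν := by
    simpa using hintν 0 le_rfl
  have hnn : ∀ z : ℝ, 0 ≤ z → 0 ≤ 1 - Real.exp (-z) := fun z hz => by simpa using hz
  obtain ⟨p₁, hp₁⟩ := happ 1 one_pos
  have hQP : ∀ h : ℝ≥0, Integrable (fun ω => (1 - Real.exp (-X h ω)) * Q (X h ω)) P := by
    intro h
    have hm := hX.measurable h
    refine ((hpolyP p₁ h).abs.add (hintP1 h)).mono' (by fun_prop) (ae_of_all _ fun ω => ?_)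
    have h1 := hp₁ _ (hX.nonneg h ω)
    have h2 := hnn _ (hX.nonneg h ω)
    rw [Real.norm_eq_abs, abs_mul, abs_of_nonneg h2, Pi.add_apply, abs_mul, abs_of_nonneg h2]
    have h3 := abs_sub_abs_le_abs_sub (Q (X h ω)) (p₁.eval (Real.exp (-X h ω)))
    rw [abs_sub_comm] at h3
    nlinarith
  have hQν : Integrable (fun z => (1 - Real.exp (-z)) * Q z) ν := by
    refine ((hpolyν p₁).abs.add hintν1).mono' (by fun_prop) ?_
    filter_upwards [hν.ae_pos] with z hz
    have h1 := hp₁ _ hz.le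
    have h2 := hnn _ hz.le
    rw [Real.norm_eq_abs, abs_mul, abs_of_nonneg h2, Pi.add_apply, abs_mul, abs_of_nonneg h2]
    have h3 := abs_sub_abs_le_abs_sub (Q z) (p₁.eval (Real.exp (-z)))
    rw [abs_sub_comm] at h3
    nlinarith
  rw [Metric.tendsto_nhds]
  intro η hη
  set A := ∫ z, (1 - Real.exp (-z)) ∂ν with hA
  have hA0 : 0 ≤ A := integral_nonneg_of_ae (by
    filter_upwards [hν.ae_pos] with z hz using hnn _ hz.le)
  -- The three errors are at most `δ (A + 1)`, `δ` and `δ A`, where `A + 1` bounds the total mass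
  -- for small `h`.
  set δ := η / (2 * A + 3) with hδ
  have hδ0 : 0 < δ := by positivity
  obtain ⟨p, hp⟩ := happ δ hδ0
  filter_upwards [Metric.tendsto_nhds.1 (hptend p) δ hδ0, Metric.tendsto_nhds.1 hone 1 one_pos,
    self_mem_nhdsWithin] with h h1 h2 hh0
  have hh : (0 : ℝ) < h := hh0
  rw [Real.dist_eq] at h1 h2 ⊢
  have e1 : |(∫ ω, (1 - Real.exp (-X h ω)) * Q (X h ω) ∂P) / h -
      (∫ ω, (1 - Real.exp (-X h ω)) * p.eval (Real.exp (-X h ω)) ∂P) / h| ≤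
      δ * ((∫ ω, (1 - Real.exp (-X h ω)) ∂P) / h) := by
    rw [← sub_div, abs_div, abs_of_pos hh, ← mul_div_assoc]
    refine div_le_div_of_nonneg_right ?_ hh.le
    rw [← integral_sub (hQP h) (hpolyP p h), ← integral_const_mul]
    refine (abs_integral_le_integral_abs).trans (integral_mono
      ((hQP h).sub (hpolyP p h)).abs ((hintP1 h).const_mul δ) fun ω => ?_)
    have h3 := hp _ (hX.nonneg h ω)
    have h4 := hnn _ (hX.nonneg h ω)
    simp only
    rw [← mul_sub, abs_mul, abs_of_nonneg h4, abs_sub_comm, mul_comm]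
    exact mul_le_mul_of_nonneg_right h3 h4
  have e2 : |(∫ z, (1 - Real.exp (-z)) * Q z ∂ν) -
      ∫ z, (1 - Real.exp (-z)) * p.eval (Real.exp (-z)) ∂ν| ≤ δ * A := by
    rw [← integral_sub hQν (hpolyν p), hA, ← integral_const_mul]
    refine (abs_integral_le_integral_abs).trans (integral_mono_ae
      (hQν.sub (hpolyν p)).abs (hintν1.const_mul δ) ?_)
    filter_upwards [hν.ae_pos] with z hz
    have h3 := hp _ hz.le
    have h4 := hnn _ hz.le
    rw [← mul_sub, abs_mul, abs_of_nonneg h4, abs_sub_comm, mul_comm]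
    exact mul_le_mul_of_nonneg_right h3 h4
  have e3 : δ * ((∫ ω, (1 - Real.exp (-X h ω)) ∂P) / h) ≤ δ * (A + 1) :=
    mul_le_mul_of_nonneg_left (by linarith [(abs_lt.1 h2).2]) hδ0.le
  have e4 : δ * (2 * A + 3) = η := by rw [hδ]; field_simp
  rw [abs_le] at e1 e2
  rw [abs_lt] at h1 ⊢
  constructor <;> nlinarith [e1.1, e1.2, e2.1, e2.2, h1.1, h1.2]

/-- The substitution `y = e^{-z}` maps `[0, ∞)` onto `(0, 1]`. The limit at infinity extends the
function continuously to `y = 0`, and Weierstrass' theorem applies on `[0, 1]`. -/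
theorem exists_polynomial_exp_neg_near {Q : ℝ → ℝ} (hQ : Continuous Q) {L : ℝ}
    (hL : Tendsto Q atTop (𝓝 L)) {δ : ℝ} (hδ : 0 < δ) :
    ∃ p : Polynomial ℝ, ∀ z, 0 ≤ z → |p.eval (Real.exp (-z)) - Q z| ≤ δ := by
  set q : ℝ → ℝ := fun y => if y ≤ 0 then L else Q (-Real.log y) with hq
  have hqc : ContinuousOn q (Icc 0 1) := by
    intro y hy
    rcases hy.1.eq_or_lt with h | h
    · subst h
      have h1 : Tendsto (fun y => Q (-Real.log y)) (𝓝[>] 0) (𝓝 L) :=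
        hL.comp (tendsto_neg_atBot_atTop.comp Real.tendsto_log_nhdsGT_zero)
      have h2 : Tendsto q (𝓝[>] 0) (𝓝 (q 0)) := by
        have : q 0 = L := by simp [hq]
        rw [this]
        refine h1.congr' ?_
        filter_upwards [self_mem_nhdsWithin] with y hy
        have : ¬ y ≤ 0 := not_le.2 hy
        simp [hq, this]
      have h3 : ContinuousWithinAt q (Ioi 0) 0 := h2
      exact (continuousWithinAt_Ioi_iff_Ici.1 h3).mono Icc_subset_Ici_self
    · have : ContinuousAt (fun y => Q (-Real.log y)) y :=
        (hQ.continuousAt).comp (Real.continuousAt_log h.ne').neg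
      refine (this.congr ?_).continuousWithinAt
      filter_upwards [lt_mem_nhds h] with x hx
      have : ¬ x ≤ 0 := not_le.2 hx
      simp [hq, this]
  obtain ⟨p, hp⟩ := exists_polynomial_near_of_continuousOn 0 1 q hqc δ hδ
  refine ⟨p, fun z hz => ?_⟩
  have h1 := hp (Real.exp (-z)) ⟨(Real.exp_pos _).le, by simpa using hz⟩
  have h2 : q (Real.exp (-z)) = Q z := by simp [hq, not_le.2 (Real.exp_pos (-z))]
  rw [h2] at h1
  exact h1.le

/-- Small-time asymptotics: `h⁻¹ E F(X_h) → ∫ F dν` for continuous `F` that vanish near `0` and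
have a limit at infinity. -/
theorem IsRegularSubordinator.tendsto_div (hν : IsSubordinatorLevyMeasure ν)
    (hX : IsRegularSubordinator P ν X) {F : ℝ → ℝ} (hF : Continuous F) {L b : ℝ} (hb : 0 < b)
    (hFb : ∀ z ≤ b, F z = 0) (hL : Tendsto F atTop (𝓝 L)) :
    Tendsto (fun h : ℝ≥0 => (∫ ω, F (X h ω) ∂P) / h) (𝓝[>] 0) (𝓝 (∫ z, F z ∂ν)) := by
  -- The weight `1 - e^{-z}` is truncated from below so that `F / D` is continuous everywhere. The
  -- truncation acts only for `z ≤ b`, where `F` vanishes.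
  set D : ℝ → ℝ := fun z => max (1 - Real.exp (-z)) (1 - Real.exp (-b)) with hD
  have hb1 : 0 < 1 - Real.exp (-b) := by simpa using hb
  have hmon : ∀ {z : ℝ}, b ≤ z → 1 - Real.exp (-b) ≤ 1 - Real.exp (-z) := fun h =>
    sub_le_sub_left (Real.exp_le_exp.2 (neg_le_neg h)) 1
  have hDpos : ∀ z, 0 < D z := fun z => lt_max_of_lt_right hb1
  have hDc : Continuous D := by fun_prop
  have hFQ : ∀ z, 0 ≤ z → F z = (1 - Real.exp (-z)) * (F z / D z) := by
    intro z hz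
    rcases le_total z b with h | h
    · simp [hFb z h]
    · have : D z = 1 - Real.exp (-z) := max_eq_left (hmon h)
      rw [← this, mul_div_cancel₀ _ (hDpos z).ne']
  have hQc : Continuous fun z => F z / D z := hF.div hDc fun z => (hDpos z).ne'
  have hDL : Tendsto D atTop (𝓝 1) := by
    have : Tendsto (fun z : ℝ => 1 - Real.exp (-z)) atTop (𝓝 1) := by
      simpa using Real.tendsto_exp_neg_atTop_nhds_zero.const_sub 1
    refine this.congr' ?_
    filter_upwards [eventually_ge_atTop b] with z hz
    exact (max_eq_left (hmon hz)).symm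
  have hQL : Tendsto (fun z => F z / D z) atTop (𝓝 L) := by
    have := hL.div hDL one_ne_zero
    rw [div_one] at this
    exact this
  have := hX.tendsto_div_of_approx hν hQc.measurable
    fun δ hδ => exists_polynomial_exp_neg_near hQc hQL hδ
  have h1 : ∫ z, (1 - Real.exp (-z)) * (F z / D z) ∂ν = ∫ z, F z ∂ν := by
    refine integral_congr_ae ?_
    filter_upwards [hν.ae_pos] with z hz using (hFQ z hz.le).symm
  rw [h1] at this
  refine this.congr fun h => ?_
  congr 1
  exact integral_congr_ae (ae_of_all _ fun ω => (hFQ _ (hX.nonneg h ω)).symm)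

end SmallTime

/-! ### Sums over partitions and atoms of a measure -/

section RiemannSums

theorem exists_mem_Ioc_succ_of_mem_Ioc {α : Type*} [LinearOrder α] (a : ℕ → α) (n : ℕ) {r : α}
    (hr : r ∈ Ioc (a 0) (a n)) : ∃ i < n, r ∈ Ioc (a i) (a (i + 1)) := by
  induction n with
  | zero => simp at hr
  | succ n ih =>
    rcases le_or_gt r (a n) with h | h
    · obtain ⟨i, hi, hri⟩ := ih ⟨hr.1, h⟩
      exact ⟨i, by omega, hri⟩
    · exact ⟨n, by omega, h, hr.2⟩

variable {m : Measure ℝ≥0}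

theorem measure_closedBall_ne_top (hm : ∀ a b, m (Ioc a b) ≠ ∞) (h0 : m {0} = 0) (r : ℝ≥0)
    (δ : ℝ) : m (Metric.closedBall r δ) ≠ ∞ := by
  refine ne_top_of_le_ne_top (b := m ({0} ∪ Ioc 0 (r + δ.toNNReal))) ?_
    (measure_mono fun x hx => ?_)
  · refine ne_top_of_le_ne_top ?_ (measure_union_le _ _)
    rw [h0, zero_add]
    exact hm _ _
  · rcases eq_or_ne x 0 with h | h
    · exact Or.inl h
    · refine Or.inr ⟨pos_iff_ne_zero.2 h, ?_⟩
      rw [Metric.mem_closedBall, NNReal.dist_eq] at hx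
      rw [← NNReal.coe_le_coe, NNReal.coe_add]
      linarith [le_abs_self ((x : ℝ) - r), Real.le_coe_toNNReal δ]

theorem tendsto_measureReal_closedBall (hm : ∀ a b, m (Ioc a b) ≠ ∞) (h0 : m {0} = 0) (r : ℝ≥0)
    {δ : ℕ → ℝ} (hδ : Tendsto δ atTop (𝓝 0)) (hδ0 : ∀ n, 0 ≤ δ n) :
    Tendsto (fun n => m.real (Metric.closedBall r (δ n))) atTop (𝓝 (m.real {r})) := by
  have h1 : Tendsto (fun δ => m (Metric.cthickening δ {r})) (𝓝 0) (𝓝 (m {r})) := by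
    refine tendsto_measure_cthickening_of_isClosed ⟨1, one_pos, ?_⟩ isClosed_singleton
    rw [Metric.cthickening_singleton r zero_le_one]
    exact measure_closedBall_ne_top hm h0 r 1
  have hr : m {r} ≠ ∞ := ne_top_of_le_ne_top (measure_closedBall_ne_top hm h0 r 1)
    (measure_mono (by simp))
  have h2 := (ENNReal.tendsto_toReal hr).comp (h1.comp hδ)
  refine h2.congr fun n => ?_
  simp only [Function.comp, Metric.cthickening_singleton r (hδ0 n), Measure.real]

/-- Riemann-type sums of a function of the increments of `m` converge to an integral over the
atoms of `m`. -/
theorem tendsto_sum_mul_measureReal_Ioc (hm : ∀ a b, m (Ioc a b) ≠ ∞) (h0 : m {0} = 0)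
    {G : ℝ → ℝ} {C : ℝ} (hGC : ∀ y, |G y| ≤ C)
    (hG : ∀ y, ContinuousWithinAt G (Ici y) y) (s t : ℝ≥0) :
    Tendsto (fun n : ℕ => ∑ i ∈ Finset.range n,
      G (m.real (Ioc (s + i * (t / n)) (s + (i + 1 : ℕ) * (t / n)))) *
        m.real (Ioc (s + i * (t / n)) (s + (i + 1 : ℕ) * (t / n))))
      atTop (𝓝 (∫ r in Ioc s (s + t), G (m.real {r}) ∂m)) := by
  set a : ℕ → ℕ → ℝ≥0 := fun n i => s + i * (t / n) with ha
  have hamono : ∀ n, Monotone (a n) := fun n i j hij => by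
    simp only [ha]
    gcongr
  have ha0 : ∀ n, a n 0 = s := fun n => by simp [ha]
  have han : ∀ n, 0 < n → a n n = s + t := fun n hn => by
    simp only [ha]
    rw [mul_div_cancel₀]
    exact_mod_cast hn.ne'
  -- The Riemann sum is the integral over `(s, s + t]` against `m` of this step function, whose
  -- value at `r` depends on the mass of the cell containing `r`.
  set step : ℕ → ℝ≥0 → ℝ := fun n r => ∑ i ∈ Finset.range n,
    (Ioc (a n i) (a n (i + 1))).indicator (fun _ => G (m.real (Ioc (a n i) (a n (i + 1))))) r
    with hstep
  have hval : ∀ n i r, i < n → r ∈ Ioc (a n i) (a n (i + 1)) →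
      step n r = G (m.real (Ioc (a n i) (a n (i + 1)))) := by
    intro n i r hi hr
    simp only [hstep]
    rw [Finset.sum_eq_single i]
    · rw [indicator_of_mem hr]
    · intro j _ hji
      refine indicator_of_notMem (fun hj => ?_) _
      exact (hamono n).pairwise_disjoint_on_Ioc_succ hji |>.le_bot ⟨hj, hr⟩
    · intro h
      exact absurd (Finset.mem_range.2 hi) h
  have hC0 : 0 ≤ C := (abs_nonneg _).trans (hGC 0)
  have : IsFiniteMeasure (m.restrict (Ioc s (s + t))) :=
    ⟨by simpa using (hm s (s + t)).lt_top⟩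
  have hstepm : ∀ n, Measurable (step n) := fun n =>
    Finset.measurable_sum _ fun i _ => measurable_const.indicator measurableSet_Ioc
  have hlim : Tendsto (fun n => ∫ r in Ioc s (s + t), step n r ∂m) atTop
      (𝓝 (∫ r in Ioc s (s + t), G (m.real {r}) ∂m)) := by
    refine tendsto_integral_of_dominated_convergence (fun _ => C)
      (fun n => (hstepm n).aestronglyMeasurable) (integrable_const C) (fun n => ?_) ?_
    · refine ae_of_all _ fun r => ?_
      by_cases h : ∃ i < n, r ∈ Ioc (a n i) (a n (i + 1))
      · obtain ⟨i, hi, hr⟩ := h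
        rw [hval n i r hi hr]
        exact hGC _
      · push Not at h
        have : step n r = 0 := Finset.sum_eq_zero fun i hi =>
          indicator_of_notMem (h i (Finset.mem_range.1 hi)) _
        simpa [this] using hC0
    · filter_upwards [ae_restrict_mem measurableSet_Ioc] with r hr
      have hex : ∀ n : ℕ, 0 < n → ∃ i < n, r ∈ Ioc (a n i) (a n (i + 1)) := fun n hn =>
        exists_mem_Ioc_succ_of_mem_Ioc (a n) n (by rwa [ha0, han n hn])
      choose! idx hidx hmem using hex
      have hsub : ∀ n, 0 < n → Ioc (a n (idx n)) (a n (idx n + 1)) ⊆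
          Metric.closedBall r ((t : ℝ) / n) := by
        intro n hn x hx
        have h1 := hmem n hn
        have h2 : (a n (idx n + 1) : ℝ) = a n (idx n) + t / n := by
          simp only [ha]; push_cast; ring
        rw [Metric.mem_closedBall, NNReal.dist_eq, abs_le]
        have h3 : (a n (idx n) : ℝ) < x := hx.1
        have h4 : (x : ℝ) ≤ a n (idx n + 1) := hx.2
        have h5 : (a n (idx n) : ℝ) < r := h1.1
        have h6 : (r : ℝ) ≤ a n (idx n + 1) := h1.2
        constructor <;> linarith
      have hball := tendsto_measureReal_closedBall hm h0 r
        (δ := fun n : ℕ => (t : ℝ) / n) (tendsto_const_div_atTop_nhds_zero_nat _)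
        (fun n => by positivity)
      have hlow : ∀ n, 0 < n → m.real {r} ≤ m.real (Ioc (a n (idx n)) (a n (idx n + 1))) :=
        fun n hn => measureReal_mono (singleton_subset_iff.2 (hmem n hn)) (hm _ _)
      have hup : ∀ n, 0 < n → m.real (Ioc (a n (idx n)) (a n (idx n + 1))) ≤
          m.real (Metric.closedBall r ((t : ℝ) / n)) := fun n hn =>
        measureReal_mono (hsub n hn) (measure_closedBall_ne_top hm h0 r _)
      -- The cells shrink to `r` and always contain it, so their masses tend to the atom at `r` from
      -- above. This is why right-continuity of `G` is enough.
      have hconv : Tendsto (fun n => m.real (Ioc (a n (idx n)) (a n (idx n + 1)))) atTop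
          (𝓝[≥] (m.real {r})) := by
        refine tendsto_nhdsWithin_iff.2 ⟨?_, ?_⟩
        · refine tendsto_of_tendsto_of_tendsto_of_le_of_le' tendsto_const_nhds hball ?_ ?_
          · filter_upwards [eventually_gt_atTop 0] with n hn using hlow n hn
          · filter_upwards [eventually_gt_atTop 0] with n hn using hup n hn
        · filter_upwards [eventually_gt_atTop 0] with n hn using hlow n hn
      refine ((hG (m.real {r})).tendsto.comp hconv).congr' ?_
      filter_upwards [eventually_gt_atTop 0] with n hn
      exact (hval n _ r (hidx n hn) (hmem n hn)).symm
  refine hlim.congr' ?_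
  filter_upwards [eventually_gt_atTop 0] with n hn
  simp only [hstep]
  rw [integral_finsetSum _ fun i _ => (integrable_const _).indicator measurableSet_Ioc]
  refine Finset.sum_congr rfl fun i hi => ?_
  have hi' := Finset.mem_range.1 hi
  have hsub : Ioc (a n i) (a n (i + 1)) ⊆ Ioc s (s + t) := by
    rw [← han n hn, ← ha0 n]
    exact Ioc_subset_Ioc (hamono n (Nat.zero_le i)) (hamono n (by omega))
  rw [integral_indicator measurableSet_Ioc, Measure.restrict_restrict measurableSet_Ioc,
    inter_eq_left.2 hsub, setIntegral_const, smul_eq_mul, mul_comm]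

end RiemannSums

/-! ### Sums over jumps and their Laplace transforms -/

section Jumps

/-- A nonnegative right-continuous function, vanishing below `b > 0` and bounded by a multiple of
the identity, to be summed over the jumps of a path. -/
structure IsJumpWeight (f : ℝ → ℝ) (b C : ℝ) : Prop where
  pos : 0 < b
  zero : ∀ y < b, f y = 0
  nonneg : ∀ y, 0 ≤ f y
  le : ∀ y, 0 ≤ y → f y ≤ C * y
  rc : ∀ y, ContinuousWithinAt f (Ici y) y
  measurable : Measurable f

/-- The sum of `f (jump X r)` over `r ∈ A`. -/
noncomputable def jumpSum {Ω : Type u} (X : ℝ≥0 → Ω → ℝ) (f : ℝ → ℝ) (A : Set ℝ≥0) (ω : Ω) : ℝ :=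
  ∑' r : A, f (jump X r ω)

theorem jumpSum_eq_sum {Ω : Type u} {X : ℝ≥0 → Ω → ℝ} {f : ℝ → ℝ} {b : ℝ} (hf : ∀ y < b, f y = 0) {A : Set ℝ≥0} {ω : Ω}
    (h : {r | r ∈ A ∧ b ≤ jump X r ω}.Finite) :
    jumpSum X f A ω = ∑ r ∈ h.toFinset, f (jump X r ω) := by
  rw [jumpSum, tsum_subtype A (fun r => f (jump X r ω)), tsum_eq_sum (s := h.toFinset)]
  · refine Finset.sum_congr rfl fun r hr => indicator_of_mem ?_ _
    exact ((h.mem_toFinset).1 hr).1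
  · intro r hr
    by_cases hrA : r ∈ A
    · rw [indicator_of_mem hrA]
      refine hf _ (not_le.1 fun hb => hr ?_)
      exact h.mem_toFinset.2 ⟨hrA, hb⟩
    · exact indicator_of_notMem hrA _

theorem jumpSum_nonneg {Ω : Type u} {X : ℝ≥0 → Ω → ℝ} {f : ℝ → ℝ} (hf : ∀ y, 0 ≤ f y)
    (A : Set ℝ≥0) (ω : Ω) : 0 ≤ jumpSum X f A ω := tsum_nonneg fun _ => hf _

theorem jump_zero {Ω : Type u} (X : ℝ≥0 → Ω → ℝ) (ω : Ω) :
    jump X 0 ω = 0 := by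
  have : Function.leftLim (fun s => X s ω) 0 = X 0 ω := by
    apply leftLim_eq_of_eq_bot
    simp
  simp [jump, this]

variable {Ω : Type u} [mΩ : MeasurableSpace Ω] {P : Measure Ω}
  {ν : Measure ℝ} {X : ℝ≥0 → Ω → ℝ}

/-- The path of `ω` as a Stieltjes function. -/
noncomputable def IsRegularSubordinator.path (hX : IsRegularSubordinator P ν X) (ω : Ω) :
    StieltjesFunction ℝ≥0 :=
  ⟨fun t => X t ω, hX.mono ω, hX.rc ω⟩

theorem IsRegularSubordinator.jump_nonneg (hX : IsRegularSubordinator P ν X) (r : ℝ≥0) (ω : Ω) :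
    0 ≤ jump X r ω :=
  sub_nonneg.2 ((hX.mono ω).leftLim_le le_rfl)

theorem IsRegularSubordinator.measureReal_singleton (hX : IsRegularSubordinator P ν X) (r : ℝ≥0)
    (ω : Ω) : (hX.path ω).measure.real {r} = jump X r ω := by
  rw [Measure.real, StieltjesFunction.measure_singleton]
  exact ENNReal.toReal_ofReal (hX.jump_nonneg r ω)

theorem IsRegularSubordinator.measureReal_Ioc (hX : IsRegularSubordinator P ν X) {s t : ℝ≥0}
    (hst : s ≤ t) (ω : Ω) : (hX.path ω).measure.real (Ioc s t) = X t ω - X s ω := by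
  rw [Measure.real, StieltjesFunction.measure_Ioc]
  exact ENNReal.toReal_ofReal (sub_nonneg.2 (hX.mono ω hst))

theorem IsRegularSubordinator.measure_Ioc_ne_top (hX : IsRegularSubordinator P ν X) (ω : Ω)
    (s t : ℝ≥0) : (hX.path ω).measure (Ioc s t) ≠ ∞ := by
  rw [StieltjesFunction.measure_Ioc]
  exact ENNReal.ofReal_ne_top

theorem IsRegularSubordinator.measure_singleton_zero (hX : IsRegularSubordinator P ν X) (ω : Ω) :
    (hX.path ω).measure {0} = 0 := by
  rw [StieltjesFunction.measure_singleton]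
  change ENNReal.ofReal (jump X 0 ω) = 0
  rw [jump_zero, ENNReal.ofReal_zero]

/-- Jumps are the atoms of the Stieltjes measure of the path. This measure is finite on `(0, t]`, so
only finitely many atoms there have mass at least `b`. -/
theorem IsRegularSubordinator.finite_jumps (hX : IsRegularSubordinator P ν X) (ω : Ω) {b : ℝ}
    (hb : 0 < b) (t : ℝ≥0) : {r | r ∈ Iic t ∧ b ≤ jump X r ω}.Finite := by
  have h1 : Set.Finite {r : Ioc 0 t | ENNReal.ofReal b ≤ (hX.path ω).measure {(r : ℝ≥0)}} := by
    refine Measure.finite_const_le_meas_of_disjoint_iUnion _ (ENNReal.ofReal_pos.2 hb)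
      (fun r => measurableSet_singleton _) (fun r s hrs => ?_) ?_
    · simpa [Function.onFun, Subtype.ext_iff] using hrs
    · refine ne_top_of_le_ne_top (hX.measure_Ioc_ne_top ω 0 t) (measure_mono ?_)
      exact iUnion_subset fun r => singleton_subset_iff.2 r.2
  refine (h1.image Subtype.val).subset fun r hr => ?_
  have hr0 : r ≠ 0 := fun h => by
    have := hr.2
    rw [h, jump_zero] at this
    linarith
  refine ⟨⟨r, pos_iff_ne_zero.2 hr0, hr.1⟩, ?_, rfl⟩
  change ENNReal.ofReal b ≤ (hX.path ω).measure {r}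
  rw [StieltjesFunction.measure_singleton]
  exact ENNReal.ofReal_le_ofReal hr.2

theorem IsRegularSubordinator.finite_jumps_Ioc (hX : IsRegularSubordinator P ν X) (ω : Ω) {b : ℝ}
    (hb : 0 < b) (s t : ℝ≥0) : {r | r ∈ Ioc s t ∧ b ≤ jump X r ω}.Finite :=
  (hX.finite_jumps ω hb t).subset fun _ hr => ⟨hr.1.2, hr.2⟩

/-- The sum over jumps is the limit of sums over the increments along equidistant partitions. -/
theorem IsRegularSubordinator.tendsto_sum_increments (hX : IsRegularSubordinator P ν X) {f : ℝ → ℝ}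
    {b C : ℝ} (hf : IsJumpWeight f b C) (s t : ℝ≥0) (ω : Ω) :
    Tendsto (fun n : ℕ => ∑ i ∈ Finset.range n,
      f (X (s + (i + 1 : ℕ) * (t / n)) ω - X (s + i * (t / n)) ω)) atTop
      (𝓝 (jumpSum X f (Ioc s (s + t)) ω)) := by
  set m := (hX.path ω).measure with hm
  -- Writing `f y = G y * y` with `G` bounded turns the sum of `f` over increments into a Riemann
  -- sum against the Stieltjes measure.
  set G : ℝ → ℝ := fun y => f y / max y b with hG
  have hb := hf.pos
  have hmax : ∀ y, 0 < max y b := fun y => lt_max_of_lt_right hb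
  have hGf : ∀ y, f y = G y * y := by
    intro y
    rcases lt_or_ge y b with h | h
    · simp [hG, hf.zero y h]
    · have : max y b = y := max_eq_left h
      simp only [hG, this]
      field_simp [(hb.trans_le h).ne']
  have hC : 0 ≤ C := by
    have h1 := (hf.nonneg b).trans (hf.le b hb.le)
    exact nonneg_of_mul_nonneg_left h1 hb
  have hGC : ∀ y, |G y| ≤ C := by
    intro y
    rw [abs_of_nonneg (div_nonneg (hf.nonneg y) (hmax y).le), div_le_iff₀ (hmax y)]
    rcases lt_or_ge y b with h | h
    · rw [hf.zero y h]; exact mul_nonneg hC (hmax y).le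
    · exact (hf.le y (hb.le.trans h)).trans (mul_le_mul_of_nonneg_left (le_max_left _ _) hC)
  have hGrc : ∀ y, ContinuousWithinAt G (Ici y) y := fun y =>
    (hf.rc y).div (by fun_prop) (hmax y).ne'
  have h1 := tendsto_sum_mul_measureReal_Ioc (hX.measure_Ioc_ne_top ω)
    (hX.measure_singleton_zero ω) hGC hGrc s t
  have hinc : ∀ n i : ℕ, m.real (Ioc (s + i * (t / n)) (s + (i + 1 : ℕ) * (t / n))) =
      X (s + (i + 1 : ℕ) * (t / n)) ω - X (s + i * (t / n)) ω := fun n i =>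
    hX.measureReal_Ioc (by gcongr; simp) ω
  simp only [← hm, hinc, ← hGf] at h1
  convert h1 using 2
  have hfin := hX.finite_jumps_Ioc ω hb s (s + t)
  rw [jumpSum_eq_sum hf.zero hfin]
  have h2 : ∫ r in Ioc s (s + t), G (m.real {r}) ∂m =
      ∫ r in (hfin.toFinset : Set ℝ≥0), G (m.real {r}) ∂m := by
    refine setIntegral_eq_of_subset_of_forall_sdiff_eq_zero measurableSet_Ioc ?_ ?_
    · intro r hr
      exact ((hfin.mem_toFinset).1 hr).1
    · intro r hr
      rw [hm, hX.measureReal_singleton]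
      have : jump X r ω < b := by
        by_contra hc
        exact hr.2 (hfin.mem_toFinset.2 ⟨hr.1, not_lt.1 hc⟩)
      simp [hG, hf.zero _ this]
  rw [h2, setIntegral_finset]
  · refine Finset.sum_congr rfl fun r _ => ?_
    rw [hm, hX.measureReal_singleton, hGf, smul_eq_mul, mul_comm]
  · have : IsFiniteMeasure (m.restrict (Ioc s (s + t))) :=
      ⟨by rw [Measure.restrict_apply_univ]; exact (hX.measure_Ioc_ne_top ω s (s + t)).lt_top⟩
    have h3 := IntegrableOn.finset (μ := m.restrict (Ioc s (s + t))) (s := hfin.toFinset)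
      (f := fun r => G (m.real {r}))
    rwa [IntegrableOn, Measure.restrict_restrict hfin.toFinset.measurableSet,
      inter_eq_left.2 fun r hr => ((hfin.mem_toFinset).1 hr).1] at h3

/-- Left limits are bypassed: the sum is a pointwise limit of functions of finitely many values of
the path up to time `s + t`. -/
theorem IsRegularSubordinator.measurable_jumpSum (hX : IsRegularSubordinator P ν X) {f : ℝ → ℝ}
    {b C : ℝ} (hf : IsJumpWeight f b C) (s t : ℝ≥0) :
    Measurable[past X (s + t)] (jumpSum X f (Ioc s (s + t))) := by
  have h1 : ∀ n : ℕ, Measurable[past X (s + t)] fun ω => ∑ i ∈ Finset.range n,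
      f (X (s + (i + 1 : ℕ) * (t / n)) ω - X (s + i * (t / n)) ω) := by
    intro n
    have key : ∀ i : ℕ, i ≤ n → s + i * (t / n) ≤ s + t := by
      intro i hi
      gcongr
      rcases Nat.eq_zero_or_pos n with h | h
      · simp [h]
      · calc (i : ℝ≥0) * (t / n) ≤ n * (t / n) := by gcongr
          _ = t := mul_div_cancel₀ _ (by exact_mod_cast h.ne')
    refine @Finset.measurable_sum _ _ _ _ _ _ (past X (s + t)) _ _ fun i hi => ?_
    have hi' := Finset.mem_range.1 hi
    exact hf.measurable.comp (Measurable.fun_sub (measurable_past (key (i + 1) (by omega)))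
      (measurable_past (key i (by omega))))
  exact @measurable_of_tendsto_metrizable _ _ (past X (s + t)) _ _ _ _ _ _ h1
    (tendsto_pi_nhds.2 fun ω => hX.tendsto_sum_increments hf s t ω)

theorem IsRegularSubordinator.jumpSum_le (hX : IsRegularSubordinator P ν X) {f : ℝ → ℝ}
    {b : ℝ} (hf : IsJumpWeight f b 1) {s t : ℝ≥0} (hst : s ≤ t) (ω : Ω) :
    jumpSum X f (Ioc s t) ω ≤ X t ω - X s ω := by
  have h1 := hX.tendsto_sum_increments hf s (t - s) ω
  rw [add_tsub_cancel_of_le hst] at h1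
  refine le_of_tendsto h1 ?_
  filter_upwards [eventually_gt_atTop 0] with n hn
  calc _ ≤ ∑ i ∈ Finset.range n,
        (X (s + (i + 1 : ℕ) * ((t - s) / n)) ω - X (s + i * ((t - s) / n)) ω) := by
        refine Finset.sum_le_sum fun i _ => ?_
        have := hf.le (X (s + (i + 1 : ℕ) * ((t - s) / n)) ω - X (s + i * ((t - s) / n)) ω)
          (sub_nonneg.2 (hX.mono ω (by gcongr; simp)))
        rwa [one_mul] at this
    _ = X t ω - X s ω := by
        rw [Finset.sum_range_sub (fun i : ℕ => X (s + i * ((t - s) / n)) ω)]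
        rw [mul_div_cancel₀ _ (by exact_mod_cast hn.ne'), add_tsub_cancel_of_le hst]
        simp

variable [IsProbabilityMeasure P]

/-- The last increment is split off repeatedly, the remaining factors being absorbed into the past.
-/
theorem IsRegularSubordinator.lintegral_mul_prod_increments (hX : IsRegularSubordinator P ν X)
    {g : ℝ → ℝ≥0∞} (hg : Measurable g) (s h : ℝ≥0) {V : Ω → ℝ≥0∞} (hV : Measurable[past X s] V)
    (n : ℕ) :
    ∫⁻ ω, V ω * ∏ i ∈ Finset.range n, g (X (s + (i + 1 : ℕ) * h) ω - X (s + i * h) ω) ∂P =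
      (∫⁻ ω, g (X h ω) ∂P) ^ n * ∫⁻ ω, V ω ∂P := by
  induction n with
  | zero => simp
  | succ n ih =>
    have hm : Measurable[past X (s + n * h)] fun ω => V ω * ∏ i ∈ Finset.range n,
        g (X (s + (i + 1 : ℕ) * h) ω - X (s + i * h) ω) := by
      refine Measurable.mul (hV.mono (past_mono (by simp)) le_rfl) ?_
      refine Finset.measurable_prod _ fun i hi => ?_
      have hi' : i + 1 ≤ n := Finset.mem_range.1 hi
      refine hg.comp (Measurable.sub (measurable_past ?_) (measurable_past ?_))
      · gcongr
      · have : i ≤ n := by omega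
        gcongr
    have h1 := lintegral_past_mul hX (t := h) hm hg
    rw [ih] at h1
    rw [pow_succ, mul_assoc, mul_comm (∫⁻ ω, g (X h ω) ∂P), ← mul_assoc, ← h1]
    refine lintegral_congr fun ω => ?_
    rw [Finset.prod_range_succ, ← mul_assoc]
    congr 4
    push_cast
    ring

/-- The Laplace transform of sums of a continuous function over the jumps. -/
theorem IsRegularSubordinator.lintegral_mul_exp_jumpSum_of_continuous
    (hν : IsSubordinatorLevyMeasure ν) (hX : IsRegularSubordinator P ν X) {f : ℝ → ℝ} {b C : ℝ}
    (hf : IsJumpWeight f b C) (hfc : Continuous f) (hfL : Tendsto f atTop atTop) {u : ℝ}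
    (hu : 0 < u) (s t : ℝ≥0) {V : Ω → ℝ≥0∞} (hV : Measurable[past X s] V) (hV1 : ∀ ω, V ω ≤ 1) :
    ∫⁻ ω, V ω * ENNReal.ofReal (Real.exp (-(u * jumpSum X f (Ioc s (s + t)) ω))) ∂P =
      ENNReal.ofReal (Real.exp (-(t * ∫ z, (1 - Real.exp (-(u * f z))) ∂ν))) *
        ∫⁻ ω, V ω ∂P := by
  rcases eq_or_ne t 0 with rfl | ht
  · simp [jumpSum]
  have hVm : Measurable V := hV.mono (past_le hX.measurable s) le_rfl
  set F : ℝ → ℝ := fun z => 1 - Real.exp (-(u * f z)) with hF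
  have hsmall : Tendsto (fun h : ℝ≥0 => (∫ ω, F (X h ω) ∂P) / h) (𝓝[>] 0) (𝓝 (∫ z, F z ∂ν)) := by
    -- The level `b / 2` appears because `f` is only known to vanish strictly below `b`.
    refine hX.tendsto_div hν (L := 1) (b := b / 2) (by fun_prop) (by linarith [hf.pos]) ?_ ?_
    · intro z hz
      simp [hF, hf.zero z (by linarith [hf.pos])]
    · have : Tendsto (fun z => Real.exp (-(u * f z))) atTop (𝓝 0) :=
        Real.tendsto_exp_neg_atTop_nhds_zero.comp (hfL.const_mul_atTop hu)
      simpa [hF] using this.const_sub 1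
  set g : ℝ → ℝ≥0∞ := fun y => ENNReal.ofReal (Real.exp (-(u * f y))) with hg
  have hgm : Measurable g := by
    have := hf.measurable
    fun_prop
  have hgP : ∀ h : ℝ≥0, ∫⁻ ω, g (X h ω) ∂P = ENNReal.ofReal (1 + -∫ ω, F (X h ω) ∂P) := by
    intro h
    have h1 := hX.measurable h
    have h2 := hf.measurable
    have hint : Integrable (fun ω => Real.exp (-(u * f (X h ω)))) P := by
      refine Integrable.of_bound (C := 1) (by fun_prop) (ae_of_all _ fun ω => ?_)
      rw [Real.norm_of_nonneg (Real.exp_pos _).le]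
      have : 0 ≤ u * f (X h ω) := mul_nonneg hu.le (hf.nonneg _)
      simpa using this
    rw [← ofReal_integral_eq_lintegral_ofReal hint (ae_of_all _ fun ω => (Real.exp_pos _).le)]
    simp only [hF]
    rw [integral_sub (integrable_const _) hint]
    simp
  -- Compound interest: `(1 - E F(X_{t/n}))^n` has the exponential limit because `n E F(X_{t/n}) → t
  -- ∫ F dν`.
  have hpow : Tendsto (fun n : ℕ => (1 + -∫ ω, F (X (t / n) ω) ∂P) ^ n) atTop
      (𝓝 (Real.exp (-(t * ∫ z, F z ∂ν)))) := by
    refine Real.tendsto_one_add_pow_exp_of_tendsto ?_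
    have h1 : Tendsto (fun n : ℕ => t / (n : ℝ≥0)) atTop (𝓝[>] 0) := by
      refine tendsto_nhdsWithin_iff.2 ⟨?_, ?_⟩
      · exact NNReal.tendsto_coe.1 (by simpa using tendsto_const_div_atTop_nhds_zero_nat (t : ℝ))
      · filter_upwards [eventually_gt_atTop 0] with n hn
        have : (0 : ℝ≥0) < n := by exact_mod_cast hn
        exact div_pos (pos_iff_ne_zero.2 ht) this
    have h2 := ((hsmall.comp h1).const_mul (t : ℝ)).neg
    refine h2.congr' ?_
    filter_upwards [eventually_gt_atTop 0] with n hn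
    have hn' : (n : ℝ) ≠ 0 := by exact_mod_cast hn.ne'
    have ht' : (t : ℝ) ≠ 0 := by exact_mod_cast ht
    simp only [Function.comp]
    push_cast
    field_simp
  have hL : Tendsto (fun n : ℕ => ∫⁻ ω, V ω * ∏ i ∈ Finset.range n,
      g (X (s + (i + 1 : ℕ) * (t / n)) ω - X (s + i * (t / n)) ω) ∂P) atTop
      (𝓝 (ENNReal.ofReal (Real.exp (-(t * ∫ z, F z ∂ν))) * ∫⁻ ω, V ω ∂P)) := by
    have h1 : ∀ n : ℕ, ∫⁻ ω, V ω * ∏ i ∈ Finset.range n,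
        g (X (s + (i + 1 : ℕ) * (t / n)) ω - X (s + i * (t / n)) ω) ∂P =
        ENNReal.ofReal ((1 + -∫ ω, F (X (t / n) ω) ∂P) ^ n) * ∫⁻ ω, V ω ∂P := by
      intro n
      rw [hX.lintegral_mul_prod_increments hgm s (t / n) hV n, hgP, ← ENNReal.ofReal_pow]
      have : ∫ ω, F (X (t / n) ω) ∂P ≤ ∫ _, (1 : ℝ) ∂P := by
        refine integral_mono_of_nonneg (ae_of_all _ fun ω => ?_) (integrable_const _)
          (ae_of_all _ fun ω => ?_)
        · have : 0 ≤ u * f (X (t / n) ω) := mul_nonneg hu.le (hf.nonneg _)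
          simpa [hF] using this
        · simp only [hF]
          linarith [Real.exp_pos (-(u * f (X (t / n) ω)))]
      simp only [integral_const, probReal_univ, smul_eq_mul, mul_one] at this
      linarith
    simp only [h1]
    refine ENNReal.Tendsto.mul_const (ENNReal.tendsto_ofReal hpow) (Or.inr ?_)
    refine ne_top_of_le_ne_top (b := 1) ENNReal.one_ne_top ?_
    calc _ ≤ ∫⁻ _, (1 : ℝ≥0∞) ∂P := lintegral_mono hV1
      _ = 1 := by simp
  have hprod : ∀ (n : ℕ) ω, ∏ i ∈ Finset.range n,
      g (X (s + (i + 1 : ℕ) * (t / n)) ω - X (s + i * (t / n)) ω) =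
      ENNReal.ofReal (Real.exp (-(u * ∑ i ∈ Finset.range n,
        f (X (s + (i + 1 : ℕ) * (t / n)) ω - X (s + i * (t / n)) ω)))) := by
    intro n ω
    simp only [hg]
    rw [← ENNReal.ofReal_prod_of_nonneg fun i _ => (Real.exp_pos _).le, ← Real.exp_sum,
      Finset.mul_sum, Finset.sum_neg_distrib]
  simp only [hprod] at hL
  refine tendsto_nhds_unique ?_ hL
  refine tendsto_lintegral_of_dominated_convergence (fun _ => 1) (fun n => ?_) (fun n => ?_)
    (by simp) (ae_of_all _ fun ω => ?_)
  · have h1 := hX.measurable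
    have h2 := hf.measurable
    refine hVm.mul (Measurable.ennreal_ofReal (Real.measurable_exp.comp (Measurable.neg
      (Measurable.const_mul (Finset.measurable_sum _ fun i _ => ?_) _))))
    exact h2.comp ((h1 _).sub (h1 _))
  · refine ae_of_all _ fun ω => mul_le_one' (hV1 ω) ?_
    rw [ENNReal.ofReal_le_one, Real.exp_le_one_iff, neg_nonpos]
    exact mul_nonneg hu.le (Finset.sum_nonneg fun i _ => hf.nonneg _)
  · refine ENNReal.Tendsto.const_mul (ENNReal.tendsto_ofReal ?_)
      (Or.inr (ne_top_of_le_ne_top ENNReal.one_ne_top (hV1 ω)))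
    exact (Real.continuous_exp.tendsto _).comp
      ((hX.tendsto_sum_increments hf s t ω).const_mul u).neg

end Jumps

/-! ### The lattice process and its Laplace exponent -/

section Lattice

/-- Rounding down to a multiple of `ε` (with value `0` on negative numbers). -/
noncomputable def roundDown (ε y : ℝ) : ℝ := ε * (⌊y / ε⌋₊ : ℝ)

variable {ε : ℝ}

theorem roundDown_mono (hε : 0 < ε) : Monotone (roundDown ε) := fun y z h => by
  unfold roundDown
  gcongr

theorem roundDown_le (hε : 0 < ε) {y : ℝ} (hy : 0 ≤ y) : roundDown ε y ≤ y := by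
  have := Nat.floor_le (div_nonneg hy hε.le)
  unfold roundDown
  calc ε * (⌊y / ε⌋₊ : ℝ) ≤ ε * (y / ε) := by gcongr
    _ = y := by field_simp

theorem lt_roundDown_add (hε : 0 < ε) (y : ℝ) : y < roundDown ε y + ε := by
  have := Nat.lt_floor_add_one (y / ε)
  rw [div_lt_iff₀ hε] at this
  unfold roundDown
  linarith

theorem roundDown_nonneg (hε : 0 < ε) (y : ℝ) : 0 ≤ roundDown ε y := by
  unfold roundDown; positivity

theorem roundDown_of_lt (hε : 0 < ε) {y : ℝ} (hy : y < ε) : roundDown ε y = 0 := by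
  have : ⌊y / ε⌋₊ = 0 := Nat.floor_eq_zero.2 ((div_lt_one hε).2 hy)
  simp [roundDown, this]

theorem continuousWithinAt_roundDown (hε : 0 < ε) (y : ℝ) :
    ContinuousWithinAt (roundDown ε) (Ici y) y := by
  have h : y < ε * (⌊y / ε⌋₊ + 1) := by
    have := Nat.lt_floor_add_one (y / ε)
    rwa [div_lt_iff₀' hε] at this
  refine (continuousWithinAt_const (b := roundDown ε y)).congr_of_eventuallyEq ?_ rfl
  filter_upwards [Ico_mem_nhdsGE h] with z hz
  unfold roundDown
  congr 2
  refine le_antisymm ?_ (Nat.floor_le_floor (div_le_div_of_nonneg_right hz.1 hε.le))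
  refine Nat.lt_add_one_iff.1 ((Nat.floor_lt' (by omega)).2 ?_)
  rw [div_lt_iff₀' hε]
  exact_mod_cast hz.2

theorem isJumpWeight_roundDown (hε : 0 < ε) : IsJumpWeight (roundDown ε) ε 1 where
  pos := hε
  zero _ hy := roundDown_of_lt hε hy
  nonneg := roundDown_nonneg hε
  le y hy := by rw [one_mul]; exact roundDown_le hε hy
  rc := continuousWithinAt_roundDown hε
  measurable := (roundDown_mono hε).measurable

/-- A continuous approximation from above of `roundDown`. -/
noncomputable def smoothRoundDown (ε δ y : ℝ) : ℝ := δ⁻¹ * ∫ x in y..(y + δ), roundDown ε x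

theorem intervalIntegrable_roundDown (hε : 0 < ε) (a b : ℝ) :
    IntervalIntegrable (roundDown ε) volume a b :=
  (roundDown_mono hε).intervalIntegrable

theorem roundDown_le_smoothRoundDown (hε : 0 < ε) {δ : ℝ} (hδ : 0 < δ) (y : ℝ) :
    roundDown ε y ≤ smoothRoundDown ε δ y := by
  have h : ∫ _ in y..(y + δ), roundDown ε y ≤ ∫ x in y..(y + δ), roundDown ε x :=
    intervalIntegral.integral_mono_on (by linarith) (by simp) (intervalIntegrable_roundDown hε _ _)
      fun x hx => roundDown_mono hε hx.1
  rw [intervalIntegral.integral_const, smul_eq_mul, add_sub_cancel_left] at h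
  unfold smoothRoundDown
  rw [← div_eq_inv_mul, le_div_iff₀ hδ]
  linarith

theorem smoothRoundDown_le (hε : 0 < ε) {δ : ℝ} (hδ : 0 < δ) (y : ℝ) :
    smoothRoundDown ε δ y ≤ roundDown ε (y + δ) := by
  have h : ∫ x in y..(y + δ), roundDown ε x ≤ ∫ _ in y..(y + δ), roundDown ε (y + δ) :=
    intervalIntegral.integral_mono_on (by linarith) (intervalIntegrable_roundDown hε _ _) (by simp)
      fun x hx => roundDown_mono hε hx.2
  rw [intervalIntegral.integral_const, smul_eq_mul, add_sub_cancel_left] at h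
  unfold smoothRoundDown
  rw [← div_eq_inv_mul, div_le_iff₀ hδ]
  linarith

theorem continuous_smoothRoundDown (hε : 0 < ε) (δ : ℝ) : Continuous (smoothRoundDown ε δ) := by
  have h1 : Continuous fun y => ∫ x in (0 : ℝ)..y, roundDown ε x :=
    intervalIntegral.continuous_primitive (fun a b => intervalIntegrable_roundDown hε a b) 0
  have h2 : ∀ y, smoothRoundDown ε δ y =
      δ⁻¹ * ((∫ x in (0 : ℝ)..(y + δ), roundDown ε x) - ∫ x in (0 : ℝ)..y, roundDown ε x) := by
    intro y
    unfold smoothRoundDown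
    rw [intervalIntegral.integral_interval_sub_left (intervalIntegrable_roundDown hε _ _)
      (intervalIntegrable_roundDown hε _ _)]
  rw [show smoothRoundDown ε δ = _ from funext h2]
  exact continuous_const.mul ((h1.comp (by fun_prop : Continuous fun y : ℝ => y + δ)).sub h1)

/-- The average looks ahead by at most `δ ≤ ε / 2`, so it vanishes below `ε / 2`. If `δ ≤ y` it is
at most `y + δ ≤ 2 y`; if `y < δ` it is `0`. -/
theorem isJumpWeight_smoothRoundDown (hε : 0 < ε) {δ : ℝ} (hδ : 0 < δ) (hδε : δ ≤ ε / 2) :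
    IsJumpWeight (smoothRoundDown ε δ) (ε / 2) 2 where
  pos := by linarith
  zero y hy := by
    refine le_antisymm ?_ ((roundDown_nonneg hε y).trans (roundDown_le_smoothRoundDown hε hδ y))
    exact (smoothRoundDown_le hε hδ y).trans (roundDown_of_lt hε (by linarith)).le
  nonneg y := (roundDown_nonneg hε y).trans (roundDown_le_smoothRoundDown hε hδ y)
  le y hy := by
    refine (smoothRoundDown_le hε hδ y).trans ?_
    rcases le_or_gt δ y with h | h
    · exact (roundDown_le hε (by linarith)).trans (by linarith)
    · rw [roundDown_of_lt hε (by linarith)]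
      linarith
  rc y := (continuous_smoothRoundDown hε δ).continuousWithinAt
  measurable := (continuous_smoothRoundDown hε δ).measurable

theorem tendsto_roundDown_atTop (hε : 0 < ε) : Tendsto (roundDown ε) atTop atTop :=
  tendsto_atTop_mono (f := fun y => y - ε) (fun y => by linarith [lt_roundDown_add hε y])
    (tendsto_atTop_add_const_right _ _ tendsto_id)

theorem tendsto_smoothRoundDown_atTop (hε : 0 < ε) {δ : ℝ} (hδ : 0 < δ) :
    Tendsto (smoothRoundDown ε δ) atTop atTop :=
  tendsto_atTop_mono (roundDown_le_smoothRoundDown hε hδ) (tendsto_roundDown_atTop hε)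

/-- Averaging to the right of `y` is essential, since rounding down is only right-continuous. -/
theorem tendsto_smoothRoundDown (hε : 0 < ε) {δ : ℕ → ℝ} (hδ : ∀ n, 0 < δ n)
    (hδ0 : Tendsto δ atTop (𝓝 0)) (y : ℝ) :
    Tendsto (fun n => smoothRoundDown ε (δ n) y) atTop (𝓝 (roundDown ε y)) := by
  refine tendsto_of_tendsto_of_tendsto_of_le_of_le tendsto_const_nhds ?_
    (fun n => roundDown_le_smoothRoundDown hε (hδ n) y) (fun n => smoothRoundDown_le hε (hδ n) y)
  refine (continuousWithinAt_roundDown hε y).tendsto.comp (tendsto_nhdsWithin_iff.2 ⟨?_, ?_⟩)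
  · simpa using hδ0.const_add y
  · exact Eventually.of_forall fun n => by simpa using (hδ n).le

/-- The Laplace exponent of the lattice process. -/
noncomputable def latticeExponent (ν : Measure ℝ) (ε u : ℝ) : ℝ :=
  ∫ z, (1 - Real.exp (-(u * roundDown ε z))) ∂ν

variable {Ω : Type u} [mΩ : MeasurableSpace Ω] {P : Measure Ω}
  {ν : Measure ℝ} {X : ℝ≥0 → Ω → ℝ}

/-- Jumps are nonnegative, so the integer floor and the natural floor agree on them. -/
theorem IsRegularSubordinator.discretised_eq_jumpSum (hX : IsRegularSubordinator P ν X)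
    (hε : 0 < ε) (t : ℝ≥0) (ω : Ω) :
    discretised X ε t ω = jumpSum X (roundDown ε) (Iic t) ω := by
  unfold discretised jumpSum roundDown
  refine tsum_congr fun r => ?_
  rw [natCast_floor_eq_intCast_floor (div_nonneg (hX.jump_nonneg _ _) hε.le)]

theorem IsRegularSubordinator.discretised_add_sub (hX : IsRegularSubordinator P ν X)
    (hε : 0 < ε) {s t : ℝ≥0} (hst : s ≤ t) (ω : Ω) :
    discretised X ε t ω - discretised X ε s ω = jumpSum X (roundDown ε) (Ioc s t) ω := by
  classical
  have hz := (isJumpWeight_roundDown hε).zero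
  have h1 := hX.finite_jumps ω hε s
  have h2 := hX.finite_jumps_Ioc ω hε s t
  rw [hX.discretised_eq_jumpSum hε, hX.discretised_eq_jumpSum hε,
    jumpSum_eq_sum hz (hX.finite_jumps ω hε t), jumpSum_eq_sum hz h1, jumpSum_eq_sum hz h2,
    sub_eq_iff_eq_add, ← Finset.sum_union]
  · refine Finset.sum_congr ?_ fun _ _ => rfl
    ext r
    simp only [Finite.mem_toFinset, Finset.mem_union, mem_ofPred_eq, mem_Iic, mem_Ioc]
    constructor
    · rintro ⟨h, hb⟩
      rcases le_or_gt r s with h' | h'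
      · exact Or.inr ⟨h', hb⟩
      · exact Or.inl ⟨⟨h', h⟩, hb⟩
    · rintro (⟨h, hb⟩ | ⟨h, hb⟩)
      · exact ⟨h.2, hb⟩
      · exact ⟨h.trans hst, hb⟩
  · rw [Finset.disjoint_left]
    intro r hr hr'
    simp only [Finite.mem_toFinset, mem_ofPred_eq, mem_Iic, mem_Ioc] at hr hr'
    exact absurd hr.1.1 (not_lt.2 hr'.1)

theorem IsRegularSubordinator.discretised_zero (hX : IsRegularSubordinator P ν X)
    (hε : 0 < ε) (ω : Ω) : discretised X ε 0 ω = 0 := by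
  rw [hX.discretised_eq_jumpSum hε, jumpSum]
  have : ∀ r : Iic (0 : ℝ≥0), roundDown ε (jump X r ω) = 0 := fun r => by
    have : (r : ℝ≥0) = 0 := le_antisymm r.2 zero_le
    rw [this, jump_zero, roundDown_of_lt hε hε]
  simp [this]

theorem IsRegularSubordinator.discretised_mono (hX : IsRegularSubordinator P ν X)
    (hε : 0 < ε) (ω : Ω) : Monotone fun t => discretised X ε t ω := fun s t hst => by
  rw [← sub_nonneg, hX.discretised_add_sub hε hst]
  exact jumpSum_nonneg (roundDown_nonneg hε) _ _

theorem IsRegularSubordinator.discretised_sub_le (hX : IsRegularSubordinator P ν X)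
    (hε : 0 < ε) {s t : ℝ≥0} (hst : s ≤ t) (ω : Ω) :
    discretised X ε t ω - discretised X ε s ω ≤ X t ω - X s ω := by
  rw [hX.discretised_add_sub hε hst]
  exact hX.jumpSum_le (isJumpWeight_roundDown hε) hst ω

theorem IsRegularSubordinator.discretised_le (hX : IsRegularSubordinator P ν X)
    (hε : 0 < ε) (t : ℝ≥0) (ω : Ω) : discretised X ε t ω ≤ X t ω := by
  have := hX.discretised_sub_le hε (zero_le : 0 ≤ t) ω
  rwa [hX.discretised_zero hε, hX.zero, sub_zero, sub_zero] at this

/-- Increments of the lattice process lie between `0` and those of `X`, whose right-continuity is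
thus inherited. -/
theorem IsRegularSubordinator.discretised_rc (hX : IsRegularSubordinator P ν X)
    (hε : 0 < ε) (ω : Ω) (t : ℝ≥0) :
    ContinuousWithinAt (fun s => discretised X ε s ω) (Ici t) t := by
  have h1 : Tendsto (fun s => discretised X ε t ω + (X s ω - X t ω)) (𝓝[≥] t)
      (𝓝 (discretised X ε t ω)) := by
    have := ((hX.rc ω t).tendsto.sub_const (X t ω)).const_add (discretised X ε t ω)
    simpa using this
  refine tendsto_of_tendsto_of_tendsto_of_le_of_le' tendsto_const_nhds h1 ?_ ?_
  · filter_upwards [self_mem_nhdsWithin] with s hs using hX.discretised_mono hε ω hs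
  · filter_upwards [self_mem_nhdsWithin] with s hs
    linarith [hX.discretised_sub_le hε (mem_Ici.1 hs) ω]

theorem IsRegularSubordinator.measurable_discretised (hX : IsRegularSubordinator P ν X)
    (hε : 0 < ε) (t : ℝ≥0) : Measurable[past X t] (discretised X ε t) := by
  have h1 := hX.measurable_jumpSum (isJumpWeight_roundDown hε) 0 t
  rw [zero_add] at h1
  have h2 : discretised X ε t = jumpSum X (roundDown ε) (Ioc 0 t) := by
    funext ω
    rw [← hX.discretised_add_sub hε zero_le, hX.discretised_zero hε, sub_zero]
  rwa [h2]

theorem tendsto_floor_mul_add_one_div (t : ℝ≥0) :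
    Tendsto (fun n : ℕ => ((⌊((n : ℝ≥0) + 1) * t⌋₊ : ℝ≥0) + 1) / ((n : ℝ≥0) + 1)) atTop
      (𝓝[≥] t) := by
  have hlow : ∀ n : ℕ, t ≤ ((⌊((n : ℝ≥0) + 1) * t⌋₊ : ℝ≥0) + 1) / ((n : ℝ≥0) + 1) := by
    intro n
    rw [le_div_iff₀ (by positivity), mul_comm]
    exact (Nat.lt_floor_add_one _).le
  refine tendsto_nhdsWithin_iff.2 ⟨?_, Eventually.of_forall hlow⟩
  have h2 : Tendsto (fun n : ℕ => t + 1 / ((n : ℝ≥0) + 1)) atTop (𝓝 t) := by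
    have : Tendsto (fun n : ℕ => 1 / ((n : ℝ≥0) + 1)) atTop (𝓝 0) :=
      NNReal.tendsto_coe.1 (by simpa using tendsto_one_div_add_atTop_nhds_zero_nat (𝕜 := ℝ))
    simpa using this.const_add t
  refine tendsto_of_tendsto_of_tendsto_of_le_of_le tendsto_const_nhds h2 hlow fun n => ?_
  have h3 : (⌊((n : ℝ≥0) + 1) * t⌋₊ : ℝ≥0) ≤ (n + 1) * t := Nat.floor_le zero_le
  have hn : ((n : ℝ≥0) + 1) ≠ 0 := by positivity
  change _ / _ ≤ t + 1 / ((n : ℝ≥0) + 1)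
  rw [div_le_iff₀ (by positivity), add_mul t, div_mul_cancel₀ _ hn, mul_comm t]
  exact add_le_add_left h3 1

/-- The process is the limit of its values at grid times approaching `t` from the right, and each
approximation takes its time from a countable set. -/
theorem measurable_uncurry_of_rightContinuous {Y : ℝ≥0 → Ω → ℝ} (hm : ∀ t, Measurable (Y t))
    (hrc : ∀ ω t, ContinuousWithinAt (fun s => Y s ω) (Ici t) t) :
    Measurable (Function.uncurry Y) := by
  set F : ℕ → ℝ≥0 × Ω → ℝ := fun n p =>
    Y (((⌊((n : ℝ≥0) + 1) * p.1⌋₊ : ℝ≥0) + 1) / ((n : ℝ≥0) + 1)) p.2 with hF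
  have hcomp : ∀ (d : ℕ → ℝ≥0) (k : ℝ≥0 → ℕ), Measurable k →
      Measurable fun p : ℝ≥0 × Ω => Y (d (k p.1)) p.2 := by
    intro d k hk
    have ha : Measurable fun q : ℕ × Ω => Y (d q.1) q.2 :=
      measurable_from_prod_countable_right fun i => hm (d i)
    exact ha.comp ((hk.comp measurable_fst).prodMk measurable_snd)
  have h1 : ∀ n : ℕ, Measurable (F n) := fun n =>
    hcomp (fun i => ((i : ℝ≥0) + 1) / ((n : ℝ≥0) + 1)) (fun t => ⌊((n : ℝ≥0) + 1) * t⌋₊)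
      (Nat.measurable_floor.comp (measurable_id.const_mul _))
  refine measurable_of_tendsto_metrizable h1 (tendsto_pi_nhds.2 fun p => ?_)
  exact (hrc p.2 p.1).tendsto.comp (tendsto_floor_mul_add_one_div p.1)

variable [IsProbabilityMeasure P]

/-- The identity for continuous weights is applied to `smoothRoundDown` and `δ → 0`. All these
weights vanish below `ε / 2`, so only the finite measure `ν` on `[ε/2, ∞)` and finitely many jumps
of each path matter. -/
theorem IsRegularSubordinator.lintegral_mul_exp_jumpSum_roundDown
    (hν : IsSubordinatorLevyMeasure ν) (hX : IsRegularSubordinator P ν X) (hε : 0 < ε) {u : ℝ}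
    (hu : 0 < u) (s t : ℝ≥0) {V : Ω → ℝ≥0∞} (hV : Measurable[past X s] V) (hV1 : ∀ ω, V ω ≤ 1) :
    ∫⁻ ω, V ω *
        ENNReal.ofReal (Real.exp (-(u * jumpSum X (roundDown ε) (Ioc s (s + t)) ω))) ∂P =
      ENNReal.ofReal (Real.exp (-(t * latticeExponent ν ε u))) * ∫⁻ ω, V ω ∂P := by
  set δ : ℕ → ℝ := fun n => ε / 2 * (1 / ((n : ℝ) + 1)) with hδ
  have hδpos : ∀ n, 0 < δ n := fun n => by positivity
  have hδle : ∀ n, δ n ≤ ε / 2 := fun n => by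
    refine mul_le_of_le_one_right (by positivity) ?_
    rw [div_le_one (by positivity)]
    linarith [(Nat.cast_nonneg n : (0 : ℝ) ≤ n)]
  have hδ0 : Tendsto δ atTop (𝓝 0) := by
    rw [hδ, ← mul_zero (ε / 2)]
    exact tendsto_one_div_add_atTop_nhds_zero_nat.const_mul (ε / 2)
  have hw := fun n => isJumpWeight_smoothRoundDown hε (hδpos n) (hδle n)
  have hVm : Measurable V := hV.mono (past_le hX.measurable s) le_rfl
  have hVfin : ∫⁻ ω, V ω ∂P ≠ ∞ := by
    refine ne_top_of_le_ne_top (b := 1) ENNReal.one_ne_top ?_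
    calc _ ≤ ∫⁻ _, (1 : ℝ≥0∞) ∂P := lintegral_mono hV1
      _ = 1 := by simp
  have hseq := fun n => hX.lintegral_mul_exp_jumpSum_of_continuous hν (hw n)
    (continuous_smoothRoundDown hε (δ n)) (tendsto_smoothRoundDown_atTop hε (hδpos n)) hu s t hV hV1
  have hR : Tendsto (fun n => ENNReal.ofReal (Real.exp (-(t *
      ∫ z, (1 - Real.exp (-(u * smoothRoundDown ε (δ n) z))) ∂ν))) * ∫⁻ ω, V ω ∂P) atTop
      (𝓝 (ENNReal.ofReal (Real.exp (-(t * latticeExponent ν ε u))) * ∫⁻ ω, V ω ∂P)) := by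
    refine ENNReal.Tendsto.mul_const (ENNReal.tendsto_ofReal
      ((Real.continuous_exp.tendsto _).comp (Tendsto.neg (Tendsto.const_mul _ ?_)))) (Or.inr hVfin)
    have hfin : ν (Ici (ε / 2)) ≠ ∞ := (hν.measure_Ici_lt_top (by linarith)).ne
    refine tendsto_integral_of_dominated_convergence ((Ici (ε / 2)).indicator fun _ => (1 : ℝ))
      (fun n => ?_) ?_ (fun n => ae_of_all _ fun z => ?_) (ae_of_all _ fun z => ?_)
    · have := (hw n).measurable
      exact Measurable.aestronglyMeasurable (by fun_prop)
    · exact (integrable_indicator_iff measurableSet_Ici).2 (integrableOn_const hfin)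
    · rcases lt_or_ge z (ε / 2) with h | h
      · simp [(hw n).zero z h, h]
      · rw [indicator_of_mem (mem_Ici.2 h)]
        have h1 : 0 ≤ u * smoothRoundDown ε (δ n) z := mul_nonneg hu.le ((hw n).nonneg z)
        have h2 : Real.exp (-(u * smoothRoundDown ε (δ n) z)) ≤ 1 := by simpa using h1
        rw [Real.norm_of_nonneg (by linarith)]
        linarith [Real.exp_pos (-(u * smoothRoundDown ε (δ n) z))]
    · exact ((Real.continuous_exp.tendsto _).comp
        ((tendsto_smoothRoundDown hε hδpos hδ0 z).const_mul u).neg).const_sub 1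
  refine tendsto_nhds_unique ?_ hR
  simp only [← hseq]
  refine tendsto_lintegral_of_dominated_convergence (fun _ => 1) (fun n => ?_) (fun n => ?_)
    (by simp) (ae_of_all _ fun ω => ?_)
  · have h1 : Measurable (jumpSum X (smoothRoundDown ε (δ n)) (Ioc s (s + t))) :=
      (hX.measurable_jumpSum (hw n) s t).mono (past_le hX.measurable _) le_rfl
    fun_prop
  · refine ae_of_all _ fun ω => mul_le_one' (hV1 ω) ?_
    rw [ENNReal.ofReal_le_one, Real.exp_le_one_iff, neg_nonpos]
    exact mul_nonneg hu.le (jumpSum_nonneg (hw n).nonneg _ _)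
  · refine ENNReal.Tendsto.const_mul (ENNReal.tendsto_ofReal ?_)
      (Or.inr (ne_top_of_le_ne_top ENNReal.one_ne_top (hV1 ω)))
    refine (Real.continuous_exp.tendsto _).comp (Tendsto.neg (Tendsto.const_mul u ?_))
    have hfin := hX.finite_jumps_Ioc ω (b := ε / 2) (by linarith) s (s + t)
    rw [jumpSum_eq_sum (fun y hy => roundDown_of_lt hε (by linarith)) hfin]
    have : ∀ n, jumpSum X (smoothRoundDown ε (δ n)) (Ioc s (s + t)) ω =
      ∑ r ∈ hfin.toFinset, smoothRoundDown ε (δ n) (jump X r ω) := fun n =>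
        jumpSum_eq_sum (hw n).zero hfin
    simp only [this]
    exact tendsto_finsetSum _ fun r _ => tendsto_smoothRoundDown hε hδpos hδ0 _

/-- This makes the moment formula available for the lattice process. The filtration is that of `X`
itself, to which the sums over jumps are adapted. -/
theorem IsRegularSubordinator.hasLaplaceIncrements_discretised
    (hν : IsSubordinatorLevyMeasure ν) (hX : IsRegularSubordinator P ν X) (hε : 0 < ε) :
    HasLaplaceIncrements P (past X) (discretised X ε) (latticeExponent ν ε) where
  le := past_le hX.measurable
  mono := past_mono
  adapted := hX.measurable_discretised hε
  jointly := measurable_uncurry_of_rightContinuous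
    (fun t => (hX.measurable_discretised hε t).mono (past_le hX.measurable t) le_rfl)
    (hX.discretised_rc hε)
  zero := hX.discretised_zero hε
  nonneg t ω := by
    rw [← hX.discretised_zero hε ω]
    exact hX.discretised_mono hε ω zero_le
  laplace s t V hV hV1 u hu := by
    simp only [hX.discretised_add_sub hε (le_self_add : s ≤ s + t)]
    exact hX.lintegral_mul_exp_jumpSum_roundDown hν hε hu s t hV hV1

theorem IsRegularSubordinator.hasLaplaceIncrements (hX : IsRegularSubordinator P ν X) :
    HasLaplaceIncrements P (past X) X (laplaceExponent ν) where
  le := past_le hX.measurable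
  mono := past_mono
  adapted t := measurable_past le_rfl
  jointly := measurable_uncurry_of_rightContinuous hX.measurable hX.rc
  zero := hX.zero
  nonneg := hX.nonneg
  laplace s t V hV hV1 u hu := by
    have h1 := lintegral_past_mul hX (t := t) hV
      (g := fun y => ENNReal.ofReal (Real.exp (-(u * y)))) (by fun_prop)
    rw [h1, mul_comm, ← hX.laplace t u hu.le,
      ofReal_integral_eq_lintegral_ofReal (hX.integrable_exp t hu.le)
        (ae_of_all _ fun ω => (Real.exp_pos _).le)]

end Lattice

/-! ### The coefficients and their generating function -/

section Coefficients

variable {ν : Measure ℝ} {ε : ℝ}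

theorem iUnion_Ico_lattice (hε : 0 < ε) :
    ⋃ k : ℕ, Ico (ε * ((k + 1 : ℕ) : ℝ)) (ε * ((k + 1 : ℕ) + 1)) = Ici ε := by
  ext z
  simp only [mem_iUnion, mem_Ico, mem_Ici]
  constructor
  · rintro ⟨k, hk, -⟩
    refine le_trans ?_ hk
    push_cast
    nlinarith [(Nat.cast_nonneg k : (0 : ℝ) ≤ k)]
  · intro hz
    have h1 : 1 ≤ z / ε := (one_le_div hε).2 hz
    have h2 : 1 ≤ ⌊z / ε⌋₊ := Nat.le_floor (by simpa using h1)
    refine ⟨⌊z / ε⌋₊ - 1, ?_, ?_⟩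
    · rw [Nat.sub_add_cancel h2, ← le_div_iff₀' hε]
      exact Nat.floor_le (by linarith)
    · rw [Nat.sub_add_cancel h2, ← div_lt_iff₀' hε]
      exact Nat.lt_floor_add_one _

theorem pairwise_disjoint_lattice (hε : 0 < ε) :
    Pairwise (Function.onFun Disjoint fun k : ℕ =>
      Ico (ε * ((k + 1 : ℕ) : ℝ)) (ε * ((k + 1 : ℕ) + 1))) := by
  have h : Monotone fun k : ℕ => ε * ((k + 1 : ℕ) : ℝ) := fun a b hab => by
    dsimp only
    gcongr
  have h1 := h.pairwise_disjoint_on_Ico_succ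
  intro i j hij
  have := h1 hij
  simpa [Function.onFun] using this

theorem hasSum_latticeMass (hν : IsSubordinatorLevyMeasure ν) (hε : 0 < ε) :
    HasSum (fun k : ℕ => latticeMass ν ε (k + 1)) (ν.real (Ici ε)) := by
  have hfin := (hν.measure_Ici_lt_top hε).ne
  have h1 := measure_iUnion (μ := ν) (pairwise_disjoint_lattice hε) fun k => measurableSet_Ico
  rw [iUnion_Ico_lattice hε] at h1
  unfold latticeMass Measure.real
  rw [h1] at hfin ⊢
  rw [ENNReal.tsum_toReal_eq fun k => ENNReal.ne_top_of_tsum_ne_top hfin k]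
  exact ENNReal.hasSum_toReal hfin

theorem totalMass_eq (hν : IsSubordinatorLevyMeasure ν) (hε : 0 < ε) :
    totalMass ν ε = ν.real (Ici ε) :=
  (hasSum_latticeMass hν hε).tsum_eq

theorem totalMass_pos (hν : IsSubordinatorLevyMeasure ν) (hε : 0 < ε) (h : ν (Ici ε) ≠ 0) :
    0 < totalMass ν ε := by
  rw [totalMass_eq hν hε]
  exact ENNReal.toReal_pos h (hν.measure_Ici_lt_top hε).ne

theorem latticeMass_nonneg (k : ℕ) : 0 ≤ latticeMass ν ε k := measureReal_nonneg

theorem roundDown_of_mem_Ico (hε : 0 < ε) {k : ℕ} {z : ℝ} (hz : z ∈ Ico (ε * k) (ε * (k + 1))) :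
    roundDown ε z = ε * k := by
  unfold roundDown
  congr 2
  have hz0 : 0 ≤ z := le_trans (by positivity) hz.1
  rw [Nat.floor_eq_iff (div_nonneg hz0 hε.le), le_div_iff₀' hε, div_lt_iff₀' hε]
  exact hz

theorem integrable_lattice (hν : IsSubordinatorLevyMeasure ν) (hε : 0 < ε) {u : ℝ} (hu : 0 ≤ u) :
    Integrable (fun z => 1 - Real.exp (-(u * roundDown ε z))) ν := by
  have hfin : ν (Ici ε) ≠ ∞ := (hν.measure_Ici_lt_top hε).ne
  have hm := (roundDown_mono hε).measurable
  refine Integrable.mono' (g := (Ici ε).indicator fun _ => (1 : ℝ))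
    ((integrable_indicator_iff measurableSet_Ici).2 (integrableOn_const hfin))
    (Measurable.aestronglyMeasurable (by fun_prop)) (ae_of_all _ fun z => ?_)
  rcases lt_or_ge z ε with h | h
  · simp [roundDown_of_lt hε h, h]
  · rw [indicator_of_mem (mem_Ici.2 h)]
    have h1 : 0 ≤ u * roundDown ε z := mul_nonneg hu (roundDown_nonneg hε z)
    have h2 : Real.exp (-(u * roundDown ε z)) ≤ 1 := by simpa using h1
    rw [Real.norm_of_nonneg (by linarith)]
    linarith [Real.exp_pos (-(u * roundDown ε z))]

/-- Rounding is constant on each cell, so the integral over a cell is a lattice mass times a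
constant; the cells partition `[ε, ∞)`, and `[0, ε)` contributes nothing. -/
theorem hasSum_latticeExponent (hν : IsSubordinatorLevyMeasure ν) (hε : 0 < ε) {u : ℝ}
    (hu : 0 ≤ u) :
    HasSum (fun k : ℕ => latticeMass ν ε (k + 1) * Real.exp (-(u * (ε * (k + 1 : ℕ)))))
      (totalMass ν ε - latticeExponent ν ε u) := by
  have hint := integrable_lattice hν hε hu
  have h1 : latticeExponent ν ε u = ∫ z in Ici ε, (1 - Real.exp (-(u * roundDown ε z))) ∂ν := by
    refine (setIntegral_eq_integral_of_forall_compl_eq_zero fun z hz => ?_).symm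
    have : z < ε := not_le.1 hz
    simp [roundDown_of_lt hε this]
  have h2 := hasSum_integral_iUnion (μ := ν)
    (f := fun z => 1 - Real.exp (-(u * roundDown ε z))) (fun k => measurableSet_Ico)
    (pairwise_disjoint_lattice hε) hint.integrableOn
  rw [iUnion_Ico_lattice hε, ← h1] at h2
  have h3 := (hasSum_latticeMass hν hε).sub h2
  rw [← totalMass_eq hν hε] at h3
  have h4 : (fun k : ℕ => latticeMass ν ε (k + 1) -
      ∫ z in Ico (ε * ((k + 1 : ℕ) : ℝ)) (ε * ((k + 1 : ℕ) + 1)),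
        (1 - Real.exp (-(u * roundDown ε z))) ∂ν) =
      fun k : ℕ => latticeMass ν ε (k + 1) * Real.exp (-(u * (ε * (k + 1 : ℕ)))) := by
    funext k
    rw [setIntegral_congr_fun (g := fun _ => 1 - Real.exp (-(u * (ε * (k + 1 : ℕ)))))
      measurableSet_Ico fun z hz => by rw [roundDown_of_mem_Ico hε hz], setIntegral_const,
      smul_eq_mul]
    unfold latticeMass
    ring
  rwa [h4] at h3

/-- Every rounded jump in the series is at least `ε`, so `Λ - ψ_ε(u) ≤ Λ e^{-uε} < Λ`. -/
theorem latticeExponent_pos (hν : IsSubordinatorLevyMeasure ν) (hε : 0 < ε) (h : ν (Ici ε) ≠ 0)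
    {u : ℝ} (hu : 0 < u) : 0 < latticeExponent ν ε u := by
  have h1 := hasSum_latticeExponent hν hε hu.le
  have h2 : ∀ k : ℕ, latticeMass ν ε (k + 1) * Real.exp (-(u * (ε * (k + 1 : ℕ)))) ≤
      latticeMass ν ε (k + 1) * Real.exp (-(u * ε)) := fun k => by
    refine mul_le_mul_of_nonneg_left (Real.exp_le_exp.2 (neg_le_neg ?_)) (latticeMass_nonneg _)
    refine mul_le_mul_of_nonneg_left (le_mul_of_one_le_right hε.le ?_) hu.le
    exact_mod_cast Nat.succ_le_succ (Nat.zero_le k)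
  have h3 := hasSum_le h2 h1 ((hasSum_latticeMass hν hε).mul_right _)
  rw [← totalMass_eq hν hε] at h3
  have h4 := totalMass_pos hν hε h
  have h5 : Real.exp (-(u * ε)) < 1 := by
    have : 0 < u * ε := by positivity
    simpa using this
  nlinarith

theorem coeff_succ_mul (hε : 0 < ε) (hΛ : totalMass ν ε ≠ 0) (n : ℕ) :
    (1 - Real.exp (ε * (n + 1 : ℕ))) * totalMass ν ε * coeff ν ε (n + 1) =
      ∑ i ∈ Finset.range (n + 1),
        Real.exp (ε * (i + 1 : ℕ)) * coeff ν ε (n - i) * latticeMass ν ε (i + 1) := by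
  have h1 : (1 - Real.exp (ε * (n + 1 : ℕ))) ≠ 0 := by
    have : 0 < ε * ((n + 1 : ℕ) : ℝ) := by positivity
    have := Real.one_lt_exp_iff.2 this
    linarith
  rw [coeff, ← mul_assoc, mul_one_div, div_self (mul_ne_zero h1 hΛ), one_mul,
    Fin.sum_univ_eq_sum_range (fun i => Real.exp (ε * ((i + 1 : ℕ) : ℝ)) * coeff ν ε (n - i) *
      latticeMass ν ε (i + 1)) (n + 1)]

/-- The recurrence multiplied by `e^{-ε (n + 1) (u + 1)}`. -/
theorem coeff_succ_mul_exp (hε : 0 < ε) (hΛ : totalMass ν ε ≠ 0) (u : ℝ) (n : ℕ) :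
    totalMass ν ε * (coeff ν ε (n + 1) * Real.exp (-((u + 1) * (ε * (n + 1 : ℕ)))) -
        coeff ν ε (n + 1) * Real.exp (-(u * (ε * (n + 1 : ℕ))))) =
      ∑ i ∈ Finset.range (n + 1),
        (latticeMass ν ε (i + 1) * Real.exp (-(u * (ε * (i + 1 : ℕ))))) *
          (coeff ν ε (n - i) * Real.exp (-((u + 1) * (ε * (n - i : ℕ))))) := by
  have h1 := congrArg (· * Real.exp (-((u + 1) * (ε * (n + 1 : ℕ))))) (coeff_succ_mul hε hΛ n)
  simp only [Finset.sum_mul] at h1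
  have h2 : Real.exp (-(u * (ε * (n + 1 : ℕ)))) =
      Real.exp (ε * (n + 1 : ℕ)) * Real.exp (-((u + 1) * (ε * (n + 1 : ℕ)))) := by
    rw [← Real.exp_add]; ring_nf
  calc _ = (1 - Real.exp (ε * (n + 1 : ℕ))) * totalMass ν ε * coeff ν ε (n + 1) *
        Real.exp (-((u + 1) * (ε * (n + 1 : ℕ)))) := by rw [h2]; ring
    _ = _ := h1
    _ = _ := by
        refine Finset.sum_congr rfl fun i hi => ?_
        have hi' : i ≤ n := Nat.lt_succ_iff.1 (Finset.mem_range.1 hi)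
        have h3 : Real.exp (ε * (i + 1 : ℕ)) * Real.exp (-((u + 1) * (ε * (n + 1 : ℕ)))) =
            Real.exp (-(u * (ε * (i + 1 : ℕ)))) * Real.exp (-((u + 1) * (ε * (n - i : ℕ)))) := by
          rw [← Real.exp_add, ← Real.exp_add, Nat.cast_sub hi']
          push_cast
          ring_nf
        linear_combination coeff ν ε (n - i) * latticeMass ν ε (i + 1) * h3

theorem sum_latticeMass_le (hν : IsSubordinatorLevyMeasure ν) (hε : 0 < ε) (n : ℕ) :
    ∑ i ∈ Finset.range n, latticeMass ν ε (i + 1) ≤ totalMass ν ε :=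
  (hasSum_latticeMass hν hε).summable.sum_le_tsum _ fun _ _ => latticeMass_nonneg _

/-- The coefficients are absolutely summable. -/
theorem summable_abs_coeff (hν : IsSubordinatorLevyMeasure ν) (hε : 0 < ε) (h : ν (Ici ε) ≠ 0) :
    Summable fun j => |coeff ν ε j| := by
  have hΛ := totalMass_pos hν hε h
  set Λ := totalMass ν ε with hΛdef
  set w : ℕ → ℝ := fun j => |coeff ν ε j| * Real.exp (-(ε * j)) with hw
  have hw0 : ∀ j, 0 ≤ w j := fun j => by positivity
  have hcw : ∀ j, |coeff ν ε j| = Real.exp (ε * j) * w j := fun j => by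
    simp only [hw]
    rw [mul_comm, mul_assoc, ← Real.exp_add]
    simp
  -- Absolute values in the recurrence at `u = 0`.
  have hstep : ∀ n, (Real.exp (ε * (n + 1 : ℕ)) - 1) * Λ * w (n + 1) ≤
      ∑ i ∈ Finset.range (n + 1), latticeMass ν ε (i + 1) * w (n - i) := by
    intro n
    have h1 := coeff_succ_mul_exp hε hΛ.ne' 0 n
    have h2 := congrArg abs h1
    have h3 : |totalMass ν ε * (coeff ν ε (n + 1) * Real.exp (-((0 + 1) * (ε * (n + 1 : ℕ)))) -
        coeff ν ε (n + 1) * Real.exp (-(0 * (ε * (n + 1 : ℕ)))))| =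
        (Real.exp (ε * (n + 1 : ℕ)) - 1) * Λ * w (n + 1) := by
      have h4 : totalMass ν ε * (coeff ν ε (n + 1) * Real.exp (-((0 + 1) * (ε * (n + 1 : ℕ)))) -
          coeff ν ε (n + 1) * Real.exp (-(0 * (ε * (n + 1 : ℕ))))) =
          -(Λ * coeff ν ε (n + 1) *
            ((Real.exp (ε * (n + 1 : ℕ)) - 1) * Real.exp (-(ε * (n + 1 : ℕ))))) := by
        have : Real.exp (ε * (n + 1 : ℕ)) * Real.exp (-(ε * (n + 1 : ℕ))) = 1 := by
          rw [← Real.exp_add]; simp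
        simp only [zero_add, one_mul, zero_mul, neg_zero, Real.exp_zero, mul_one]
        linear_combination (Λ * coeff ν ε (n + 1)) * this
      have h5 : 0 ≤ Real.exp (ε * (n + 1 : ℕ)) - 1 := by
        have : 0 ≤ ε * ((n + 1 : ℕ) : ℝ) := by positivity
        linarith [Real.one_le_exp this]
      rw [h4, abs_neg, abs_mul, abs_mul, abs_of_pos hΛ,
        abs_of_nonneg (mul_nonneg h5 (Real.exp_pos _).le)]
      simp only [hw]
      ring
    rw [h3] at h2
    rw [h2]
    refine (Finset.abs_sum_le_sum_abs _ _).trans (Finset.sum_le_sum fun i _ => le_of_eq ?_)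
    rw [abs_mul, abs_mul, abs_mul, abs_of_nonneg (latticeMass_nonneg _), Real.abs_exp,
      Real.abs_exp]
    simp [hw]
  -- Summation over `n`: the convolution on the right contributes at most `Λ ∑ w_j`, and `Λ`
  -- cancels.
  have hsum : ∀ n, ∑ j ∈ Finset.range n, (Real.exp (ε * (j + 1 : ℕ)) - 1) * w (j + 1) ≤
      ∑ j ∈ Finset.range n, w j := by
    intro n
    have h1 : Λ * ∑ j ∈ Finset.range n, (Real.exp (ε * (j + 1 : ℕ)) - 1) * w (j + 1) ≤
        ∑ j ∈ Finset.range n, ∑ i ∈ Finset.range (j + 1),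
          latticeMass ν ε (i + 1) * w (j - i) := by
      rw [Finset.mul_sum]
      refine Finset.sum_le_sum fun j _ => le_trans (le_of_eq ?_) (hstep j)
      ring
    have h2 : ∑ j ∈ Finset.range n, ∑ i ∈ Finset.range (j + 1),
          latticeMass ν ε (i + 1) * w (j - i) ≤ Λ * ∑ j ∈ Finset.range n, w j := by
      have : ∑ j ∈ Finset.range n, ∑ i ∈ Finset.range (j + 1),
          latticeMass ν ε (i + 1) * w (j - i) =
          ∑ i ∈ Finset.range n, ∑ j ∈ Finset.range (n - i), latticeMass ν ε (i + 1) * w j := by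
        rw [Finset.sum_sigma', Finset.sum_sigma']
        refine Finset.sum_bij' (fun p _ => ⟨p.2, p.1 - p.2⟩) (fun p _ => ⟨p.1 + p.2, p.1⟩)
          ?_ ?_ ?_ ?_ ?_
        · rintro ⟨a, b⟩ hp
          simp only [Finset.mem_sigma, Finset.mem_range] at hp ⊢
          omega
        · rintro ⟨a, b⟩ hp
          simp only [Finset.mem_sigma, Finset.mem_range] at hp ⊢
          omega
        · rintro ⟨a, b⟩ hp
          simp only [Finset.mem_sigma, Finset.mem_range] at hp
          have : b + (a - b) = a := by omega
          simp [this]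
        · rintro ⟨a, b⟩ hp
          simp
        · rintro ⟨a, b⟩ hp
          rfl
      rw [this]
      calc _ ≤ ∑ i ∈ Finset.range n, latticeMass ν ε (i + 1) * ∑ j ∈ Finset.range n, w j := by
            refine Finset.sum_le_sum fun i _ => ?_
            rw [← Finset.mul_sum]
            refine mul_le_mul_of_nonneg_left ?_ (latticeMass_nonneg _)
            exact Finset.sum_le_sum_of_subset_of_nonneg
              (Finset.range_mono (Nat.sub_le n i)) fun j _ _ => hw0 j
        _ ≤ _ := by
            rw [← Finset.sum_mul]
            exact mul_le_mul_of_nonneg_right (sum_latticeMass_le hν hε n)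
              (Finset.sum_nonneg fun j _ => hw0 j)
    exact le_of_mul_le_mul_left (h1.trans h2) hΛ
  -- The inequality so far reads `∑ (e^{εj} - 2) w_j ≤ 0`. Once `e^{εj} ≥ 4` one has `e^{εj} ≤ 2
  -- (e^{εj} - 2)`, so the tail of `∑ |c_j|` is controlled by finitely many terms.
  obtain ⟨J, hJ⟩ : ∃ J : ℕ, ∀ j ≥ J, 4 ≤ Real.exp (ε * j) := by
    have : Tendsto (fun j : ℕ => Real.exp (ε * j)) atTop atTop :=
      Real.tendsto_exp_atTop.comp (tendsto_natCast_atTop_atTop.const_mul_atTop hε)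
    exact eventually_atTop.1 (this.eventually_ge_atTop 4)
  refine summable_of_sum_range_le (c := 4 * ∑ j ∈ Finset.range J, w j)
    (fun j => abs_nonneg _) fun n => ?_
  have h1 : ∑ j ∈ Finset.range n, (Real.exp (ε * j) - 2) * w j ≤ 0 := by
    rcases n with _ | n
    · simp
    · have h2 := hsum n
      have h3 : ∑ j ∈ Finset.range (n + 1), (Real.exp (ε * j) - 1) * w j ≤
          ∑ j ∈ Finset.range (n + 1), w j := by
        rw [Finset.sum_range_succ' (fun j : ℕ => (Real.exp (ε * j) - 1) * w j)]
        refine le_trans ?_ (h2.trans (Finset.sum_le_sum_of_subset_of_nonneg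
          (Finset.range_mono (Nat.le_succ n)) fun j _ _ => hw0 j))
        simp
      have h4 : ∑ j ∈ Finset.range (n + 1), (Real.exp (ε * j) - 2) * w j =
          ∑ j ∈ Finset.range (n + 1), (Real.exp (ε * j) - 1) * w j -
            ∑ j ∈ Finset.range (n + 1), w j := by
        rw [← Finset.sum_sub_distrib]
        exact Finset.sum_congr rfl fun j _ => by ring
      linarith
  have h2 : ∀ j, |coeff ν ε j| ≤ 2 * ((Real.exp (ε * j) - 2) * w j) +
      (if j < J then 4 * w j else 0) := by
    intro j
    rw [hcw j]
    split_ifs with hj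
    · nlinarith [hw0 j, Real.exp_pos (ε * j)]
    · have := hJ j (not_lt.1 hj)
      nlinarith [hw0 j]
  calc ∑ j ∈ Finset.range n, |coeff ν ε j| ≤ ∑ j ∈ Finset.range n,
        (2 * ((Real.exp (ε * j) - 2) * w j) + (if j < J then 4 * w j else 0)) :=
        Finset.sum_le_sum fun j _ => h2 j
    _ ≤ 0 + ∑ j ∈ Finset.range n, (if j < J then 4 * w j else 0) := by
        rw [Finset.sum_add_distrib, ← Finset.mul_sum]
        linarith
    _ ≤ 4 * ∑ j ∈ Finset.range J, w j := by
        rw [zero_add, ← Finset.sum_filter, Finset.mul_sum]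
        refine Finset.sum_le_sum_of_subset_of_nonneg (fun j hj => ?_)
          fun j _ _ => mul_nonneg (by norm_num) (hw0 j)
        exact Finset.mem_range.2 (Finset.mem_filter.1 hj).2

theorem summable_coeff_mul_exp (hν : IsSubordinatorLevyMeasure ν) (hε : 0 < ε)
    (h : ν (Ici ε) ≠ 0) {u : ℝ} (hu : 0 ≤ u) :
    Summable fun j : ℕ => ‖coeff ν ε j * Real.exp (-(u * (ε * j)))‖ := by
  refine Summable.of_nonneg_of_le (fun _ => norm_nonneg _) (fun j => ?_)
    (summable_abs_coeff hν hε h)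
  rw [norm_mul, Real.norm_eq_abs]
  refine mul_le_of_le_one_right (abs_nonneg _) ?_
  rw [Real.norm_of_nonneg (Real.exp_pos _).le]
  have : 0 ≤ u * (ε * j) := by positivity
  simpa using this

/-- The generating function `∑_j c_{ε,j} e^{-ε j u}`. -/
noncomputable def coeffSeries (ν : Measure ℝ) (ε u : ℝ) : ℝ :=
  ∑' j : ℕ, coeff ν ε j * Real.exp (-(u * (ε * j)))

/-- The right side of the recurrence is a Cauchy product. Summed over `n`, it gives `(Λ - ψ_ε(u))
C(u + 1) = Λ (C(u + 1) - C(u))`. -/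
theorem totalMass_mul_coeffSeries (hν : IsSubordinatorLevyMeasure ν) (hε : 0 < ε)
    (h : ν (Ici ε) ≠ 0) {u : ℝ} (hu : 0 ≤ u) :
    totalMass ν ε * coeffSeries ν ε u = coeffSeries ν ε (u + 1) * latticeExponent ν ε u := by
  have hΛ := (totalMass_pos hν hε h).ne'
  have hA := summable_coeff_mul_exp hν hε h (u := u + 1) (by linarith)
  have hA0 := summable_coeff_mul_exp hν hε h hu
  have hB := hasSum_latticeExponent hν hε hu
  have hBn : Summable fun k : ℕ =>
      ‖latticeMass ν ε (k + 1) * Real.exp (-(u * (ε * (k + 1 : ℕ))))‖ := by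
    refine hB.summable.congr fun k => ?_
    rw [Real.norm_of_nonneg (mul_nonneg (latticeMass_nonneg _) (Real.exp_pos _).le)]
  have h1 := tsum_mul_tsum_eq_tsum_sum_range_of_summable_norm hBn hA
  simp only [← coeff_succ_mul_exp hε hΛ] at h1
  rw [hB.tsum_eq, tsum_mul_left] at h1
  have h2 := (hA.of_norm.sub hA0.of_norm).tsum_eq_zero_add
  simp only [coeff_zero, Nat.cast_zero, mul_zero, neg_zero, Real.exp_zero, mul_one, sub_self,
    zero_add] at h2
  rw [← h2, hA.of_norm.tsum_sub hA0.of_norm] at h1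
  change (_ - _) * coeffSeries ν ε (u + 1) = _ * (coeffSeries ν ε (u + 1) - coeffSeries ν ε u) at h1
  linear_combination h1

theorem tendsto_coeffSeries (hν : IsSubordinatorLevyMeasure ν) (hε : 0 < ε)
    (h : ν (Ici ε) ≠ 0) : Tendsto (fun n : ℕ => coeffSeries ν ε (n + 1)) atTop (𝓝 1) := by
  have h1 : (1 : ℝ) = ∑' j : ℕ, if j = 0 then 1 else 0 := by simp
  rw [h1]
  unfold coeffSeries
  refine tendsto_tsum_of_dominated_convergence (summable_abs_coeff hν hε h) (fun j => ?_)
    (Eventually.of_forall fun n j => ?_)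
  · rcases Nat.eq_zero_or_pos j with rfl | hj
    · simp [coeff_zero]
    · rw [if_neg hj.ne']
      have hj' : (0 : ℝ) < ε * j := by positivity
      have h2 : Tendsto (fun n : ℕ => Real.exp (-(((n : ℝ) + 1) * (ε * j)))) atTop (𝓝 0) :=
        Real.tendsto_exp_neg_atTop_nhds_zero.comp ((tendsto_atTop_add_const_right _ _
          tendsto_natCast_atTop_atTop).atTop_mul_const hj')
      simpa using h2.const_mul (coeff ν ε j)
  · rw [norm_mul, Real.norm_eq_abs]
    refine mul_le_of_le_one_right (abs_nonneg _) ?_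
    rw [Real.norm_of_nonneg (Real.exp_pos _).le]
    have : 0 ≤ ((n : ℝ) + 1) * (ε * j) := by positivity
    simpa using this

theorem coeffSeries_add_one (hν : IsSubordinatorLevyMeasure ν) (hε : 0 < ε)
    (h : ν (Ici ε) ≠ 0) (n : ℕ) :
    coeffSeries ν ε (n + 1) = coeffSeries ν ε 1 *
      ∏ k ∈ Finset.range n, (totalMass ν ε / latticeExponent ν ε (k + 1)) := by
  induction n with
  | zero => simp
  | succ n ih =>
    have h1 := totalMass_mul_coeffSeries hν hε h (u := n + 1) (by positivity)
    have h2 := latticeExponent_pos hν hε h (u := n + 1) (by positivity)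
    rw [Finset.prod_range_succ, ← mul_assoc, ← ih]
    push_cast
    field_simp
    linarith

/-- The product formula writes `C(n + 1)` as `C(1)` times a nonnegative factor, and `C(n + 1) → c_0
= 1`. -/
theorem coeffSeries_one_pos (hν : IsSubordinatorLevyMeasure ν) (hε : 0 < ε)
    (h : ν (Ici ε) ≠ 0) : 0 < coeffSeries ν ε 1 := by
  obtain ⟨n, hn⟩ := ((tendsto_coeffSeries hν hε h).eventually (lt_mem_nhds one_pos)).exists
  rw [coeffSeries_add_one hν hε h] at hn
  refine pos_of_mul_pos_left hn (Finset.prod_nonneg fun k _ => ?_)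
  exact div_nonneg (totalMass_pos hν hε h).le
    (latticeExponent_pos hν hε h (by positivity)).le

end Coefficients

/-! ### Determinacy by moments and signed mixtures of exponential laws -/

section Moments

/-- The Laplace transform at a nonnegative argument as a power series of moments. -/
theorem lintegral_exp_mul_eq_tsum {μ : Measure ℝ} (h0 : ∀ᵐ x ∂μ, 0 ≤ x) {t : ℝ} (ht : 0 ≤ t) :
    ∫⁻ x, ENNReal.ofReal (Real.exp (t * x)) ∂μ =
      ∑' n : ℕ, ENNReal.ofReal (t ^ n / n.factorial) * ∫⁻ x, ENNReal.ofReal x ^ n ∂μ := by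
  calc ∫⁻ x, ENNReal.ofReal (Real.exp (t * x)) ∂μ =
      ∫⁻ x, ∑' n : ℕ, ENNReal.ofReal (t ^ n / n.factorial) * ENNReal.ofReal x ^ n ∂μ := by
        refine lintegral_congr_ae (h0.mono fun x hx => ?_)
        have h1 := NormedSpace.expSeries_div_hasSum_exp (t * x)
        rw [← Real.exp_eq_exp_ℝ] at h1
        dsimp only
        rw [← h1.tsum_eq, ENNReal.ofReal_tsum_of_nonneg (fun n => by positivity) h1.summable]
        refine tsum_congr fun n => ?_
        rw [← ENNReal.ofReal_pow hx, ← ENNReal.ofReal_mul (by positivity), mul_pow]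
        ring_nf
    _ = _ := by
        rw [lintegral_tsum fun n => by fun_prop]
        exact tsum_congr fun n => lintegral_const_mul _ (by fun_prop)

theorem integrable_exp_mul_of_le {μ : Measure ℝ} (h0 : ∀ᵐ x ∂μ, 0 ≤ x) {r t : ℝ} (hr : t ≤ r)
    (hfin : ∫⁻ x, ENNReal.ofReal (Real.exp (r * x)) ∂μ ≠ ∞) :
    Integrable (fun x => Real.exp (t * x)) μ := by
  refine ⟨by fun_prop, ?_⟩
  rw [hasFiniteIntegral_iff_ofReal (ae_of_all _ fun x => (Real.exp_pos _).le)]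
  refine lt_of_le_of_lt (lintegral_mono_ae (h0.mono fun x hx => ?_)) (lt_top_iff_ne_top.2 hfin)
  exact ENNReal.ofReal_le_ofReal (Real.exp_le_exp.2 (mul_le_mul_of_nonneg_right hr hx))

/-- Finite measures on the half line with the same moments and a common exponential moment
coincide. -/
theorem ext_of_moments {μ₁ μ₂ : Measure ℝ} [IsFiniteMeasure μ₁] [IsFiniteMeasure μ₂]
    (h₁ : ∀ᵐ x ∂μ₁, 0 ≤ x) (h₂ : ∀ᵐ x ∂μ₂, 0 ≤ x)
    (hm : ∀ n : ℕ, ∫⁻ x, ENNReal.ofReal x ^ n ∂μ₁ = ∫⁻ x, ENNReal.ofReal x ^ n ∂μ₂)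
    {r : ℝ} (hr : 0 < r) (hfin : ∫⁻ x, ENNReal.ofReal (Real.exp (r * x)) ∂μ₂ ≠ ∞) : μ₁ = μ₂ := by
  -- Expanded in moments with values in `[0, ∞]`, the Laplace transforms agree even where infinite.
  -- So the exponential moment assumed for `μ₂` passes to `μ₁`.
  have hL : ∀ t : ℝ, 0 ≤ t → ∫⁻ x, ENNReal.ofReal (Real.exp (t * x)) ∂μ₁ =
      ∫⁻ x, ENNReal.ofReal (Real.exp (t * x)) ∂μ₂ := fun t ht => by
    rw [lintegral_exp_mul_eq_tsum h₁ ht, lintegral_exp_mul_eq_tsum h₂ ht]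
    simp only [hm]
  have hsub : ∀ μ : Measure ℝ, (∀ᵐ x ∂μ, 0 ≤ x) →
      ∫⁻ x, ENNReal.ofReal (Real.exp (r * x)) ∂μ ≠ ∞ →
      AnalyticOnNhd ℂ (complexMGF id μ) {z | z.re ∈ Iio r} := fun μ h0 hf => by
    refine analyticOnNhd_complexMGF.mono fun z (hz : z.re < r) => ?_
    refine interior_mono (fun t (ht : t ∈ Iio r) => ?_) ((isOpen_Iio (a := r)).interior_eq.symm ▸ hz)
    exact integrable_exp_mul_of_le h0 (le_of_lt ht) hf
  have hmgf : ∀ t : ℝ, 0 ≤ t → mgf id μ₁ t = mgf id μ₂ t := fun t ht => by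
    unfold mgf
    simp only [id]
    rw [integral_eq_lintegral_of_nonneg_ae (ae_of_all _ fun x => (Real.exp_pos _).le) (by fun_prop),
      integral_eq_lintegral_of_nonneg_ae (ae_of_all _ fun x => (Real.exp_pos _).le) (by fun_prop),
      hL t ht]
  -- Both transforms are analytic on the half-plane `Re z < r` and agree at real points near `r /
  -- 2`. The identity theorem carries the equality to the imaginary axis, where they are the
  -- characteristic functions.
  have heq : EqOn (complexMGF id μ₁) (complexMGF id μ₂) {z | z.re ∈ Iio r} := by
    refine AnalyticOnNhd.eqOn_of_preconnected_of_frequently_eq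
      (hsub μ₁ h₁ (by rwa [hL r hr.le])) (hsub μ₂ h₂ hfin)
      ((convex_Iio r).linear_preimage Complex.reLm).isPreconnected
      (z₀ := ((r / 2 : ℝ) : ℂ)) (by simp [hr]) ?_
    have h_real : ∃ᶠ x : ℝ in 𝓝[≠] (r / 2), complexMGF id μ₁ x = complexMGF id μ₂ x := by
      refine Eventually.frequently (eventually_nhdsWithin_of_eventually_nhds ?_)
      filter_upwards [lt_mem_nhds (half_pos hr)] with t ht
      rw [complexMGF_ofReal, complexMGF_ofReal, hmgf t ht.le]
    have htend : Tendsto (fun x : ℝ => (x : ℂ)) (𝓝[≠] (r / 2)) (𝓝[≠] ((r / 2 : ℝ) : ℂ)) := by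
      refine tendsto_nhdsWithin_iff.2 ⟨?_, ?_⟩
      · exact (Complex.continuous_ofReal.tendsto _).mono_left nhdsWithin_le_nhds
      · filter_upwards [self_mem_nhdsWithin] with x hx
        simpa only [mem_compl_iff, mem_singleton_iff, Complex.ofReal_inj] using hx
    exact htend.frequently h_real
  refine Measure.ext_of_charFun (funext fun t => ?_)
  rw [← complexMGF_id_mul_I, ← complexMGF_id_mul_I]
  exact heq (by simpa using hr)

theorem expMeasure_ae_nonneg (r : ℝ) : ∀ᵐ x ∂expMeasure r, 0 ≤ x := by
  rw [ae_iff]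
  simp only [not_le]
  change expMeasure r (Iio 0) = 0
  rw [expMeasure, gammaMeasure, withDensity_apply _ measurableSet_Iio]
  exact setLIntegral_eq_zero measurableSet_Iio fun x hx => gammaPDF_of_neg hx

theorem lintegral_pow_expMeasure {r : ℝ} (hr : 0 < r) (n : ℕ) :
    ∫⁻ x, ENNReal.ofReal x ^ n ∂expMeasure r = ENNReal.ofReal (n.factorial / r ^ n) := by
  have h1 := Real.integral_rpow_mul_exp_neg_mul_Ioi (a := n + 1) (by positivity) hr
  rw [Real.Gamma_nat_eq_factorial] at h1
  have hn : (1 / r) ^ ((n : ℝ) + 1) * n.factorial ≠ 0 := by positivity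
  have hint : Integrable (fun t : ℝ => t ^ ((n : ℝ) + 1 - 1) * Real.exp (-(r * t)))
      (volume.restrict (Ioi 0)) := by
    by_contra h
    rw [integral_undef h] at h1
    exact hn h1.symm
  have hpdf : Measurable (exponentialPDF r) :=
    (measurable_exponentialPDFReal r).ennreal_ofReal
  change ∫⁻ x, ENNReal.ofReal x ^ n ∂(volume.withDensity (exponentialPDF r)) = _
  rw [lintegral_withDensity_eq_lintegral_mul _ hpdf (by fun_prop)]
  have h2 : ∫⁻ x, (exponentialPDF r * fun x => ENNReal.ofReal x ^ n) x =
      ∫⁻ x in Ioi (0 : ℝ),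
        ENNReal.ofReal r * ENNReal.ofReal (x ^ ((n : ℝ) + 1 - 1) * Real.exp (-(r * x))) := by
    rw [← lintegral_indicator measurableSet_Ioi]
    refine lintegral_congr_ae ?_
    filter_upwards [Measure.ae_ne volume (0 : ℝ)] with x hx
    rcases lt_or_gt_of_ne hx with h | h
    · simp [exponentialPDF_of_neg h, h.le]
    · rw [indicator_of_mem (mem_Ioi.2 h), Pi.mul_apply, exponentialPDF_of_nonneg h.le,
        ← ENNReal.ofReal_pow h.le, ← ENNReal.ofReal_mul (by positivity),
        ← ENNReal.ofReal_mul hr.le]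
      simp only [add_sub_cancel_right, Real.rpow_natCast]
      ring_nf
  rw [h2, lintegral_const_mul _ (by fun_prop), ← ofReal_integral_eq_lintegral_ofReal hint
    ((ae_restrict_mem measurableSet_Ioi).mono fun x (hx : 0 < x) => by positivity), h1,
    ← ENNReal.ofReal_mul hr.le]
  congr 1
  rw [Real.rpow_add (by positivity), Real.rpow_natCast, Real.rpow_one, one_div, inv_pow]
  field_simp

/-- `ENNReal.ofReal` cuts negative weights to `0`. Thus `expMixture a` and `expMixture (-a)` are the
positive and negative parts of the signed mixture. -/
theorem tsum_ofReal_mul_ofReal {a w : ℕ → ℝ} {W : ℝ} (ha : Summable fun j => |a j|)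
    (hw : ∀ j, 0 ≤ w j) (hW : ∀ j, w j ≤ W) :
    Summable (fun j => max (a j) 0 * w j) ∧
      ∑' j, ENNReal.ofReal (a j) * ENNReal.ofReal (w j) =
        ENNReal.ofReal (∑' j, max (a j) 0 * w j) := by
  have hs : Summable (fun j => max (a j) 0 * w j) := by
    refine Summable.of_nonneg_of_le (fun j => mul_nonneg (le_max_right _ _) (hw j)) (fun j => ?_)
      (ha.mul_right W)
    exact mul_le_mul (max_le (le_abs_self _) (abs_nonneg _)) (hW j) (hw j) (abs_nonneg _)
  refine ⟨hs, ?_⟩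
  rw [ENNReal.ofReal_tsum_of_nonneg (fun j => mul_nonneg (le_max_right _ _) (hw j)) hs]
  refine tsum_congr fun j => ?_
  rw [ENNReal.ofReal_mul (le_max_right _ _), ENNReal.ofReal_max, ENNReal.ofReal_zero,
    max_eq_left zero_le]

theorem tsum_max_sub_tsum_max {a w : ℕ → ℝ} {W : ℝ} (ha : Summable fun j => |a j|)
    (hw : ∀ j, 0 ≤ w j) (hW : ∀ j, w j ≤ W) :
    ∑' j, max (a j) 0 * w j - ∑' j, max (-a j) 0 * w j = ∑' j, a j * w j := by
  rw [← (tsum_ofReal_mul_ofReal ha hw hW).1.tsum_sub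
    (tsum_ofReal_mul_ofReal (a := fun j => -a j) (by simpa using ha) hw hW).1]
  refine tsum_congr fun j => ?_
  rcases le_total (a j) 0 with h | h
  · rw [max_eq_right h, max_eq_left (by linarith)]; ring
  · rw [max_eq_left h, max_eq_right (by linarith)]; ring

/-- A mixture of exponential distributions. -/
noncomputable def expMixture (a ρ : ℕ → ℝ) : Measure ℝ :=
  Measure.sum fun j => ENNReal.ofReal (a j) • expMeasure (ρ j)

theorem expMixture_ae_nonneg (a ρ : ℕ → ℝ) : ∀ᵐ x ∂expMixture a ρ, 0 ≤ x := by
  rw [expMixture, Measure.ae_sum_iff' measurableSet_Ici]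
  exact fun j => Measure.ae_smul_measure (expMeasure_ae_nonneg _) _

theorem lintegral_expMixture (a ρ : ℕ → ℝ) (f : ℝ → ℝ≥0∞) :
    ∫⁻ x, f x ∂expMixture a ρ = ∑' j, ENNReal.ofReal (a j) * ∫⁻ x, f x ∂expMeasure (ρ j) := by
  simp [expMixture, lintegral_sum_measure]

theorem lintegral_pow_expMixture {a ρ : ℕ → ℝ} {r : ℝ} (hr : 0 < r) (hρ : ∀ j, r ≤ ρ j)
    (ha : Summable fun j => |a j|) (n : ℕ) :
    ∫⁻ x, ENNReal.ofReal x ^ n ∂expMixture a ρ =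
      ENNReal.ofReal (∑' j, max (a j) 0 * (n.factorial / ρ j ^ n)) := by
  rw [lintegral_expMixture, ← (tsum_ofReal_mul_ofReal ha (W := n.factorial / r ^ n)
    (fun j => ?_) fun j => ?_).2]
  · exact tsum_congr fun j => by rw [lintegral_pow_expMeasure (hr.trans_le (hρ j))]
  · have := hr.trans_le (hρ j); positivity
  · gcongr
    exact hρ j

theorem expMixture_Iic {a ρ : ℕ → ℝ} (hρ : ∀ j, 0 < ρ j)
    (ha : Summable fun j => |a j|) {x : ℝ} (hx : 0 ≤ x) :
    expMixture a ρ (Iic x) =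
      ENNReal.ofReal (∑' j, max (a j) 0 * (1 - Real.exp (-(ρ j * x)))) := by
  have h1 : expMixture a ρ (Iic x) =
      ∑' j, ENNReal.ofReal (a j) * ENNReal.ofReal (1 - Real.exp (-(ρ j * x))) := by
    rw [expMixture, Measure.sum_apply _ measurableSet_Iic]
    refine tsum_congr fun j => ?_
    have := isProbabilityMeasure_expMeasure (hρ j)
    rw [Measure.smul_apply, smul_eq_mul, ← ofReal_cdf, cdf_expMeasure_eq (hρ j), if_pos hx]
  rw [h1, (tsum_ofReal_mul_ofReal ha (W := 1) (fun j => ?_) fun j => ?_).2]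
  · have : 0 ≤ ρ j * x := mul_nonneg (hρ j).le hx
    have : Real.exp (-(ρ j * x)) ≤ 1 := by simpa using this
    linarith
  · linarith [Real.exp_pos (-(ρ j * x))]

theorem isFiniteMeasure_expMixture {a ρ : ℕ → ℝ} {r : ℝ} (hr : 0 < r) (hρ : ∀ j, r ≤ ρ j)
    (ha : Summable fun j => |a j|) : IsFiniteMeasure (expMixture a ρ) := by
  refine ⟨?_⟩
  have := lintegral_pow_expMixture hr hρ ha 0
  simp only [pow_zero, lintegral_one] at this
  rw [this]
  exact ENNReal.ofReal_lt_top

/-- A law whose moments are those of a signed mixture of exponential distributions is that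
mixture. -/
theorem add_expMixture_eq_of_moments {μ : Measure ℝ} [IsFiniteMeasure μ] (h0 : ∀ᵐ x ∂μ, 0 ≤ x)
    {a ρ : ℕ → ℝ} {r : ℝ} (hr : 0 < r) (hρ : ∀ j, r ≤ ρ j) (ha : Summable fun j => |a j|)
    (hm0 : ∀ n : ℕ, 0 ≤ ∑' j, a j * (n.factorial / ρ j ^ n))
    (hm : ∀ n : ℕ, ∫⁻ x, ENNReal.ofReal x ^ n ∂μ =
      ENNReal.ofReal (∑' j, a j * (n.factorial / ρ j ^ n))) :
    μ + expMixture (fun j => -a j) ρ = expMixture a ρ := by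
  have hρ0 : ∀ j, 0 < ρ j := fun j => hr.trans_le (hρ j)
  have ha' : Summable fun j => |-a j| := by simpa using ha
  have := isFiniteMeasure_expMixture hr hρ ha
  have := isFiniteMeasure_expMixture hr hρ ha'
  have hw : ∀ (n : ℕ) j, (0 : ℝ) ≤ n.factorial / ρ j ^ n := fun n j => by
    have := hρ0 j; positivity
  have hW : ∀ (n : ℕ) j, (n.factorial : ℝ) / ρ j ^ n ≤ n.factorial / r ^ n := fun n j => by
    gcongr
    exact hρ j
  have hpos : ∀ (b : ℕ → ℝ) (w : ℕ → ℝ), (∀ j, 0 ≤ w j) → 0 ≤ ∑' j, max (b j) 0 * w j :=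
    fun b w hw => tsum_nonneg fun j => mul_nonneg (le_max_right _ _) (hw j)
  -- The negative part is placed on the left, so that two positive measures are compared.
  refine ext_of_moments ?_ (expMixture_ae_nonneg _ _) (fun n => ?_) (half_pos hr) ?_
  · rw [ae_add_measure_iff]
    exact ⟨h0, expMixture_ae_nonneg _ _⟩
  · rw [lintegral_add_measure, hm, lintegral_pow_expMixture hr hρ ha',
      lintegral_pow_expMixture hr hρ ha, ← ENNReal.ofReal_add (hm0 n) (hpos _ _ (hw n)),
      ← tsum_max_sub_tsum_max ha (hw n) (hW n), sub_add_cancel]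
  · rw [lintegral_exp_mul_eq_tsum (expMixture_ae_nonneg _ _) (half_pos hr).le]
    -- All rates are at least `r`, so the `n`-th moment is at most `n! / r^n` times `∑ |a_j|`. At `r
    -- / 2` the exponential series is dominated by a geometric one.
    have hb : ∀ n : ℕ, ENNReal.ofReal ((r / 2) ^ n / n.factorial) *
        ∫⁻ x, ENNReal.ofReal x ^ n ∂expMixture a ρ ≤
        ENNReal.ofReal ((∑' j, |a j|) * (1 / 2) ^ n) := fun n => by
      rw [lintegral_pow_expMixture hr hρ ha, ← ENNReal.ofReal_mul (by positivity)]
      refine ENNReal.ofReal_le_ofReal ?_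
      have : ∑' j, max (a j) 0 * (n.factorial / ρ j ^ n) ≤
          (∑' j, |a j|) * (n.factorial / r ^ n) := by
        rw [← tsum_mul_right]
        refine (tsum_ofReal_mul_ofReal ha (hw n) (hW n)).1.tsum_le_tsum (fun j => ?_)
          (ha.mul_right _)
        exact mul_le_mul (max_le (le_abs_self _) (abs_nonneg _)) (hW n j) (hw n j)
          (abs_nonneg _)
      refine (mul_le_mul_of_nonneg_left this (by positivity)).trans (le_of_eq ?_)
      have : (n.factorial : ℝ) ≠ 0 := by positivity
      rw [div_pow, div_pow, one_pow]
      field_simp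
    have hs : Summable fun n : ℕ => (∑' j, |a j|) * (1 / 2 : ℝ) ^ n :=
      summable_geometric_two.mul_left _
    have hK : 0 ≤ ∑' j, |a j| := tsum_nonneg fun j => abs_nonneg _
    generalize (∑' j, |a j|) = K at hb hs hK
    refine ((ENNReal.tsum_le_tsum hb).trans_lt ?_).ne
    rw [← ENNReal.ofReal_tsum_of_nonneg (fun n => mul_nonneg hK (by positivity)) hs]
    exact ENNReal.ofReal_lt_top

/-- A law whose moments are those of a signed mixture of exponential distributions has the
corresponding distribution function. -/
theorem measureReal_Iic_of_moments {μ : Measure ℝ} [IsFiniteMeasure μ] (h0 : ∀ᵐ x ∂μ, 0 ≤ x)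
    {a ρ : ℕ → ℝ} {r : ℝ} (hr : 0 < r) (hρ : ∀ j, r ≤ ρ j) (ha : Summable fun j => |a j|)
    (hm0 : ∀ n : ℕ, 0 ≤ ∑' j, a j * (n.factorial / ρ j ^ n))
    (hm : ∀ n : ℕ, ∫⁻ x, ENNReal.ofReal x ^ n ∂μ =
      ENNReal.ofReal (∑' j, a j * (n.factorial / ρ j ^ n))) {x : ℝ} (hx : 0 ≤ x) :
    μ.real (Iic x) = ∑' j, a j * (1 - Real.exp (-(ρ j * x))) := by
  have hρ0 : ∀ j, 0 < ρ j := fun j => hr.trans_le (hρ j)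
  have ha' : Summable fun j => |-a j| := by simpa using ha
  have hw1 : ∀ j, 0 ≤ 1 - Real.exp (-(ρ j * x)) := fun j => by
    have : 0 ≤ ρ j * x := mul_nonneg (hρ0 j).le hx
    have : Real.exp (-(ρ j * x)) ≤ 1 := by simpa using this
    linarith
  have hW1 : ∀ j, 1 - Real.exp (-(ρ j * x)) ≤ 1 := fun j => by
    linarith [Real.exp_pos (-(ρ j * x))]
  have h1 := DFunLike.congr_fun (add_expMixture_eq_of_moments h0 hr hρ ha hm0 hm) (Iic x)
  have hpos : ∀ b : ℕ → ℝ, 0 ≤ ∑' j, max (b j) 0 * (1 - Real.exp (-(ρ j * x))) :=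
    fun b => tsum_nonneg fun j => mul_nonneg (le_max_right _ _) (hw1 j)
  rw [Measure.add_apply, expMixture_Iic hρ0 ha hx, expMixture_Iic hρ0 ha' hx] at h1
  have h2 := congrArg ENNReal.toReal h1
  rw [ENNReal.toReal_add (measure_ne_top _ _) ENNReal.ofReal_ne_top,
    ENNReal.toReal_ofReal (hpos a), ENNReal.toReal_ofReal (hpos fun j => -a j)] at h2
  rw [← tsum_max_sub_tsum_max ha hw1 hW1, ← h2, Measure.real, add_sub_cancel_right]

end Moments

/-! ### The law of the exponential functional of the lattice process -/

section LatticeLaw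

theorem HasLaplaceIncrements.ae_expFunctional_ne_top {Ω : Type u} [mΩ : MeasurableSpace Ω]
    {P : Measure Ω} [IsProbabilityMeasure P] {𝓕 : ℝ≥0 → MeasurableSpace Ω} {X : ℝ≥0 → Ω → ℝ}
    {ψ : ℝ → ℝ} (hX : HasLaplaceIncrements P 𝓕 X ψ) (hψ : ∀ n : ℕ, 0 < ψ (n + 1)) :
    ∀ᵐ ω ∂P, expFunctional X ω ≠ ∞ := by
  have h := hX.lintegral_expFunctional_pow hψ 1
  simp only [pow_one, Finset.prod_range_one] at h
  refine (ae_lt_top hX.measurable_expFunctional ?_).mono fun ω h => h.ne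
  rw [h]
  exact ENNReal.ofReal_ne_top

variable {ν : Measure ℝ} {ε : ℝ}

/-- The normalised weights sum to `1`, which separates the constant term from the series. -/
theorem one_sub_tsum_eq_seriesCDF (hν : IsSubordinatorLevyMeasure ν) (hε : 0 < ε)
    (h : ν (Ici ε) ≠ 0) {x : ℝ} (hx : 0 ≤ x) :
    Summable (fun j : ℕ => coeff ν ε j * Real.exp (-(ε * j)) *
      Real.exp (-(Real.exp (ε * j) * x * totalMass ν ε))) ∧
    ∑' j : ℕ, coeff ν ε j * Real.exp (-(1 * (ε * j))) / coeffSeries ν ε 1 *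
      (1 - Real.exp (-(Real.exp (ε * j) * totalMass ν ε * x))) = seriesCDF ν ε x := by
  have hC := coeffSeries_one_pos hν hε h
  have hΛ := totalMass_pos hν hε h
  have hs := summable_coeff_mul_exp hν hε h zero_le_one
  have hs2 : Summable (fun j : ℕ => coeff ν ε j * Real.exp (-(ε * j)) *
      Real.exp (-(Real.exp (ε * j) * x * totalMass ν ε))) := by
    refine Summable.of_norm_bounded hs fun j => ?_
    rw [norm_mul, one_mul]
    refine mul_le_of_le_one_right (norm_nonneg _) ?_
    rw [Real.norm_of_nonneg (Real.exp_pos _).le]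
    have : 0 ≤ Real.exp (ε * j) * x * totalMass ν ε := by positivity
    simpa using this
  refine ⟨hs2, ?_⟩
  have h1 : ∀ j : ℕ, coeff ν ε j * Real.exp (-(1 * (ε * j))) / coeffSeries ν ε 1 *
      (1 - Real.exp (-(Real.exp (ε * j) * totalMass ν ε * x))) =
      (coeffSeries ν ε 1)⁻¹ * (coeff ν ε j * Real.exp (-(1 * (ε * j))) -
        coeff ν ε j * Real.exp (-(ε * j)) *
          Real.exp (-(Real.exp (ε * j) * x * totalMass ν ε))) := fun j => by
    rw [one_mul, mul_right_comm (Real.exp (ε * j)) x]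
    ring
  simp only [h1]
  rw [tsum_mul_left, hs.of_norm.tsum_sub hs2, mul_sub]
  change (coeffSeries ν ε 1)⁻¹ * coeffSeries ν ε 1 - _ = _
  rw [inv_mul_cancel₀ hC.ne', seriesCDF, one_div]
  congr 3
  unfold coeffSeries
  simp only [one_mul]

/-- The `n`-th moment of the exponential law with rate `e^{εj} Λ` contributes `n! e^{-nεj} / Λ^n`.
The mixture therefore has moment `n! C(n + 1) / (C(1) Λ^n)`, and the product formula for `C` turns
it into the moments of `I_{[X^(ε)]}`. -/
theorem tsum_coeff_mul_moment (hν : IsSubordinatorLevyMeasure ν) (hε : 0 < ε)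
    (h : ν (Ici ε) ≠ 0) (n : ℕ) :
    ∑' j : ℕ, coeff ν ε j * Real.exp (-(1 * (ε * j))) / coeffSeries ν ε 1 *
      (n.factorial / (Real.exp (ε * j) * totalMass ν ε) ^ n) =
      ∏ k ∈ Finset.range n, (((k : ℝ) + 1) / latticeExponent ν ε (k + 1)) := by
  have hC := coeffSeries_one_pos hν hε h
  have hΛ := totalMass_pos hν hε h
  have h1 : ∀ j : ℕ, coeff ν ε j * Real.exp (-(1 * (ε * j))) / coeffSeries ν ε 1 *
      (n.factorial / (Real.exp (ε * j) * totalMass ν ε) ^ n) =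
      n.factorial / (coeffSeries ν ε 1 * totalMass ν ε ^ n) *
        (coeff ν ε j * Real.exp (-((n + 1) * (ε * j)))) := fun j => by
    have h2 : Real.exp (-((n + 1) * (ε * j))) * Real.exp (ε * j) ^ n =
        Real.exp (-(1 * (ε * j))) := by
      rw [← Real.exp_nat_mul, ← Real.exp_add]
      ring_nf
    rw [← h2, mul_pow]
    field_simp
  simp only [h1]
  rw [tsum_mul_left]
  change _ * coeffSeries ν ε (n + 1) = _
  rw [coeffSeries_add_one hν hε h, Finset.prod_div_distrib, Finset.prod_div_distrib,
    Finset.prod_const, Finset.card_range, ← Finset.prod_range_add_one_eq_factorial]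
  push_cast
  field_simp

variable {Ω : Type u} [mΩ : MeasurableSpace Ω] {P : Measure Ω} [IsProbabilityMeasure P]
  {X : ℝ≥0 → Ω → ℝ}

/-- The distribution function of the exponential functional of the lattice process. -/
theorem IsRegularSubordinator.expFunctionalCDF_discretised (hν : IsSubordinatorLevyMeasure ν)
    (hX : IsRegularSubordinator P ν X) (hε : 0 < ε) (h : ν (Ici ε) ≠ 0) {x : ℝ} (hx : 0 ≤ x) :
    expFunctionalCDF P (discretised X ε) x = seriesCDF ν ε x := by
  have hL := hX.hasLaplaceIncrements_discretised hν hε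
  have hψ : ∀ n : ℕ, 0 < latticeExponent ν ε (n + 1) := fun n =>
    latticeExponent_pos hν hε h (by positivity)
  have hC := coeffSeries_one_pos hν hε h
  have hΛ := totalMass_pos hν hε h
  have htop := hL.ae_expFunctional_ne_top hψ
  have hmeas := hL.measurable_expFunctional
  set μ : Measure ℝ := P.map fun ω => (expFunctional (discretised X ε) ω).toReal with hμ
  have hμP : IsProbabilityMeasure μ :=
    Measure.isProbabilityMeasure_map hmeas.ennreal_toReal.aemeasurable
  have h0 : ∀ᵐ y ∂μ, 0 ≤ y :=
    (ae_map_iff hmeas.ennreal_toReal.aemeasurable measurableSet_Ici).2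
      (ae_of_all _ fun ω => ENNReal.toReal_nonneg)
  have hprod : ∀ n : ℕ, 0 ≤ ∏ k ∈ Finset.range n, (((k : ℝ) + 1) / latticeExponent ν ε (k + 1)) :=
    fun n => Finset.prod_nonneg fun k _ => div_nonneg (by positivity) (hψ k).le
  have hm : ∀ n : ℕ, ∫⁻ y, ENNReal.ofReal y ^ n ∂μ =
      ENNReal.ofReal (∏ k ∈ Finset.range n, (((k : ℝ) + 1) / latticeExponent ν ε (k + 1))) := by
    intro n
    rw [hμ, lintegral_map (by fun_prop) hmeas.ennreal_toReal,
      ENNReal.ofReal_prod_of_nonneg fun k _ => div_nonneg (by positivity) (hψ k).le,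
      ← hL.lintegral_expFunctional_pow hψ n]
    exact lintegral_congr_ae (htop.mono fun ω hω => by
      dsimp only
      rw [ENNReal.ofReal_toReal hω])
  have key := measureReal_Iic_of_moments h0 hΛ
    (a := fun j : ℕ => coeff ν ε j * Real.exp (-(1 * (ε * j))) / coeffSeries ν ε 1)
    (ρ := fun j : ℕ => Real.exp (ε * j) * totalMass ν ε) (fun j => ?_) ?_ (fun n => ?_)
    (fun n => ?_) hx
  · rw [← (one_sub_tsum_eq_seriesCDF hν hε h hx).2, ← key, hμ,
      map_measureReal_apply hmeas.ennreal_toReal measurableSet_Iic]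
    refine measureReal_congr (htop.mono fun ω hω => propext ?_)
    exact ENNReal.le_ofReal_iff_toReal_le hω hx
  · refine le_mul_of_one_le_left hΛ.le (Real.one_le_exp (by positivity))
  · have := (summable_coeff_mul_exp hν hε h zero_le_one).div_const (coeffSeries ν ε 1)
    refine this.congr fun j => ?_
    rw [abs_div, abs_of_pos hC, Real.norm_eq_abs]
  · rw [tsum_coeff_mul_moment hν hε h]
    exact hprod n
  · rw [tsum_coeff_mul_moment hν hε h]
    exact hm n

end LatticeLaw

/-! ### Moving one large entry through a discounted sum -/

section DiscountedSum

/-- The discounted sum `∑_k e^{-(x_0 + ⋯ + x_{k-1})}`. -/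
noncomputable def discountedSum (x : ℕ → ℝ) : ℝ :=
  (∑' k, ENNReal.ofReal (Real.exp (-∑ j ∈ Finset.range k, x j))).toReal

theorem measurable_discountedSum : Measurable discountedSum := by
  unfold discountedSum
  fun_prop

theorem discountedSum_eq_tsum (x : ℕ → ℝ) :
    discountedSum x = ∑' k, Real.exp (-∑ j ∈ Finset.range k, x j) := by
  rw [discountedSum, ENNReal.tsum_toReal_eq fun _ => ENNReal.ofReal_ne_top]
  exact tsum_congr fun k => ENNReal.toReal_ofReal (Real.exp_pos _).le

/-- The index map moving the entry at `0` to position `i`. -/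
def moveIndex (i k : ℕ) : ℕ := if k < i then k + 1 else if k = i then 0 else k

theorem moveIndex_injective (i : ℕ) : Function.Injective (moveIndex i) := fun k l h => by
  unfold moveIndex at h
  split_ifs at h <;> omega

theorem moveIndex_self (i : ℕ) : moveIndex i i = 0 := by simp [moveIndex]

theorem moveIndex_of_lt {i k : ℕ} (h : i < k) : moveIndex i k = k := by
  rw [moveIndex, if_neg (by omega), if_neg (by omega)]

theorem sum_moveIndex_of_le (x : ℕ → ℝ) {i k : ℕ} (h : k ≤ i) :
    ∑ j ∈ Finset.range k, x (moveIndex i j) = ∑ j ∈ Finset.range k, x (j + 1) :=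
  Finset.sum_congr rfl fun j hj => by
    rw [moveIndex, if_pos ((Finset.mem_range.1 hj).trans_le h)]

theorem sum_moveIndex_of_lt (x : ℕ → ℝ) {i k : ℕ} (h : i < k) :
    ∑ j ∈ Finset.range k, x (moveIndex i j) = ∑ j ∈ Finset.range k, x j := by
  induction k, h using Nat.le_induction with
  | base => rw [Finset.sum_range_succ, sum_moveIndex_of_le x le_rfl, moveIndex_self,
      Finset.sum_range_succ' x]
  | succ k hk ih => rw [Finset.sum_range_succ, ih, Finset.sum_range_succ, moveIndex_of_lt hk]

theorem summable_moveIndex {x : ℕ → ℝ}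
    (hx : Summable fun k => Real.exp (-∑ j ∈ Finset.range k, x j)) (i : ℕ) :
    Summable fun k => Real.exp (-∑ j ∈ Finset.range k, x (moveIndex i j)) := by
  rw [← summable_nat_add_iff (i + 1)] at hx ⊢
  exact hx.congr fun k => by rw [sum_moveIndex_of_lt x (by omega)]

/-- The two arrangements exchange neighbouring entries, so their partial sums differ only at `k = i
+ 1`. -/
theorem discountedSum_moveIndex_succ_sub {x : ℕ → ℝ}
    (hx : Summable fun k => Real.exp (-∑ j ∈ Finset.range k, x j)) (i : ℕ) :
    discountedSum (fun k => x (moveIndex (i + 1) k)) - discountedSum (fun k => x (moveIndex i k)) =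
      Real.exp (-∑ j ∈ Finset.range i, x (j + 1)) * (Real.exp (-x (i + 1)) - Real.exp (-x 0)) := by
  rw [discountedSum_eq_tsum, discountedSum_eq_tsum,
    ← (summable_moveIndex hx (i + 1)).tsum_sub (summable_moveIndex hx i),
    tsum_eq_single (i + 1)]
  · rw [sum_moveIndex_of_le x le_rfl, sum_moveIndex_of_lt x (Nat.lt_succ_self i),
      Finset.sum_range_succ, Finset.sum_range_succ' x, neg_add, neg_add, Real.exp_add,
      Real.exp_add]
    ring
  · intro k hk
    rcases lt_or_gt_of_ne hk with h | h
    · rw [sum_moveIndex_of_le x (by omega), sum_moveIndex_of_le x (by omega), sub_self]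
    · rw [sum_moveIndex_of_lt x (by omega), sum_moveIndex_of_lt x (by omega), sub_self]

/-- If the entry at `0` is large and the entries at `1, …, m` are small, moving the large entry
through positions `0, …, m` increases the discounted sum steadily. -/
theorem discountedSum_moveIndex_sub_ge {x : ℕ → ℝ} {a : ℝ} {m : ℕ} (h0 : ∀ j, 0 ≤ x j)
    (hx : Summable fun k => Real.exp (-∑ j ∈ Finset.range k, x j)) (ha : a ≤ x 0)
    (hsmall : ∀ j < m, x (j + 1) < a) {i i' : ℕ} (hi : i ≤ i') (him : i' ≤ m) :
    Real.exp (-∑ j ∈ Finset.range m, x (j + 1)) *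
        (((i' : ℝ) - i) * (1 - Real.exp (-a)) - ∑ j ∈ Finset.Ico i i', x (j + 1)) ≤
      discountedSum (fun k => x (moveIndex i' k)) - discountedSum (fun k => x (moveIndex i k)) := by
  induction i', hi using Nat.le_induction with
  | base => simp
  | succ l hl ih =>
    have ih := ih (by omega)
    have h1 := discountedSum_moveIndex_succ_sub hx l
    have h2 : Real.exp (-x 0) ≤ Real.exp (-a) := Real.exp_le_exp.2 (neg_le_neg ha)
    have h3 : Real.exp (-a) < Real.exp (-x (l + 1)) :=
      Real.exp_lt_exp.2 (neg_lt_neg (hsmall l (by omega)))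
    have h4 : Real.exp (-∑ j ∈ Finset.range m, x (j + 1)) ≤
        Real.exp (-∑ j ∈ Finset.range l, x (j + 1)) :=
      Real.exp_le_exp.2 (neg_le_neg (Finset.sum_le_sum_of_subset_of_nonneg
        (Finset.range_mono (by omega)) fun j _ _ => h0 _))
    have h5 : 1 - x (l + 1) ≤ Real.exp (-x (l + 1)) := by
      linarith [Real.add_one_le_exp (-x (l + 1))]
    -- Each move gains `1 - e^{-a}` up to the size of the small entry passed, discounted by at most
    -- the sum of all small entries.
    have h6 : Real.exp (-∑ j ∈ Finset.range m, x (j + 1)) * (1 - Real.exp (-a) - x (l + 1)) ≤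
        Real.exp (-∑ j ∈ Finset.range l, x (j + 1)) *
          (Real.exp (-x (l + 1)) - Real.exp (-x 0)) := by
      refine le_trans (mul_le_mul_of_nonneg_left ?_ (Real.exp_pos _).le)
        (mul_le_mul_of_nonneg_right h4 (by linarith))
      linarith
    rw [← h1] at h6
    rw [Finset.sum_Ico_succ_top hl]
    push_cast
    linarith

-- Let `i ≤ i'` be the extreme admissible positions and `H` the sum of the small entries. The
-- increase from `i` to `i'` is less than `β - α`, so `(i' - i)(1 - e^{-a}) ≤ H + e^H (β - α)`. Then
-- `H ≤ e^H` bounds the number of positions between `i` and `i'`.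
open Classical in
theorem card_moveIndex_le {x : ℕ → ℝ} {a α β : ℝ} {m : ℕ} (hpos : 0 < a) (h0 : ∀ j, 0 ≤ x j)
    (hx : Summable fun k => Real.exp (-∑ j ∈ Finset.range k, x j)) (ha : a ≤ x 0)
    (hsmall : ∀ j < m, x (j + 1) < a) (hαβ : α ≤ β) :
    (((Finset.range (m + 1)).filter fun i =>
        discountedSum (fun k => x (moveIndex i k)) ∈ Ioo α β).card : ℝ) ≤
      (1 + (1 + (β - α)) / (1 - Real.exp (-a))) *
        Real.exp (∑ j ∈ Finset.range m, x (j + 1)) := by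
  set s := (Finset.range (m + 1)).filter fun i =>
    discountedSum (fun k => x (moveIndex i k)) ∈ Ioo α β with hs
  set H := ∑ j ∈ Finset.range m, x (j + 1) with hH
  have hH0 : 0 ≤ H := Finset.sum_nonneg fun j _ => h0 _
  have hc : 0 < 1 - Real.exp (-a) := by simpa using hpos
  have hE : 1 ≤ Real.exp H := Real.one_le_exp hH0
  rcases s.eq_empty_or_nonempty with h | h
  · rw [h, Finset.card_empty, Nat.cast_zero]
    have : 0 ≤ (1 + (β - α)) / (1 - Real.exp (-a)) := div_nonneg (by linarith) hc.le
    positivity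
  · have hmin := s.min'_mem h
    have hmax := s.max'_mem h
    have hle := s.min'_le _ hmax
    set i := s.min' h
    set i' := s.max' h
    have hcard : s.card ≤ i' + 1 - i := by
      rw [← Nat.card_Icc]
      exact Finset.card_le_card fun j hj => Finset.mem_Icc.2 ⟨s.min'_le _ hj, s.le_max' _ hj⟩
    rw [hs, Finset.mem_filter, Finset.mem_range] at hmin hmax
    have h1 := discountedSum_moveIndex_sub_ge h0 hx ha hsmall hle (by omega)
    have h2 : ∑ j ∈ Finset.Ico i i', x (j + 1) ≤ H :=
      Finset.sum_le_sum_of_subset_of_nonneg (fun j hj => by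
        rw [Finset.mem_Ico] at hj
        rw [Finset.mem_range]
        omega) fun j _ _ => h0 _
    have h3 : Real.exp (-H) * (((i' : ℝ) - i) * (1 - Real.exp (-a)) - H) ≤ β - α := by
      refine le_trans (mul_le_mul_of_nonneg_left ?_ (Real.exp_pos _).le)
        (h1.trans ?_)
      · linarith
      · linarith [hmin.2.1, hmax.2.2]
    have h4 : ((i' : ℝ) - i) * (1 - Real.exp (-a)) ≤ Real.exp H * (1 + (β - α)) := by
      rw [Real.exp_neg, inv_mul_le_iff₀ (Real.exp_pos _)] at h3
      linarith [Real.add_one_le_exp H]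
    have h5 : ((i' : ℝ) - i) ≤ (1 + (β - α)) / (1 - Real.exp (-a)) * Real.exp H := by
      rw [div_mul_eq_mul_div, le_div_iff₀ hc]
      linarith
    have h6 : (s.card : ℝ) ≤ (i' : ℝ) - i + 1 := by
      have : (s.card : ℝ) ≤ ((i' + 1 - i : ℕ) : ℝ) := Nat.cast_le.2 hcard
      rw [Nat.cast_sub (by omega)] at this
      push_cast at this
      linarith
    rw [add_mul, one_mul]
    linarith

end DiscountedSum

/-! ### A concentration bound for discounted sums of i.i.d. variables -/

section Concentration

variable {Ω : Type u} [mΩ : MeasurableSpace Ω] {P : Measure Ω} {ξ : ℕ → Ω → ℝ}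

/-- An i.i.d. sequence has the product law along any family of distinct indices; this is the
exchangeability used with `moveIndex`. -/
theorem map_precomp_eq (hm : ∀ k, Measurable (ξ k)) (hind : iIndepFun ξ P)
    (hid : ∀ k, P.map (ξ k) = P.map (ξ 0)) {σ : ℕ → ℕ} (hσ : Function.Injective σ) :
    P.map (fun ω k => ξ (σ k) ω) = P.map (fun ω k => ξ k ω) := by
  rw [hind.map_fun_eq_infinitePi_map hm,
    (hind.precomp hσ).map_fun_eq_infinitePi_map fun k => hm (σ k)]
  simp only [hid]

theorem ae_exists_ge (hm : ∀ k, Measurable (ξ k)) (hind : iIndepFun ξ P)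
    (hid : ∀ k, P.map (ξ k) = P.map (ξ 0)) {a : ℝ} (hq : P (ξ 0 ⁻¹' Iio a) < 1) :
    ∀ᵐ ω ∂P, ∀ n, ∃ j ≥ n, a ≤ ξ j ω := by
  rw [ae_all_iff]
  intro n
  rw [ae_iff]
  refine le_antisymm (ge_of_tendsto' (ENNReal.tendsto_pow_atTop_nhds_zero_of_lt_one hq)
    fun M => ?_) zero_le
  have h1 := hind.measure_inter_preimage_eq_mul (Finset.Ico n (n + M)) (sets := fun _ => Iio a)
    fun _ _ => measurableSet_Iio
  have h2 : ∀ j, P (ξ j ⁻¹' Iio a) = P (ξ 0 ⁻¹' Iio a) := fun j => by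
    rw [← Measure.map_apply (hm j) measurableSet_Iio, hid j,
      Measure.map_apply (hm 0) measurableSet_Iio]
  simp only [h2, Finset.prod_const, Nat.card_Ico, add_tsub_cancel_left] at h1
  rw [← h1]
  refine measure_mono fun ω hω => ?_
  simp only [mem_ofPred_eq, not_exists, not_and, not_le] at hω
  simp only [mem_iInter, mem_preimage, mem_Iio]
  exact fun j hj => hω j (Finset.mem_Ico.1 hj).1

/-- The sequences whose first entry `≥ a` is at `i`, whose second is at `m + 1`, and whose
discounted sum lies in `(α, β)`. -/
def twoLarge (a α β : ℝ) (i m : ℕ) : Set (ℕ → ℝ) :=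
  {x | (∀ j ≤ m, j ≠ i → x j < a) ∧ a ≤ x i ∧ a ≤ x (m + 1) ∧ discountedSum x ∈ Ioo α β}

theorem measurableSet_twoLarge (a α β : ℝ) (i m : ℕ) : MeasurableSet (twoLarge a α β i m) := by
  have h1 : MeasurableSet {x : ℕ → ℝ | ∀ j ≤ m, j ≠ i → x j < a} := by
    simp only [ofPred_forall]
    exact .iInter fun j => .iInter fun _ => .iInter fun _ =>
      measurableSet_lt (measurable_pi_apply j) measurable_const
  exact h1.inter ((measurableSet_le measurable_const (measurable_pi_apply i)).inter
    ((measurableSet_le measurable_const (measurable_pi_apply (m + 1))).inter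
      (measurable_discountedSum measurableSet_Ioo)))

theorem exists_mem_twoLarge {x : ℕ → ℝ} {a α β : ℝ} (hx : ∀ n, ∃ j ≥ n, a ≤ x j)
    (hD : discountedSum x ∈ Ioo α β) : ∃ m, ∃ i ∈ Finset.range (m + 1), x ∈ twoLarge a α β i m := by
  classical
  have h0 := hx 0
  set i := Nat.find h0 with hi
  have h1 := hx (i + 1)
  obtain ⟨h2, h3⟩ := Nat.find_spec h1
  refine ⟨Nat.find h1 - 1, i, Finset.mem_range.2 (by omega), fun j hj hji => ?_,
    (Nat.find_spec h0).2, ?_, hD⟩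
  · rcases lt_or_gt_of_ne hji with h | h
    · exact not_le.1 fun h' => Nat.find_min h0 h ⟨Nat.zero_le _, h'⟩
    · exact not_le.1 fun h' => Nat.find_min h1 (m := j) (by omega) ⟨h, h'⟩
  · rwa [Nat.sub_add_cancel (by omega)]

/-- The factor `e^H` in the bound for the number of positions is a product over the small entries,
so independence splits its expectation on the event of two large entries enclosing `m` small ones.
-/
theorem lintegral_twoLarge_weight (hm : ∀ k, Measurable (ξ k)) (hind : iIndepFun ξ P)
    (hid : ∀ k, P.map (ξ k) = P.map (ξ 0)) (a : ℝ) (m : ℕ) :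
    ∫⁻ ω, (Ici a).indicator 1 (ξ 0 ω) * (∏ j ∈ Finset.range m,
        (Iio a).indicator (fun y => ENNReal.ofReal (Real.exp y)) (ξ (j + 1) ω)) *
        (Ici a).indicator 1 (ξ (m + 1) ω) ∂P =
      P (ξ 0 ⁻¹' Ici a) ^ 2 *
        (∫⁻ ω, (Iio a).indicator (fun y => ENNReal.ofReal (Real.exp y)) (ξ 0 ω) ∂P) ^ m := by
  set big : ℝ → ℝ≥0∞ := (Ici a).indicator 1 with hbig
  set small : ℝ → ℝ≥0∞ := (Iio a).indicator (fun y => ENNReal.ofReal (Real.exp y)) with hsm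
  have hb : Measurable big := measurable_one.indicator measurableSet_Ici
  have hs : Measurable small :=
    (Real.measurable_exp.ennreal_ofReal).indicator measurableSet_Iio
  set g : ℕ → ℝ → ℝ≥0∞ := fun k => if k = 0 ∨ k = m + 1 then big else small with hg
  have hgm : ∀ k, Measurable (g k) := fun k => by
    simp only [hg]
    split_ifs <;> assumption
  have h1 := lintegral_prod_eq_prod_lintegral_of_indepFun (Finset.range (m + 2))
    (fun k => g k ∘ ξ k) (hind.comp g hgm) fun k => (hgm k).comp (hm k)
  have h2 : ∀ k, ∫⁻ ω, (g k ∘ ξ k) ω ∂P = ∫⁻ ω, g k (ξ 0 ω) ∂P := fun k => by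
    rw [← lintegral_map (hgm k) (hm 0), ← hid k, lintegral_map (hgm k) (hm k)]
    rfl
  have hg0 : g 0 = big := by simp [hg]
  have hg1 : g (m + 1) = big := by simp [hg]
  have hgj : ∀ j ∈ Finset.range m, g (j + 1) = small := fun j hj => by
    have := Finset.mem_range.1 hj
    simp only [hg]
    rw [if_neg (by omega)]
  simp only [h2] at h1
  have h3 : ∀ f : ℕ → ℝ≥0∞, ∏ k ∈ Finset.range (m + 2), f k =
      f 0 * (∏ j ∈ Finset.range m, f (j + 1)) * f (m + 1) := fun f => by
    rw [Finset.prod_range_succ, Finset.prod_range_succ', mul_comm (f 0)]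
  rw [h3, hg0, hg1, Finset.prod_congr rfl fun j hj => by rw [hgj j hj]] at h1
  simp only [h3] at h1
  have h4 : ∫⁻ ω, big (ξ 0 ω) ∂P = P (ξ 0 ⁻¹' Ici a) := by
    rw [← lintegral_map hb (hm 0), hbig, lintegral_indicator_one measurableSet_Ici,
      Measure.map_apply (hm 0) measurableSet_Ici]
  rw [h4, Finset.prod_const, Finset.card_range] at h1
  calc _ = _ := lintegral_congr fun ω => by
        simp only [Function.comp, hg0, hg1]
        congr 2
        exact Finset.prod_congr rfl fun j hj => by rw [hgj j hj]
    _ = _ := h1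
    _ = _ := by ring

/-- A concentration estimate for discounted sums of independent identically distributed
nonnegative random variables. -/
theorem measure_discountedSum_mem_Ioo_le (hm : ∀ k, Measurable (ξ k)) (hind : iIndepFun ξ P)
    (hid : ∀ k, P.map (ξ k) = P.map (ξ 0)) (h0 : ∀ k ω, 0 ≤ ξ k ω)
    (hsum : ∀ᵐ ω ∂P, Summable fun k => Real.exp (-∑ j ∈ Finset.range k, ξ j ω))
    {a : ℝ} (ha : 0 < a) (hq : P (ξ 0 ⁻¹' Iio a) < 1) {α β : ℝ} (hαβ : α ≤ β) :
    P {ω | discountedSum (fun k => ξ k ω) ∈ Ioo α β} ≤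
      ENNReal.ofReal (1 + (1 + (β - α)) / (1 - Real.exp (-a))) * P (ξ 0 ⁻¹' Ici a) ^ 2 *
        (1 - ∫⁻ ω, (Iio a).indicator (fun y => ENNReal.ofReal (Real.exp y)) (ξ 0 ω) ∂P)⁻¹ := by
  classical
  set K := 1 + (1 + (β - α)) / (1 - Real.exp (-a)) with hK
  set r := ∫⁻ ω, (Iio a).indicator (fun y => ENNReal.ofReal (Real.exp y)) (ξ 0 ω) ∂P with hr
  set p := P (ξ 0 ⁻¹' Ici a)
  have hmeas : Measurable fun ω k => ξ k ω := measurable_pi_iff.2 hm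
  have hmeasσ : ∀ i, Measurable fun ω k => ξ (moveIndex i k) ω := fun i =>
    measurable_pi_iff.2 fun k => hm _
  -- All the events for a given `m` are pulled back to sequences whose large entry stands at `0`.
  -- For such a sequence, summing over `i` counts the admissible positions.
  have hmove : ∀ i m, P {ω | (fun k => ξ k ω) ∈ twoLarge a α β i m} =
      P {ω | (fun k => ξ (moveIndex i k) ω) ∈ twoLarge a α β i m} := fun i m => by
    have h1 := map_precomp_eq hm hind hid (moveIndex_injective i)
    have h2 := DFunLike.congr_fun h1 (twoLarge a α β i m)
    rw [Measure.map_apply (hmeasσ i) (measurableSet_twoLarge a α β i m),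
      Measure.map_apply hmeas (measurableSet_twoLarge a α β i m)] at h2
    exact h2.symm
  have hstep : ∀ m, ∑ i ∈ Finset.range (m + 1), P {ω | (fun k => ξ k ω) ∈ twoLarge a α β i m} ≤
      ENNReal.ofReal K * p ^ 2 * r ^ m := by
    intro m
    have hms : ∀ i, MeasurableSet {ω | (fun k => ξ (moveIndex i k) ω) ∈ twoLarge a α β i m} :=
      fun i => hmeasσ i (measurableSet_twoLarge a α β i m)
    calc ∑ i ∈ Finset.range (m + 1), P {ω | (fun k => ξ k ω) ∈ twoLarge a α β i m}
        = ∑ i ∈ Finset.range (m + 1), ∫⁻ ω, {ω | (fun k => ξ (moveIndex i k) ω) ∈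
            twoLarge a α β i m}.indicator 1 ω ∂P :=
          Finset.sum_congr rfl fun i _ => by rw [hmove, lintegral_indicator_one (hms i)]
      _ = ∫⁻ ω, ∑ i ∈ Finset.range (m + 1), {ω | (fun k => ξ (moveIndex i k) ω) ∈
            twoLarge a α β i m}.indicator 1 ω ∂P :=
          (lintegral_finsetSum _ fun i _ => measurable_one.indicator (hms i)).symm
      _ ≤ ∫⁻ ω, ENNReal.ofReal K * ((Ici a).indicator 1 (ξ 0 ω) * (∏ j ∈ Finset.range m,
            (Iio a).indicator (fun y => ENNReal.ofReal (Real.exp y)) (ξ (j + 1) ω)) *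
            (Ici a).indicator 1 (ξ (m + 1) ω)) ∂P := by
          refine lintegral_mono_ae (hsum.mono fun ω hω => ?_)
          by_cases hgood : a ≤ ξ 0 ω ∧ (∀ j < m, ξ (j + 1) ω < a) ∧ a ≤ ξ (m + 1) ω
          · obtain ⟨g1, g2, g3⟩ := hgood
            have hcard := card_moveIndex_le ha (fun j => h0 j ω) hω g1 g2 hαβ
            rw [indicator_of_mem (mem_Ici.2 g1), indicator_of_mem (mem_Ici.2 g3)]
            rw [Finset.prod_congr rfl fun j hj =>
              indicator_of_mem (mem_Iio.2 (g2 j (Finset.mem_range.1 hj))) _]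
            rw [← ENNReal.ofReal_prod_of_nonneg fun j _ => (Real.exp_pos _).le, ← Real.exp_sum]
            simp only [Pi.one_apply, one_mul, mul_one]
            rw [← ENNReal.ofReal_mul' (Real.exp_pos _).le]
            refine le_trans ?_ (ENNReal.ofReal_le_ofReal hcard)
            rw [ENNReal.ofReal_natCast, Finset.card_filter, Nat.cast_sum]
            refine Finset.sum_le_sum fun i _ => ?_
            by_cases hi : (fun k => ξ (moveIndex i k) ω) ∈ twoLarge a α β i m
            · rw [if_pos hi.2.2.2]
              exact (indicator_le_self _ _ _).trans (by simp)
            · rw [indicator_of_notMem (by exact hi)]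
              exact zero_le
          · rw [Finset.sum_eq_zero fun i hi => ?_]
            · exact zero_le
            · refine indicator_of_notMem (fun hmem => hgood ?_) _
              obtain ⟨g1, g2, g3, -⟩ := hmem
              have him : i ≤ m := Nat.lt_succ_iff.1 (Finset.mem_range.1 hi)
              dsimp only at g1 g2 g3
              rw [moveIndex_self] at g2
              rw [moveIndex_of_lt (Nat.lt_succ_iff.2 him)] at g3
              refine ⟨g2, fun j hj => ?_, g3⟩
              rcases lt_or_ge j i with h | h
              · have := g1 j hj.le h.ne
                rwa [moveIndex, if_pos h] at this
              · have := g1 (j + 1) hj (by omega)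
                rwa [moveIndex_of_lt (by omega)] at this
      _ = _ := by
          rw [lintegral_const_mul, lintegral_twoLarge_weight hm hind hid, mul_assoc]
          have e1 : Measurable ((Ici a).indicator (1 : ℝ → ℝ≥0∞)) :=
            measurable_one.indicator measurableSet_Ici
          have e2 : Measurable ((Iio a).indicator (fun y => ENNReal.ofReal (Real.exp y))) :=
            (Real.measurable_exp.ennreal_ofReal).indicator measurableSet_Iio
          exact ((e1.comp (hm 0)).mul (Finset.measurable_prod _ fun j _ =>
            e2.comp (hm (j + 1)))).mul (e1.comp (hm (m + 1)))
  calc P {ω | discountedSum (fun k => ξ k ω) ∈ Ioo α β}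
      ≤ P (⋃ m, ⋃ i ∈ Finset.range (m + 1), {ω | (fun k => ξ k ω) ∈ twoLarge a α β i m}) := by
        refine measure_mono_ae ((ae_exists_ge hm hind hid hq).mono fun ω hω hD => ?_)
        obtain ⟨m, i, hi, hx⟩ := exists_mem_twoLarge hω hD
        exact mem_iUnion.2 ⟨m, mem_iUnion₂.2 ⟨i, hi, hx⟩⟩
    -- Almost every sequence has two large entries, so the events cover. Their bounds form a
    -- geometric series in `r`.
    _ ≤ ∑' m, ∑ i ∈ Finset.range (m + 1), P {ω | (fun k => ξ k ω) ∈ twoLarge a α β i m} :=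
        (measure_iUnion_le _).trans (ENNReal.tsum_le_tsum fun m => measure_biUnion_finset_le _ _)
    _ ≤ ∑' m, ENNReal.ofReal K * p ^ 2 * r ^ m := ENNReal.tsum_le_tsum hstep
    _ = _ := by rw [ENNReal.tsum_mul_left, ENNReal.tsum_geometric]

end Concentration

/-! ### Comparison of the exponential functional with a discounted sum -/

section Sandwich

variable {Ω : Type u} {X : ℝ≥0 → Ω → ℝ}

theorem expFunctional_eq_tsum_setLIntegral {h : ℝ} (hh : 0 < h) (ω : Ω) :
    expFunctional X ω =
      ∑' k : ℕ, ∫⁻ t in Ioc (k * h) ((k + 1 : ℕ) * h),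
        ENNReal.ofReal (Real.exp (-X t.toNNReal ω)) := by
  have hmono : Monotone fun k : ℕ => (k : ℝ) * h := fun a b hab => by
    dsimp only
    gcongr
  have hU : Ioi (0 : ℝ) = ⋃ k : ℕ, Ioc ((k : ℝ) * h) ((k + 1 : ℕ) * h) := by
    ext t
    simp only [mem_Ioi, mem_iUnion, mem_Ioc]
    constructor
    · intro ht
      obtain ⟨k, hk⟩ : ∃ k : ℕ, ⌈t / h⌉₊ = k + 1 :=
        Nat.exists_eq_add_one.2 (Nat.ceil_pos.2 (div_pos ht hh))
      refine ⟨k, ?_, ?_⟩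
      · rw [← lt_div_iff₀ hh]
        exact Nat.lt_ceil.1 (by omega)
      · rw [← div_le_iff₀ hh, ← hk]
        exact Nat.le_ceil _
    · rintro ⟨k, hk, -⟩
      exact lt_of_le_of_lt (by positivity) hk
  rw [expFunctional, hU]
  exact lintegral_iUnion (fun k => measurableSet_Ioc) hmono.pairwise_disjoint_on_Ioc_succ _

theorem expFunctional_le_mul_tsum (hmono : ∀ ω, Monotone fun t => X t ω) {h : ℝ≥0} (hh : 0 < h)
    (ω : Ω) :
    expFunctional X ω ≤
      ENNReal.ofReal h * ∑' k : ℕ, ENNReal.ofReal (Real.exp (-X (k * h) ω)) := by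
  rw [expFunctional_eq_tsum_setLIntegral (NNReal.coe_pos.2 hh), ← ENNReal.tsum_mul_left]
  refine ENNReal.tsum_le_tsum fun k => ?_
  calc _ ≤ ∫⁻ _ in Ioc ((k : ℝ) * h) ((k + 1 : ℕ) * h),
        ENNReal.ofReal (Real.exp (-X (k * h) ω)) := by
        refine setLIntegral_mono' measurableSet_Ioc fun t ht => ?_
        refine ENNReal.ofReal_le_ofReal (Real.exp_le_exp.2 (neg_le_neg (hmono ω ?_)))
        rw [← NNReal.coe_le_coe, Real.coe_toNNReal _ (le_trans (by positivity) ht.1.le)]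
        exact_mod_cast ht.1.le
    _ = _ := by
        rw [setLIntegral_const, Real.volume_Ioc, mul_comm]
        congr 2
        push_cast
        ring

/-- Monotone paths make the Riemann sum at right endpoints a lower bound for the integral. The sum
at left endpoints exceeds it by its first term, which is `h`. -/
theorem mul_tsum_le_add_expFunctional (hmono : ∀ ω, Monotone fun t => X t ω)
    (hzero : ∀ ω, X 0 ω = 0) {h : ℝ≥0} (hh : 0 < h) (ω : Ω) :
    ENNReal.ofReal h * ∑' k : ℕ, ENNReal.ofReal (Real.exp (-X (k * h) ω)) ≤
      ENNReal.ofReal h + expFunctional X ω := by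
  rw [expFunctional_eq_tsum_setLIntegral (NNReal.coe_pos.2 hh),
    tsum_eq_zero_add' ENNReal.summable, mul_add]
  refine add_le_add (by simp [hzero]) ?_
  rw [← ENNReal.tsum_mul_left]
  refine ENNReal.tsum_le_tsum fun k => ?_
  calc _ = ∫⁻ _ in Ioc ((k : ℝ) * h) ((k + 1 : ℕ) * h),
        ENNReal.ofReal (Real.exp (-X ((k + 1 : ℕ) * h) ω)) := by
        rw [setLIntegral_const, Real.volume_Ioc, mul_comm]
        congr 2
        push_cast
        ring
    _ ≤ _ := by
        refine setLIntegral_mono' measurableSet_Ioc fun t ht => ?_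
        refine ENNReal.ofReal_le_ofReal (Real.exp_le_exp.2 (neg_le_neg (hmono ω ?_)))
        rw [Real.toNNReal_le_iff_le_coe]
        exact_mod_cast ht.2

theorem sum_increments (hzero : ∀ ω, X 0 ω = 0) (h : ℝ≥0) (ω : Ω) (k : ℕ) :
    ∑ j ∈ Finset.range k, (X ((j + 1 : ℕ) * h) ω - X (j * h) ω) = X (k * h) ω := by
  rw [Finset.sum_range_sub fun j : ℕ => X (j * h) ω]
  simp [hzero]

/-- The exponential functional is close to a discounted sum of increments. -/
theorem mul_discountedSum_mem_Icc (hmono : ∀ ω, Monotone fun t => X t ω)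
    (hzero : ∀ ω, X 0 ω = 0) {h : ℝ≥0} (hh : 0 < h) {ω : Ω} (hω : expFunctional X ω ≠ ∞) :
    (Summable fun k => Real.exp
      (-∑ j ∈ Finset.range k, (X ((j + 1 : ℕ) * h) ω - X (j * h) ω))) ∧
    h * discountedSum (fun j => X ((j + 1 : ℕ) * h) ω - X (j * h) ω) ∈
      Icc (expFunctional X ω).toReal ((expFunctional X ω).toReal + h) := by
  have h1 := expFunctional_le_mul_tsum hmono hh ω
  have h2 := mul_tsum_le_add_expFunctional hmono hzero hh ω
  simp only [discountedSum, sum_increments hzero]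
  set T := ∑' k : ℕ, ENNReal.ofReal (Real.exp (-X (k * h) ω)) with hT
  have hh' : (0 : ℝ) < h := NNReal.coe_pos.2 hh
  have hmul : ENNReal.ofReal h * T ≠ ∞ :=
    ne_top_of_le_ne_top (ENNReal.add_ne_top.2 ⟨ENNReal.ofReal_ne_top, hω⟩) h2
  have hTtop : T ≠ ∞ := fun hc => by
    rw [hc, ENNReal.mul_top (by simpa using hh.ne')] at hmul
    exact hmul rfl
  have h3 : (ENNReal.ofReal h * T).toReal = h * T.toReal := by
    rw [ENNReal.toReal_mul, ENNReal.toReal_ofReal hh'.le]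
  refine ⟨?_, ?_, ?_⟩
  · refine (ENNReal.summable_toReal hTtop).congr fun k => ?_
    exact ENNReal.toReal_ofReal (Real.exp_pos _).le
  · rw [← h3]
    exact ENNReal.toReal_mono hmul h1
  · rw [← h3, add_comm]
    refine (ENNReal.toReal_mono (ENNReal.add_ne_top.2 ⟨ENNReal.ofReal_ne_top, hω⟩) h2).trans ?_
    rw [ENNReal.toReal_add ENNReal.ofReal_ne_top hω, ENNReal.toReal_ofReal hh'.le]

end Sandwich

/-! ### The bound for the density of the exponential functional -/

section Density

variable {Ω : Type u} [mΩ : MeasurableSpace Ω] {P : Measure Ω} {ν : Measure ℝ}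
  {X : ℝ≥0 → Ω → ℝ}

/-- Markov's inequality for `1 - e^{-X_h}`, whose mean is `1 - e^{-hΨ(1)} ≤ h Ψ(1)`. -/
theorem IsRegularSubordinator.measure_ge_le [IsProbabilityMeasure P]
    (hX : IsRegularSubordinator P ν X) {a : ℝ} (ha : 0 < a) (h : ℝ≥0) :
    P (X h ⁻¹' Ici a) ≤ ENNReal.ofReal (laplaceExponent ν 1 / (1 - Real.exp (-a)) * h) := by
  have hc : 0 < 1 - Real.exp (-a) := by simpa using ha
  have hi := hX.integrable_exp h zero_le_one
  have h1 := mul_meas_ge_le_integral_of_nonneg (μ := P) (f := fun ω => 1 - Real.exp (-(1 * X h ω)))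
    (ae_of_all _ fun ω => by
      have : 0 ≤ X h ω := hX.nonneg h ω
      simpa using this) ((integrable_const 1).sub hi) (1 - Real.exp (-a))
  rw [integral_sub (integrable_const 1) hi, hX.laplace h 1 zero_le_one] at h1
  simp only [integral_const, probReal_univ, smul_eq_mul, mul_one, one_mul] at h1
  have h2 : {ω | 1 - Real.exp (-a) ≤ 1 - Real.exp (-X h ω)} = X h ⁻¹' Ici a := by
    ext ω
    rw [mem_ofPred_eq, mem_preimage, mem_Ici, sub_le_sub_iff_left, Real.exp_le_exp,
      neg_le_neg_iff]
  rw [h2] at h1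
  have h3 := Real.add_one_le_exp (-(h * laplaceExponent ν 1))
  rw [← ENNReal.ofReal_toReal (measure_ne_top P (X h ⁻¹' Ici a))]
  refine ENNReal.ofReal_le_ofReal ?_
  rw [div_mul_eq_mul_div, le_div_iff₀ hc]
  change P.real _ * _ ≤ _
  linarith

/-- This keeps the ratio of the geometric series below `1` by an amount of order `h`. The condition
on `a` yields the pointwise bound `e^x 1_{x < a} ≤ 1 - (1 - e^{-x}) + 4 (1 - e^{-x}) e^{-mx}` for `x
≥ 0`, because `e^x - 1 = e^x (1 - e^{-x})`. The small-time limits of both correction terms are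
differences of `Ψ`. -/
theorem IsRegularSubordinator.eventually_lintegral_le [IsProbabilityMeasure P]
    (hν : IsSubordinatorLevyMeasure ν) (hX : IsRegularSubordinator P ν X) {a c : ℝ} {m : ℕ}
    (ham : 1 + Real.exp a ≤ 4 * Real.exp (-(m * a)))
    (hc : c < laplaceExponent ν 1 - 4 * (laplaceExponent ν (m + 1) - laplaceExponent ν m)) :
    ∀ᶠ h : ℝ≥0 in 𝓝[>] 0,
      ∫⁻ ω, (Iio a).indicator (fun y => ENNReal.ofReal (Real.exp y)) (X h ω) ∂P ≤
        ENNReal.ofReal (1 - c * h) := by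
  have hΨ0 : laplaceExponent ν 0 = 0 := by simp [laplaceExponent]
  have h0 := hX.tendsto_div_monomial hν (u := 0) le_rfl
  have hm := hX.tendsto_div_monomial hν (u := m) (Nat.cast_nonneg m)
  rw [← laplaceExponent_add_one_sub hν le_rfl, hΨ0, zero_add, sub_zero] at h0
  rw [← laplaceExponent_add_one_sub hν (Nat.cast_nonneg m)] at hm
  have hlim := h0.sub (hm.const_mul 4)
  filter_upwards [hlim.eventually (lt_mem_nhds hc), self_mem_nhdsWithin] with h hh hpos
  have hpos' : (0 : ℝ) < h := NNReal.coe_pos.2 hpos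
  have hXm := hX.measurable h
  have hb : ∀ u : ℝ, 0 ≤ u → Integrable
      (fun ω => (1 - Real.exp (-X h ω)) * Real.exp (-(u * X h ω))) P := fun u hu => by
    have := (hX.integrable_exp h hu).sub (hX.integrable_exp h (u := u + 1) (by linarith))
    refine this.congr (ae_of_all _ fun ω => ?_)
    simp only [Pi.sub_apply]
    rw [sub_mul, one_mul, ← Real.exp_add]
    ring_nf
  have hφm : Measurable fun ω => (Iio a).indicator Real.exp (X h ω) :=
    (Real.measurable_exp.indicator measurableSet_Iio).comp hXm
  have hφi : Integrable (fun ω => (Iio a).indicator Real.exp (X h ω)) P := by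
    refine Integrable.of_bound (C := Real.exp a) hφm.aestronglyMeasurable (ae_of_all _ fun ω => ?_)
    by_cases hω : X h ω < a
    · rw [indicator_of_mem (mem_Iio.2 hω), Real.norm_of_nonneg (Real.exp_pos _).le]
      exact Real.exp_le_exp.2 hω.le
    · rw [indicator_of_notMem (by simpa using hω), norm_zero]
      exact (Real.exp_pos _).le
  have h1 : ∫⁻ ω, (Iio a).indicator (fun y => ENNReal.ofReal (Real.exp y)) (X h ω) ∂P =
      ENNReal.ofReal (∫ ω, (Iio a).indicator Real.exp (X h ω) ∂P) := by
    rw [ofReal_integral_eq_lintegral_ofReal hφi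
      (ae_of_all _ fun ω => indicator_nonneg (fun _ _ => (Real.exp_pos _).le) _)]
    refine lintegral_congr fun ω => ?_
    by_cases hω : X h ω < a
    · rw [indicator_of_mem (mem_Iio.2 hω), indicator_of_mem (mem_Iio.2 hω)]
    · rw [indicator_of_notMem (by simpa using hω), indicator_of_notMem (by simpa using hω),
        ENNReal.ofReal_zero]
  rw [h1]
  refine ENNReal.ofReal_le_ofReal ?_
  have h2 : ∫ ω, (Iio a).indicator Real.exp (X h ω) ∂P ≤
      ∫ ω, (1 - ((1 - Real.exp (-X h ω)) * Real.exp (-(0 * X h ω)) -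
        4 * ((1 - Real.exp (-X h ω)) * Real.exp (-(m * X h ω))))) ∂P := by
    refine integral_mono hφi ((integrable_const 1).sub ((hb 0 le_rfl).sub
      ((hb m (Nat.cast_nonneg m)).const_mul 4))) fun ω => ?_
    have hx := hX.nonneg h ω
    dsimp only
    generalize X h ω = x at hx ⊢
    have e1 : Real.exp (-x) ≤ 1 := by simpa using hx
    have e2 := Real.exp_pos (-x)
    rw [zero_mul, neg_zero, Real.exp_zero, mul_one]
    by_cases hxa : x < a
    · rw [indicator_of_mem (mem_Iio.2 hxa)]
      have e3 : Real.exp x ≤ Real.exp a := Real.exp_le_exp.2 hxa.le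
      have e4 : Real.exp (-(m * a)) ≤ Real.exp (-(m * x)) := Real.exp_le_exp.2
        (neg_le_neg (mul_le_mul_of_nonneg_left hxa.le (Nat.cast_nonneg m)))
      have e5 : Real.exp x * Real.exp (-x) = 1 := by rw [← Real.exp_add]; simp
      nlinarith [mul_nonneg (sub_nonneg.2 e1)
        (show 0 ≤ 4 * Real.exp (-(m * x)) - 1 - Real.exp x by linarith)]
    · rw [indicator_of_notMem (by simpa using hxa)]
      nlinarith [mul_nonneg (sub_nonneg.2 e1) (Real.exp_pos (-(m * x))).le]
  have h3 := integral_sub (integrable_const (μ := P) (1 : ℝ)) ((hb 0 le_rfl).sub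
    ((hb m (Nat.cast_nonneg m)).const_mul 4))
  simp only [Pi.sub_apply] at h3
  refine h2.trans (h3.trans_le ?_)
  rw [integral_sub (hb 0 le_rfl) ((hb m (Nat.cast_nonneg m)).const_mul 4), integral_const_mul]
  simp only [integral_const, probReal_univ, smul_eq_mul, mul_one]
  rw [mul_div_assoc', ← sub_div, lt_div_iff₀ hpos'] at hh
  linarith

/-- The law of the exponential functional has a density bounded in terms of the Lévy measure. -/
theorem exists_measure_expFunctional_mem_Ioo_le (hν : IsSubordinatorLevyMeasure ν) (hν0 : ν ≠ 0) :
    ∃ C > 0, ∀ (Ω : Type u) [MeasurableSpace Ω] (P : Measure Ω) [IsProbabilityMeasure P]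
      (X : ℝ≥0 → Ω → ℝ), IsRegularSubordinator P ν X → ∀ α β : ℝ, α ≤ β →
        P {ω | (expFunctional X ω).toReal ∈ Ioo α β} ≤ ENNReal.ofReal (C * (β - α)) := by
  have hΨ : 0 < laplaceExponent ν 1 := hν.laplaceExponent_pos hν0 one_pos
  -- With `Ψ(m + 1) - Ψ(m) < Ψ(1) / 8` the admissible range for `c` includes everything up to `Ψ(1)
  -- / 2`; `Ψ(1) / 4` is taken below. At `a = 0` the condition on `a` reads `2 < 4`, so it persists
  -- for small `a > 0`.
  obtain ⟨m, hm⟩ := ((tendsto_laplaceExponent_add_one_sub hν).eventually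
    (gt_mem_nhds (show 0 < laplaceExponent ν 1 / 8 by linarith))).exists
  obtain ⟨a, ham, ha⟩ : ∃ a : ℝ, 1 + Real.exp a < 4 * Real.exp (-(m * a)) ∧ 0 < a := by
    have hcont : Continuous fun a : ℝ => 4 * Real.exp (-(m * a)) - (1 + Real.exp a) := by fun_prop
    have h1 := (hcont.tendsto 0).eventually (lt_mem_nhds (a := 0) (by norm_num))
    obtain ⟨a, h2, h3⟩ := ((h1.filter_mono (nhdsWithin_le_nhds (s := Ioi 0))).and
      self_mem_nhdsWithin).exists
    exact ⟨a, by linarith, h3⟩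
  set c := laplaceExponent ν 1 / 4 with hc
  set d := 1 - Real.exp (-a) with hd
  have hd0 : 0 < d := by simpa [hd] using ha
  set A := laplaceExponent ν 1 / d with hA
  have hc0 : 0 < c := by linarith
  have hA0 : 0 < A := div_pos hΨ hd0
  refine ⟨A ^ 2 / (c * d), by positivity, ?_⟩
  intro Ω _ P _ X hX α β hαβ
  have hψ : ∀ n : ℕ, 0 < laplaceExponent ν (n + 1) := fun n =>
    hν.laplaceExponent_pos hν0 (by positivity)
  have htop := hX.hasLaplaceIncrements.ae_expFunctional_ne_top hψ
  have hsmall : ∀ᶠ h : ℝ≥0 in 𝓝[>] 0, c * h < 1 := by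
    have hcont : Continuous fun h : ℝ≥0 => c * (h : ℝ) := by fun_prop
    exact ((hcont.tendsto 0).eventually (gt_mem_nhds (by simp))).filter_mono nhdsWithin_le_nhds
  -- A large increment has probability at most `A h`, and the geometric series is at most `1 / (c
  -- h)`. The number of positions contributes a factor of order `(β - α) / (h d)`, so all powers of
  -- `h` cancel in the limit.
  have hbound : ∀ᶠ h : ℝ≥0 in 𝓝[>] 0, P {ω | (expFunctional X ω).toReal ∈ Ioo α β} ≤
      ENNReal.ofReal (A ^ 2 / c * (h * (1 + 2 / d) + (β - α) / d)) := by
    filter_upwards [hX.eventually_lintegral_le hν ham.le (c := c) (by linarith),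
      self_mem_nhdsWithin, hsmall] with h hr hpos hch
    have hpos' : (0 : ℝ) < h := NNReal.coe_pos.2 hpos
    set ξ : ℕ → Ω → ℝ := fun j ω => X ((j + 1 : ℕ) * h) ω - X (j * h) ω with hξ
    have hξm : ∀ k, Measurable (ξ k) := fun k => (hX.measurable _).sub (hX.measurable _)
    have hind : iIndepFun ξ P := hX.indep.nat (t := fun j : ℕ => (j : ℝ≥0) * h)
      fun i j hij => by
        dsimp only
        gcongr
    have hξ0 : ξ 0 = X h := by
      funext ω
      simp [hξ, hX.zero]
    have hid : ∀ k, P.map (ξ k) = P.map (ξ 0) := fun k => by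
      have := (hX.stationary (k * h) h).map_eq
      rw [hξ0, ← this]
      congr 1
      funext ω
      simp only [hξ]
      congr 2
      push_cast
      ring
    have hRlt : ENNReal.ofReal (1 - c * h) < 1 := by
      rw [← ENNReal.ofReal_one, ENNReal.ofReal_lt_ofReal_iff one_pos]
      linarith [mul_pos hc0 hpos']
    have hR : ENNReal.ofReal (c * h) ≤ 1 - ∫⁻ ω, (Iio a).indicator
        (fun y => ENNReal.ofReal (Real.exp y)) (ξ 0 ω) ∂P := by
      have : ENNReal.ofReal (c * h) = 1 - ENNReal.ofReal (1 - c * h) := by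
        rw [← ENNReal.ofReal_one, ← ENNReal.ofReal_sub _ (by linarith)]
        congr 1
        ring
      rw [this, hξ0]
      exact tsub_le_tsub_left hr 1
    have hq : P (ξ 0 ⁻¹' Iio a) < 1 := by
      refine lt_of_le_of_lt (le_trans ?_ hr) hRlt
      rw [hξ0, ← lintegral_indicator_one (hX.measurable h measurableSet_Iio)]
      refine lintegral_mono fun ω => ?_
      by_cases hω : X h ω < a
      · rw [indicator_of_mem (by exact hω), indicator_of_mem (mem_Iio.2 hω), Pi.one_apply,
          ← ENNReal.ofReal_one]
        exact ENNReal.ofReal_le_ofReal (Real.one_le_exp (hX.nonneg h ω))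
      · rw [indicator_of_notMem (by exact hω)]
        exact zero_le
    have hsandwich := fun (ω : Ω) (hω : expFunctional X ω ≠ ∞) =>
      mul_discountedSum_mem_Icc hX.mono hX.zero hpos hω
    -- `h` times the discounted sum exceeds the functional by at most `h`, so the rescaled interval
    -- is lengthened by `1` on the right.
    have hαβ' : α / h ≤ β / h + 1 := by
      have : α / h ≤ β / h := by gcongr
      linarith
    have key := measure_discountedSum_mem_Ioo_le hξm hind hid
      (fun k ω => sub_nonneg.2 (hX.mono ω (by gcongr; simp)))
      (htop.mono fun ω hω => (hsandwich ω hω).1) ha hq hαβ'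
    refine (measure_mono_ae (htop.mono fun ω hω hI => ?_)).trans (key.trans ?_)
    · obtain ⟨-, h1, h2⟩ := hsandwich ω hω
      change discountedSum (fun k => ξ k ω) ∈ _
      refine ⟨?_, ?_⟩
      · rw [div_lt_iff₀' hpos']
        exact lt_of_lt_of_le hI.1 h1
      · rw [div_add_one hpos'.ne', lt_div_iff₀' hpos']
        linarith [hI.2]
    · have hp : P (ξ 0 ⁻¹' Ici a) ≤ ENNReal.ofReal (A * h) := by
        rw [hξ0]
        exact hX.measure_ge_le ha h
      calc _ ≤ ENNReal.ofReal (1 + (1 + (β / h + 1 - α / h)) / d) * ENNReal.ofReal (A * h) ^ 2 *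
            (ENNReal.ofReal (c * h))⁻¹ := by gcongr
        _ = ENNReal.ofReal ((1 + (1 + (β / h + 1 - α / h)) / d) * (A * h) ^ 2 * (c * h)⁻¹) := by
            rw [ENNReal.ofReal_mul' (inv_nonneg.2 (mul_pos hc0 hpos').le),
              ENNReal.ofReal_mul' (sq_nonneg (A * h)), ENNReal.ofReal_pow (by positivity),
              ENNReal.ofReal_inv_of_pos (by positivity)]
        _ = _ := by
            congr 1
            field_simp
            ring
  have hlim : Tendsto (fun h : ℝ≥0 => ENNReal.ofReal
      (A ^ 2 / c * (h * (1 + 2 / d) + (β - α) / d))) (𝓝[>] 0)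
      (𝓝 (ENNReal.ofReal (A ^ 2 / (c * d) * (β - α)))) := by
    have hcont : Continuous fun h : ℝ≥0 => ENNReal.ofReal
      (A ^ 2 / c * (h * (1 + 2 / d) + (β - α) / d)) :=
      ENNReal.continuous_ofReal.comp (by fun_prop)
    have h1 := (hcont.tendsto 0).mono_left (nhdsWithin_le_nhds (s := Ioi 0))
    convert h1 using 3
    rw [NNReal.coe_zero]
    field_simp
    ring
  exact ge_of_tendsto hlim hbound

end Density

/-! ### The rate and the loss caused by rounding -/

section Rate

variable {ν : Measure ℝ} {ε : ℝ}

theorem integrable_min_const (hν : IsSubordinatorLevyMeasure ν) (hε : 0 < ε) :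
    Integrable (fun z => min z ε) ν := by
  refine (hν.integrable_min.const_mul (max 1 ε)).mono' (by fun_prop) ?_
  filter_upwards [hν.ae_pos] with z hz
  rw [Real.norm_of_nonneg (le_min hz.le hε.le)]
  rcases le_total 1 z with h | h
  · rw [min_eq_left h, mul_one]
    exact (min_le_right _ _).trans (le_max_right _ _)
  · rw [min_eq_right h]
    exact (min_le_left _ _).trans (le_mul_of_one_le_left hz.le (le_max_left _ _))

/-- Layer-cake formula: the set where `min z ε ≥ t` is `[t, ∞)` for `t ≤ ε` and empty beyond. -/
theorem sq_rate (hν : IsSubordinatorLevyMeasure ν) (hε : 0 < ε) :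
    rate ν ε ^ 2 = ∫ z, min z ε ∂ν := by
  rw [rate, Real.sq_sqrt
    (intervalIntegral.integral_nonneg hε.le fun _ _ => measureReal_nonneg),
    (integrable_min_const hν hε).integral_eq_integral_meas_le
      (hν.ae_pos.mono fun z hz => le_min hz.le hε.le),
    intervalIntegral.integral_of_le hε.le, ← Ioi_inter_Iic,
    ← setIntegral_indicator measurableSet_Iic]
  refine integral_congr_ae (ae_of_all _ fun t => ?_)
  dsimp only
  by_cases ht : t ≤ ε
  · rw [indicator_of_mem (mem_Iic.2 ht)]
    congr 1
    ext z
    simp [ht]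
  · rw [indicator_of_notMem (by simpa using ht)]
    simp [ht]

theorem rate_pos (hν : IsSubordinatorLevyMeasure ν) (hε : 0 < ε) (h : ν (Ici ε) ≠ 0) :
    0 < rate ν ε := by
  have h1 := mul_meas_ge_le_integral_of_nonneg (hν.ae_pos.mono fun z hz => le_min hz.le hε.le)
    (integrable_min_const hν hε) ε
  have h2 : {z : ℝ | ε ≤ min z ε} = Ici ε := by ext z; simp
  rw [h2, ← sq_rate hν hε] at h1
  have h3 : 0 < ν.real (Ici ε) := ENNReal.toReal_pos h (hν.measure_Ici_lt_top hε).ne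
  have h4 : 0 < rate ν ε ^ 2 := lt_of_lt_of_le (by positivity) h1
  exact lt_of_le_of_ne (Real.sqrt_nonneg _) fun h5 => by rw [← h5] at h4; simp at h4

/-- Rounding `z` to `y` loses at most `z` and less than `ε`, and `e^{-y} - e^{-z} ≤ z - y`. -/
theorem laplaceExponent_sub_latticeExponent_le (hν : IsSubordinatorLevyMeasure ν) (hε : 0 < ε) :
    laplaceExponent ν 1 - latticeExponent ν ε 1 ≤ rate ν ε ^ 2 := by
  rw [sq_rate hν hε, laplaceExponent, latticeExponent,
    ← integral_sub (hν.integrable_one_sub_exp zero_le_one) (integrable_lattice hν hε zero_le_one)]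
  refine integral_mono_ae ((hν.integrable_one_sub_exp zero_le_one).sub
    (integrable_lattice hν hε zero_le_one)) (integrable_min_const hν hε) ?_
  filter_upwards [hν.ae_pos] with z hz
  have h1 := roundDown_nonneg hε z
  have h2 := roundDown_le hε hz.le
  have h3 := lt_roundDown_add hε z
  simp only [one_mul]
  generalize roundDown ε z = y at h1 h2 h3 ⊢
  have h4 : Real.exp (-z) = Real.exp (-y) * Real.exp (-(z - y)) := by
    rw [← Real.exp_add]; ring_nf
  have h5 := Real.add_one_le_exp (-(z - y))
  have h6 : Real.exp (-y) ≤ 1 := by simpa using h1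
  have h7 : Real.exp (-y) - Real.exp (-z) ≤ z - y := by
    rw [h4]
    nlinarith [Real.exp_pos (-y)]
  exact le_min (by linarith) (by linarith)

/-- A jump of size at least `b` keeps at least `b / 2` after rounding. The lower bound does not
depend on `ε`, as the uniform constant requires. -/
theorem mul_measure_Ici_le_latticeExponent (hν : IsSubordinatorLevyMeasure ν) (hε : 0 < ε)
    {b : ℝ} (hb : 0 < b) (hεb : ε ≤ b / 2) :
    (1 - Real.exp (-(b / 2))) * ν.real (Ici b) ≤ latticeExponent ν ε 1 := by
  have hint := integrable_lattice hν hε (u := 1) zero_le_one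
  have hκ : 0 < 1 - Real.exp (-(b / 2)) := by simpa using hb
  have h1 := mul_meas_ge_le_integral_of_nonneg (ae_of_all _ fun z => by
    have := roundDown_nonneg hε z
    simpa using this) hint (1 - Real.exp (-(b / 2)))
  refine le_trans (mul_le_mul_of_nonneg_left (measureReal_mono (fun z hz => ?_)
    (hint.measure_ge_lt_top hκ).ne) hκ.le) h1
  have h2 := lt_roundDown_add hε z
  have h3 : b ≤ z := hz
  rw [mem_ofPred_eq, one_mul]
  exact sub_le_sub_left (Real.exp_le_exp.2 (by linarith)) 1

end Rate

/-! ### Comparison of the two exponential functionals -/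

section Comparison

variable {Ω : Type u} [mΩ : MeasurableSpace Ω] {P : Measure Ω}
  {ν : Measure ℝ} {X : ℝ≥0 → Ω → ℝ} {ε : ℝ}

theorem IsRegularSubordinator.expFunctional_le_discretised (hX : IsRegularSubordinator P ν X)
    (hε : 0 < ε) (ω : Ω) : expFunctional X ω ≤ expFunctional (discretised X ε) ω :=
  lintegral_mono fun _ => ENNReal.ofReal_le_ofReal
    (Real.exp_le_exp.2 (neg_le_neg (hX.discretised_le hε _ ω)))

variable [IsProbabilityMeasure P]

/-- Markov's inequality for the nonnegative difference of the functionals, whose mean comes from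
their first moments. -/
theorem IsRegularSubordinator.measureReal_add_le_discretised_le
    (hν : IsSubordinatorLevyMeasure ν) (hX : IsRegularSubordinator P ν X) (hε : 0 < ε)
    (h : ν (Ici ε) ≠ 0) {δ : ℝ} (hδ : 0 ≤ δ) :
    δ * P.real {ω | expFunctional X ω + ENNReal.ofReal δ ≤ expFunctional (discretised X ε) ω} ≤
      1 / latticeExponent ν ε 1 - 1 / laplaceExponent ν 1 := by
  have hν0 : ν ≠ 0 := fun h0 => h (by simp [h0])
  have hL := hX.hasLaplaceIncrements
  have hLε := hX.hasLaplaceIncrements_discretised hν hε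
  have h1 := hL.lintegral_expFunctional_pow
    (fun n => hν.laplaceExponent_pos hν0 (by positivity)) 1
  have h2 := hLε.lintegral_expFunctional_pow
    (fun n => latticeExponent_pos hν hε h (by positivity)) 1
  simp only [pow_one, Finset.prod_range_one, Nat.cast_zero, zero_add] at h1 h2
  have hm := hL.measurable_expFunctional
  have hmε := hLε.measurable_expFunctional
  set E := {ω | expFunctional X ω + ENNReal.ofReal δ ≤ expFunctional (discretised X ε) ω}
  have hE : MeasurableSet E := measurableSet_le (hm.add_const _) hmε
  have h3 : ∫⁻ ω, expFunctional X ω ∂P + ENNReal.ofReal δ * P E ≤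
      ∫⁻ ω, expFunctional (discretised X ε) ω ∂P := by
    rw [← lintegral_indicator_const hE, ← lintegral_add_left hm]
    refine lintegral_mono fun ω => ?_
    by_cases hω : ω ∈ E
    · rw [indicator_of_mem hω]
      exact hω
    · simpa [hω] using hX.expFunctional_le_discretised hε ω
  have hp1 := hν.laplaceExponent_pos hν0 one_pos
  have hp2 := latticeExponent_pos hν hε h one_pos
  rw [h1, h2, ← ENNReal.ofReal_toReal (measure_ne_top P E), ← ENNReal.ofReal_mul hδ,
    ← ENNReal.ofReal_add (by positivity) (by positivity),
    ENNReal.ofReal_le_ofReal_iff (by positivity)] at h3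
  change _ + δ * P.real E ≤ _ at h3
  linarith

/-- If only one of the functionals is at most `x`, either `I_{[X]}` is within `δ` of `x` or the two
differ by at least `δ`. The bounds are `2 C δ` and a multiple of `ϱ² / δ`; the choice `δ = ϱ`
balances them. -/
theorem IsRegularSubordinator.abs_expFunctionalCDF_sub_le
    (hν : IsSubordinatorLevyMeasure ν) (hX : IsRegularSubordinator P ν X) (hε : 0 < ε)
    (h : ν (Ici ε) ≠ 0) {C : ℝ} (hC0 : 0 < C)
    (hC : ∀ α β : ℝ, α ≤ β →
      P {ω | (expFunctional X ω).toReal ∈ Ioo α β} ≤ ENNReal.ofReal (C * (β - α)))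
    {κ : ℝ} (hκ0 : 0 < κ) (hκ : κ ≤ latticeExponent ν ε 1) {x : ℝ} (hx : 0 ≤ x) :
    |expFunctionalCDF P X x - expFunctionalCDF P (discretised X ε) x| ≤
      (2 * C + 1 / (laplaceExponent ν 1 * κ)) * rate ν ε := by
  have hν0 : ν ≠ 0 := fun h0 => h (by simp [h0])
  have hδ := rate_pos hν hε h
  set δ := rate ν ε with hδdef
  have hp1 := hν.laplaceExponent_pos hν0 one_pos
  have hp2 := latticeExponent_pos hν hε h one_pos
  have htop := hX.hasLaplaceIncrements.ae_expFunctional_ne_top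
    (fun n => hν.laplaceExponent_pos hν0 (by positivity))
  have h1 : expFunctionalCDF P (discretised X ε) x ≤ expFunctionalCDF P X x :=
    measureReal_mono fun ω hω => (hX.expFunctional_le_discretised hε ω).trans hω
  set E := {ω | expFunctional X ω + ENNReal.ofReal δ ≤ expFunctional (discretised X ε) ω}
  have h2 : expFunctionalCDF P X x ≤ expFunctionalCDF P (discretised X ε) x +
      (P.real {ω | (expFunctional X ω).toReal ∈ Ioo (x - δ) (x + δ)} + P.real E) := by
    refine le_trans (ENNReal.toReal_mono (measure_ne_top _ _)
      (measure_mono_ae (htop.mono fun ω hω hI => ?_)))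
      ((measureReal_union_le {ω | expFunctional (discretised X ε) ω ≤ ENNReal.ofReal x} _).trans
        (add_le_add le_rfl (measureReal_union_le _ _)))
    by_contra hc
    change ¬(expFunctional (discretised X ε) ω ≤ _ ∨
      (expFunctional X ω).toReal ∈ Ioo (x - δ) (x + δ) ∨ ω ∈ E) at hc
    push Not at hc
    obtain ⟨c1, c2, c3⟩ := hc
    replace c3 := not_le.1 (show ¬expFunctional X ω + ENNReal.ofReal δ ≤
      expFunctional (discretised X ε) ω from c3)
    have hI' : expFunctional X ω ≤ ENNReal.ofReal x := hI
    refine c2 ⟨?_, ?_⟩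
    · have h3 : ENNReal.ofReal x < expFunctional X ω + ENNReal.ofReal δ := c1.trans c3
      have h4 := (ENNReal.toReal_lt_toReal ENNReal.ofReal_ne_top
        (ENNReal.add_ne_top.2 ⟨hω, ENNReal.ofReal_ne_top⟩)).2 h3
      rw [ENNReal.toReal_add hω ENNReal.ofReal_ne_top, ENNReal.toReal_ofReal hx,
        ENNReal.toReal_ofReal hδ.le] at h4
      linarith
    · have := (ENNReal.le_ofReal_iff_toReal_le hω hx).1 hI'
      linarith
  have h3 : P.real {ω | (expFunctional X ω).toReal ∈ Ioo (x - δ) (x + δ)} ≤ 2 * C * δ := by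
    refine (ENNReal.toReal_mono ENNReal.ofReal_ne_top
      (hC (x - δ) (x + δ) (by linarith))).trans (le_of_eq ?_)
    rw [ENNReal.toReal_ofReal (mul_nonneg hC0.le (by linarith))]
    ring
  have h4 : P.real E ≤ 1 / (laplaceExponent ν 1 * κ) * δ := by
    have h5 := hX.measureReal_add_le_discretised_le hν hε h hδ.le
    have h6 := laplaceExponent_sub_latticeExponent_le hν hε
    have h7 : 1 / latticeExponent ν ε 1 - 1 / laplaceExponent ν 1 ≤
        δ ^ 2 / (laplaceExponent ν 1 * κ) := by
      rw [div_sub_div _ _ hp2.ne' hp1.ne', one_mul, mul_one, mul_comm (latticeExponent ν ε 1)]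
      gcongr
    refine le_of_mul_le_mul_left ((h5.trans h7).trans (le_of_eq ?_)) hδ
    ring
  rw [abs_of_nonneg (by linarith), add_mul]
  linarith

end Comparison

end ExpFunctional

theorem mainTheorem3 (ν : Measure ℝ) (hν : IsSubordinatorLevyMeasure ν) (hν0 : ν ≠ 0) :
    -- the constants depend on the Lévy measure only
    ∃ C > 0, ∃ ε₀ ∈ Ioo (0 : ℝ) 1,
      ∀ (Ω : Type u) [MeasurableSpace Ω] (P : Measure Ω) [IsProbabilityMeasure P]
        (X : ℝ≥0 → Ω → ℝ), IsPureJumpSubordinator P ν X →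
        -- the series converge and give the distribution function for the lattice process
        (∀ ε ∈ Ioo (0 : ℝ) 1, ν (Ici ε) ≠ 0 →
          Summable (fun k : ℕ => latticeMass ν ε (k + 1)) ∧
          0 < totalMass ν ε ∧
          Summable (fun j : ℕ => coeff ν ε j * Real.exp (-(ε * j))) ∧
          0 < ∑' j : ℕ, coeff ν ε j * Real.exp (-(ε * j)) ∧
          ∀ x > 0,
            Summable (fun j : ℕ => coeff ν ε j * Real.exp (-(ε * j)) *
              Real.exp (-(Real.exp (ε * j) * x * totalMass ν ε))) ∧
            expFunctionalCDF P (discretised X ε) x = seriesCDF ν ε x) ∧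
        -- the error estimate, uniform in `x`
        (∀ ε ∈ Ioo (0 : ℝ) ε₀, ν (Ici ε) ≠ 0 ∧
          ∀ x > 0, |expFunctionalCDF P X x - seriesCDF ν ε x| ≤ C * rate ν ε) := by
  have hconc := exists_measure_expFunctional_mem_Ioo_le.{u} hν hν0
  obtain ⟨C, hC0, hC⟩ := hconc
  obtain ⟨b, hb, hνb⟩ := hν.exists_measure_Ici_ne_zero hν0
  have hΨ := hν.laplaceExponent_pos hν0 one_pos
  have hκ : 0 < (1 - Real.exp (-(b / 2))) * ν.real (Ici b) := by
    have h1 : 0 < 1 - Real.exp (-(b / 2)) := by simpa using hb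
    exact mul_pos h1 (ENNReal.toReal_pos hνb (hν.measure_Ici_lt_top hb).ne)
  -- The level `b` carries mass of `ν`. For `ε < b / 2` the mass of `[ε, ∞)` is then nonzero and the
  -- exponent at `1` is bounded below uniformly.
  refine ⟨2 * C + 1 / (laplaceExponent ν 1 * ((1 - Real.exp (-(b / 2))) * ν.real (Ici b))),
    by positivity, min (b / 2) (1 / 2), ⟨by positivity, (min_le_right _ _).trans_lt (by norm_num)⟩,
    ?_⟩
  intro Ω _ P _ X hX
  obtain ⟨Y, hY, hXY⟩ := hX.exists_regular
  have hcdf : ∀ x, expFunctionalCDF P X x = expFunctionalCDF P Y x := fun x =>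
    expFunctionalCDF_congr hXY x
  have hcdfε : ∀ ε x, expFunctionalCDF P (discretised X ε) x =
      expFunctionalCDF P (discretised Y ε) x := fun ε x =>
    expFunctionalCDF_congr (hXY.mono fun ω hω t => discretised_congr hω ε t) x
  constructor
  · intro ε hε h
    have hs := summable_coeff_mul_exp hν hε.1 h zero_le_one
    have hC1 := coeffSeries_one_pos hν hε.1 h
    unfold coeffSeries at hC1
    simp only [one_mul] at hs hC1
    refine ⟨(hasSum_latticeMass hν hε.1).summable, totalMass_pos hν hε.1 h, hs.of_norm, hC1,
      fun x hx => ⟨(one_sub_tsum_eq_seriesCDF hν hε.1 h hx.le).1, ?_⟩⟩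
    rw [hcdfε, hY.expFunctionalCDF_discretised hν hε.1 h hx.le]
  · intro ε hε
    have hε0 : 0 < ε := hε.1
    have hεb : ε ≤ b / 2 := hε.2.le.trans (min_le_left _ _)
    have h : ν (Ici ε) ≠ 0 := fun h0 =>
      hνb (measure_mono_null (Ici_subset_Ici.2 (by linarith)) h0)
    refine ⟨h, fun x hx => ?_⟩
    rw [hcdf, ← hY.expFunctionalCDF_discretised hν hε0 h hx.le]
    exact hY.abs_expFunctionalCDF_sub_le hν hε0 h hC0 (hC Ω P Y hY) hκ
      (mul_measure_Ici_le_latticeExponent hν hε0 hb hεb) hx.le
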